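/- Let $k$ be a commutative ring and write $\otimes=\otimes_k$. Let $A$ be a $k$-algebra which is projective as a $k$-module, $\sigma$ a $k$-algebra automorphism of $A$, $\delta\colon A\to A$ a $\sigma$-derivation (a $k$-linear map with $\delta(ab)=\delta(a)b+\sigma(a)\delta(b)$), and $E=A[x;\sigma,\delta]$ the Ore extension: the $k$-algebra containing $A$ which is free as a left $A$-module on $1,x,x^2,\dots$, with $xa=\sigma(a)x+\delta(a)$ for $a\in A$. Conventions. For a $k$-algebra $S$ put $S^e=S\otimes S^{op}$; $S^e$-modules are $S$-$S$-bimodules on which $k$ acts centrally. For an $S^e$-module $M$, $H^n(S,M)$ is Hochschild cohomology, the cohomology of the Hochschild cochain complex $C^n(S,M)=\mathrm{Hom}_k(S^{\otimes n},M)$. For an endomorphism $\tau$ of $S$, $S\otimes S^{\tau}$ denotes $S\otimes S$ with the outer structure $a\cdot(u\otimes v)\cdot b=au\otimes v\tau(b)$; this structure is used to compute $H^n(S,S\otimes S^\tau)$ (for $\tau=\mathrm{id}$ we write $S\otimes S$). The inner structure $b\cdot(u\otimes v)\cdot a=ua\otimes bv$ commutes with it and makes $H^n(S,S\otimes S^{\tau})$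 an $S^e$-module. Suppose that (1) $A$ has a (possibly infinite) resolution by finitely generated projective $A^e$-modules; (2) for some $d\in\mathbb N$, $H^i(A,A\otimes A)=0$ for all $i\neq d$. Then $H^i(E,E\otimes E)=0$ for all $i\ne d+1$. Moreover, let $\omega'=H^d(A,A\otimes A^{\sigma^{-1}})$ and $\Omega=H^{d+1}(E,E\otimes E)$. Then there is an isomorphism of $E^e$-modules $\Omega\cong\omega'\otimes k[x]$, where the $E^e$-module structure on $\omega'\otimes k[x]$ is given, for $a\in A$, $n\in\mathbb N$ and $w\in\omega'$, by $$a\triangleright(w\otimes x^n)=\sum_{i=0}^n q^n_i(a)\,w\otimes x^i,\qquad x\triangleright(w\otimes x^n)=w\otimes x^{n+1},\qquad (w\otimes x^n)\triangleleft a=wa\otimes x^n,$$ and, for every $d$-cocycle $\tilde f\in C^d(A,A\otimes A^{\sigma^{-1}})$ with class $[\tilde f]\in\omega'$, by $$([\tilde f]\otimes x^n)\triangleleft x=[f_2]\otimes x^{n+1}-[f_3]\otimes x^n .$$ Here $q^n_i\colon A\to A$ is the sum of all compositions $\sigma_1\sigma_2\cdots\sigma_n$ with each $\sigma_j$ equal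 to $\sigma^{-1}$ or $-\delta\sigma^{-1}$ and with $\sigma^{-1}$ occurring exactly $i$ times ($q^0_0=\mathrm{id}$), and, with $f=(\sigma^{-1}\otimes\mathrm{id})\circ\tilde f\circ\sigma^{\otimes d}$, $$f_2=(\mathrm{id}\otimes\sigma^{-1})\circ f,$$ $$f_3=(\delta\otimes\mathrm{id})\circ f\circ(\sigma^{-1})^{\otimes d}+(\mathrm{id}\otimes\delta\sigma^{-1})\circ f-\sum_{j=1}^{d}f\circ\big(\mathrm{id}^{\otimes j-1}\otimes\delta\sigma^{-1}\otimes(\sigma^{-1})^{\otimes d-j}\big);$$ $f_2$ and $f_3$ are again cocycles in $C^d(A,A\otimes A^{\sigma^{-1}})$. -/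

import Mathlib

open scoped TensorProduct Polynomial

namespace OreHochschild

noncomputable section

/-! ### Bimodules over a `k`-algebra, that is, modules over the enveloping algebra -/

/-- An `S`-`S`-bimodule structure (with central action of `k`) on the `k`-module `M`, i.e. a module
structure over the enveloping algebra `Sᵉ = S ⊗ Sᵒᵖ`: a left action of `S` and a right action of `S`
(a left action of `Sᵒᵖ`) by `k`-linear maps which commute. -/
structure BimoduleStr (k S M : Type*) [CommRing k] [Ring S] [Algebra k S] [AddCommGroup M]
    [Module k M] where
  /-- the left action -/
  left : S →ₐ[k] Module.End k M
  /-- the right action -/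
  right : Sᵐᵒᵖ →ₐ[k] Module.End k M
  comm : ∀ (a : S) (b : Sᵐᵒᵖ), Commute (left a) (right b)

namespace BimoduleStr

/-- The regular bimodule `S`. -/
def regular (k S : Type*) [CommRing k] [Ring S] [Algebra k S] : BimoduleStr k S S where
  left := Algebra.lsmul k k S
  right := Algebra.lsmul k k S
  comm a b := by
    ext s
    simp [mul_assoc]

section

variable {k S T M N : Type*} [CommRing k] [Ring S] [Algebra k S] [Ring T] [Algebra k T]
  [AddCommGroup M] [Module k M] [AddCommGroup N] [Module k N]

/-- Pull-back of a bimodule along an algebra morphism `ν` on the left and `τ` on the right: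
`a · m · b = ν(a) m τ(b)`. For `S = T` it is the twisted bimodule `{}^ν M^τ`. -/
def twist (B : BimoduleStr k S M) (ν τ : T →ₐ[k] S) : BimoduleStr k T M where
  left := B.left.comp ν
  right := B.right.comp (AlgHom.op τ)
  comm _ _ := B.comm _ _

/-- The outer structure on `M ⊗ N`: `a · (m ⊗ n) · b = a m ⊗ n b`. -/
def outer (B : BimoduleStr k S M) (B' : BimoduleStr k S N) : BimoduleStr k S (M ⊗[k] N) where
  left := (Module.End.rTensorAlgHom k M N).comp B.left
  right := (Module.End.lTensorAlgHom k N M).comp B'.right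
  comm _ _ := TensorProduct.ext' fun _ _ => rfl

theorem outer_left_tmul (B : BimoduleStr k S M) (B' : BimoduleStr k S N) (s : S) (m : M) (n : N) :
    (B.outer B').left s (m ⊗ₜ n) = B.left s m ⊗ₜ n := rfl

theorem outer_right_tmul (B : BimoduleStr k S M) (B' : BimoduleStr k S N) (s : Sᵐᵒᵖ) (m : M) (n : N) :
    (B.outer B').right s (m ⊗ₜ n) = m ⊗ₜ B'.right s n := rfl

/-- The inner structure on `M ⊗ N`: `b · (m ⊗ n) · a = m a ⊗ b n`. -/
def inner (B : BimoduleStr k S M) (B' : BimoduleStr k S N) : BimoduleStr k S (M ⊗[k] N) where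
  left := (Module.End.lTensorAlgHom k N M).comp B'.left
  right := (Module.End.rTensorAlgHom k M N).comp B.right
  comm _ _ := TensorProduct.ext' fun _ _ => rfl

theorem inner_left_tmul (B : BimoduleStr k S M) (B' : BimoduleStr k S N) (s : S) (m : M) (n : N) :
    (B.inner B').left s (m ⊗ₜ n) = m ⊗ₜ B'.left s n := rfl

theorem inner_right_tmul (B : BimoduleStr k S M) (B' : BimoduleStr k S N) (s : Sᵐᵒᵖ) (m : M) (n : N) :
    (B.inner B').right s (m ⊗ₜ n) = B.right s m ⊗ₜ n := rfl

/-- A `k`-linear map is a morphism of bimodules if it respects both actions. -/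
def IsHom (B : BimoduleStr k S M) (B' : BimoduleStr k S N) (φ : M →ₗ[k] N) : Prop :=
  (∀ s m, φ (B.left s m) = B'.left s (φ m)) ∧ (∀ s m, φ (B.right s m) = B'.right s (φ m))

/-- The algebra of bimodule endomorphisms of `M`. -/
def endo (B : BimoduleStr k S M) : Subalgebra k (Module.End k M) :=
  Subalgebra.centralizer k (Set.range B.left ∪ Set.range B.right)

theorem mem_endo {B : BimoduleStr k S M} {φ : Module.End k M} :
    φ ∈ B.endo ↔ B.IsHom B φ := by
  simp only [endo, Subalgebra.mem_centralizer_iff, Set.mem_union, Set.mem_range, IsHom]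
  constructor
  · intro h
    exact ⟨fun s m => (LinearMap.congr_fun (h _ (Or.inl ⟨s, rfl⟩)) m).symm,
      fun s m => (LinearMap.congr_fun (h _ (Or.inr ⟨s, rfl⟩)) m).symm⟩
  · rintro ⟨h1, h2⟩ _ (⟨s, rfl⟩ | ⟨s, rfl⟩)
    · ext m; exact (h1 s m).symm
    · ext m; exact (h2 s m).symm

end

end BimoduleStr

/-! ### Hochschild cohomology through the Hochschild cochain complex -/

/-- Hochschild cochains `Cⁿ(A, M) = Hom_k(A^{⊗ n}, M)`, as `k`-multilinear maps. -/
abbrev Cochain (k A M : Type*) [CommRing k] [Ring A] [Algebra k A] [AddCommGroup M] [Module k M]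
    (n : ℕ) : Type _ :=
  MultilinearMap k (fun _ : Fin n => A) M

section Cohomology

variable {k A S M : Type*} [CommRing k] [Ring A] [Algebra k A] [Ring S] [Algebra k S]
  [AddCommGroup M] [Module k M]

/-- The term `a₀ · f(a₁, …, aₙ)`. -/
def leftTerm (B : BimoduleStr k A M) {n : ℕ} (f : Cochain k A M n) : Cochain k A M (n + 1) where
  toFun a := B.left (a 0) (f (fun i => a i.succ))
  map_update_add' := by
    intro inst a i x y
    obtain rfl : inst = instDecidableEqFin _ := Subsingleton.elim _ _
    refine Fin.cases ?_ (fun j => ?_) i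
    · simp
    · have h : ∀ z : A, (fun l : Fin n => Function.update a j.succ z l.succ)
          = Function.update (fun l => a l.succ) j z := fun z =>
        funext fun l => by simp [Function.update_apply]
      simp [h, Function.update_of_ne (Fin.succ_ne_zero j).symm]
  map_update_smul' := by
    intro inst a i c x
    obtain rfl : inst = instDecidableEqFin _ := Subsingleton.elim _ _
    refine Fin.cases ?_ (fun j => ?_) i
    · simp
    · have h : ∀ z : A, (fun l : Fin n => Function.update a j.succ z l.succ)
          = Function.update (fun l => a l.succ) j z := fun z =>
        funext fun l => by simp [Function.update_apply]
      simp [h, Function.update_of_ne (Fin.succ_ne_zero j).symm]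

/-- The term `f(a₀, …, aₙ₋₁) · aₙ`. -/
def rightTerm (B : BimoduleStr k A M) {n : ℕ} (f : Cochain k A M n) : Cochain k A M (n + 1) where
  toFun a := B.right (MulOpposite.op (a (Fin.last n))) (f (fun i => a i.castSucc))
  map_update_add' := by
    intro inst a i x y
    obtain rfl : inst = instDecidableEqFin _ := Subsingleton.elim _ _
    refine Fin.lastCases ?_ (fun j => ?_) i
    · simp [(Fin.castSucc_lt_last _).ne]
    · have h : ∀ z : A, (fun l : Fin n => Function.update a j.castSucc z l.castSucc)
          = Function.update (fun l => a l.castSucc) j z := fun z =>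
        funext fun l => by simp [Function.update_apply]
      simp [h, Function.update_of_ne (Fin.castSucc_lt_last j).ne']
  map_update_smul' := by
    intro inst a i c x
    obtain rfl : inst = instDecidableEqFin _ := Subsingleton.elim _ _
    refine Fin.lastCases ?_ (fun j => ?_) i
    · simp [(Fin.castSucc_lt_last _).ne]
    · have h : ∀ z : A, (fun l : Fin n => Function.update a j.castSucc z l.castSucc)
          = Function.update (fun l => a l.castSucc) j z := fun z =>
        funext fun l => by simp [Function.update_apply]
      simp [h, Function.update_of_ne (Fin.castSucc_lt_last j).ne']

theorem exists_contract_update {n : ℕ} (j : Fin n) (a : Fin (n + 1) → A) (i : Fin (n + 1)) :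
    ∃ (i' : Fin n) (g : A →ₗ[k] A), ∀ z : A,
      Fin.contractNth j.castSucc (· * ·) (Function.update a i z)
        = Function.update (Fin.contractNth j.castSucc (· * ·) a) i' (g z) := by
  rcases lt_trichotomy (i : ℕ) (j : ℕ) with h | h | h
  · refine ⟨⟨i, by omega⟩, LinearMap.id, fun z => ?_⟩
    funext l
    simp only [Fin.contractNth, Function.update_apply, Fin.ext_iff, Fin.val_castSucc, Fin.val_succ,
      LinearMap.id_apply]
    split_ifs <;> first | rfl | omega
  · refine ⟨j, LinearMap.mulRight k (a j.succ), fun z => ?_⟩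
    funext l
    simp only [Fin.contractNth, Function.update_apply, Fin.ext_iff, Fin.val_castSucc, Fin.val_succ,
      LinearMap.mulRight_apply]
    split_ifs with h1 h2 h3 <;> first | rfl | omega | skip
    all_goals (have : l = j := Fin.ext ‹_›; subst this; rfl)
  · by_cases h' : (i : ℕ) = j + 1
    · refine ⟨j, LinearMap.mulLeft k (a j.castSucc), fun z => ?_⟩
      funext l
      simp only [Fin.contractNth, Function.update_apply, Fin.ext_iff, Fin.val_castSucc,
        Fin.val_succ, LinearMap.mulLeft_apply]
      split_ifs with h1 h2 h3 <;> first | rfl | omega | skip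
      all_goals (have : l = j := Fin.ext ‹_›; subst this; rfl)
    · refine ⟨⟨i - 1, by omega⟩, LinearMap.id, fun z => ?_⟩
      funext l
      simp only [Fin.contractNth, Function.update_apply, Fin.ext_iff, Fin.val_castSucc,
        Fin.val_succ, LinearMap.id_apply]
      split_ifs <;> first | rfl | omega

/-- The term `f(a₀, …, a_j a_{j+1}, …, aₙ)`. -/
def contractTerm {n : ℕ} (j : Fin n) (f : Cochain k A M n) : Cochain k A M (n + 1) where
  toFun a := f (Fin.contractNth j.castSucc (· * ·) a)
  map_update_add' := by
    intro inst a i x y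
    obtain rfl : inst = instDecidableEqFin _ := Subsingleton.elim _ _
    obtain ⟨i', g, h⟩ := exists_contract_update (k := k) j a i
    simp [h]
  map_update_smul' := by
    intro inst a i c x
    obtain rfl : inst = instDecidableEqFin _ := Subsingleton.elim _ _
    obtain ⟨i', g, h⟩ := exists_contract_update (k := k) j a i
    simp [h]

/-- The Hochschild differential `Cⁿ(A, M) → Cⁿ⁺¹(A, M)`. -/
def differential (B : BimoduleStr k A M) (n : ℕ) : Cochain k A M n →ₗ[k] Cochain k A M (n + 1) where
  toFun f := leftTerm B f + ∑ j : Fin n, (-1 : k) ^ ((j : ℕ) + 1) • contractTerm j f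
    + (-1 : k) ^ (n + 1) • rightTerm B f
  map_add' f g := by
    ext a
    simp [leftTerm, rightTerm, contractTerm, Finset.sum_add_distrib]
    abel
  map_smul' c f := by
    ext a
    simp [leftTerm, rightTerm, contractTerm, Finset.smul_sum,
      smul_comm c]

theorem differential_apply (B : BimoduleStr k A M) (n : ℕ) (f : Cochain k A M n) (a : Fin (n + 1) → A) :
    differential B n f a = B.left (a 0) (f (fun i => a i.succ))
      + ∑ j : Fin n, (-1 : k) ^ ((j : ℕ) + 1) • f (Fin.contractNth j.castSucc (· * ·) a)
      + (-1 : k) ^ (n + 1) •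
        B.right (MulOpposite.op (a (Fin.last n))) (f (fun i => a i.castSucc)) := by
  simp [differential, leftTerm, rightTerm, contractTerm]

/-- Hochschild `n`-cocycles. -/
def cocycles (B : BimoduleStr k A M) (n : ℕ) : Submodule k (Cochain k A M n) :=
  LinearMap.ker (differential B n)

/-- Hochschild `n`-coboundaries. -/
def coboundaries (B : BimoduleStr k A M) : (n : ℕ) → Submodule k (Cochain k A M n)
  | 0 => ⊥
  | n + 1 => LinearMap.range (differential B n)

/-- Hochschild cohomology `Hⁿ(A, M)`: cocycles modulo coboundaries. -/
abbrev HH (B : BimoduleStr k A M) (n : ℕ) : Type _ :=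
  cocycles B n ⧸ (coboundaries B n).comap (cocycles B n).subtype

/-- The class of a cocycle. -/
def HH.mk (B : BimoduleStr k A M) (n : ℕ) : cocycles B n →ₗ[k] HH B n :=
  Submodule.mkQ _

/-- Composition of cochains with endomorphisms of the coefficients. -/
def postcomp (k A M : Type*) [CommRing k] [Ring A] [Algebra k A] [AddCommGroup M] [Module k M]
    (n : ℕ) : Module.End k M →ₐ[k] Module.End k (Cochain k A M n) :=
  AlgHom.ofLinearMap
    { toFun := fun φ =>
        { toFun := fun f => φ.compMultilinearMap f
          map_add' := fun f g => by ext; simp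
          map_smul' := fun c f => by ext; simp }
      map_add' := fun φ ψ => by ext; simp
      map_smul' := fun c φ => by ext; simp }
    (by ext; simp) (fun φ ψ => by ext; simp)

theorem postcomp_apply (n : ℕ) (φ : Module.End k M) (f : Cochain k A M n) (a : Fin n → A) :
    postcomp k A M n φ f a = φ (f a) := rfl

theorem differential_postcomp (B : BimoduleStr k A M) (n : ℕ) {φ : Module.End k M} (hφ : φ ∈ B.endo)
    (f : Cochain k A M n) :
    differential B n (postcomp k A M n φ f) = postcomp k A M (n + 1) φ (differential B n f) := by
  obtain ⟨h1, h2⟩ := BimoduleStr.mem_endo.1 hφ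
  ext a
  simp [differential_apply, postcomp_apply, h1, h2]

theorem postcomp_mem_cocycles (B : BimoduleStr k A M) (n : ℕ) {φ : Module.End k M} (hφ : φ ∈ B.endo)
    {f : Cochain k A M n} (hf : f ∈ cocycles B n) : postcomp k A M n φ f ∈ cocycles B n := by
  rw [cocycles, LinearMap.mem_ker] at hf ⊢
  rw [differential_postcomp B n hφ, hf, map_zero]

theorem postcomp_mem_coboundaries (B : BimoduleStr k A M) (n : ℕ) {φ : Module.End k M} (hφ : φ ∈ B.endo)
    {f : Cochain k A M n} (hf : f ∈ coboundaries B n) :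
    postcomp k A M n φ f ∈ coboundaries B n := by
  cases n with
  | zero =>
    simp only [coboundaries, Submodule.mem_bot] at hf ⊢
    rw [hf, map_zero]
  | succ n =>
    obtain ⟨g, rfl⟩ := hf
    exact ⟨postcomp k A M n φ g, differential_postcomp B n hφ g⟩

/-- The map `[f] ↦ [φ ∘ f]` on `Hⁿ(A, M)` induced by a bimodule endomorphism `φ` of `M`. -/
def cohomologyMap (B : BimoduleStr k A M) (n : ℕ) (φ : B.endo) : Module.End k (HH B n) :=
  Submodule.mapQ _ _
    (((postcomp k A M n φ.1).comp (cocycles B n).subtype).codRestrict (cocycles B n)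
      fun f => postcomp_mem_cocycles B n φ.2 f.2)
    (fun _ hf => postcomp_mem_coboundaries B n φ.2 (Submodule.mem_comap.1 hf))

theorem cohomologyMap_mk (B : BimoduleStr k A M) (n : ℕ) (φ : B.endo) (f : cocycles B n) :
    cohomologyMap B n φ (HH.mk B n f)
      = HH.mk B n ⟨postcomp k A M n φ.1 f.1, postcomp_mem_cocycles B n φ.2 f.2⟩ := rfl

theorem HH.ext_mk {B : BimoduleStr k A M} {n : ℕ} {φ ψ : Module.End k (HH B n)}
    (h : ∀ f, φ (HH.mk B n f) = ψ (HH.mk B n f)) : φ = ψ :=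
  Submodule.linearMap_qext _ (LinearMap.ext h)

/-- Functoriality of Hochschild cohomology in the coefficients: the algebra of bimodule
endomorphisms of `M` acts on `Hⁿ(A, M)`. -/
def cohomologyAction (B : BimoduleStr k A M) (n : ℕ) : B.endo →ₐ[k] Module.End k (HH B n) :=
  AlgHom.ofLinearMap
    { toFun := cohomologyMap B n
      map_add' := fun φ ψ => HH.ext_mk fun f => by
        rw [LinearMap.add_apply]
        simp only [cohomologyMap_mk]
        rw [← map_add]
        congr 1
      map_smul' := fun c φ => HH.ext_mk fun f => by
        rw [LinearMap.smul_apply]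
        simp only [cohomologyMap_mk, RingHom.id_apply]
        rw [← map_smul]
        congr 1 }
    (HH.ext_mk fun f => by
      change cohomologyMap B n 1 _ = _
      rw [cohomologyMap_mk, Module.End.one_apply]
      congr 1)
    (fun φ ψ => HH.ext_mk fun f => by
      rw [Module.End.mul_apply]
      exact cohomologyMap_mk B n (φ * ψ) f)

theorem cohomologyAction_mk (B : BimoduleStr k A M) (n : ℕ) (φ : B.endo) (f : cocycles B n) :
    cohomologyAction B n φ (HH.mk B n f)
      = HH.mk B n ⟨postcomp k A M n φ.1 f.1, postcomp_mem_cocycles B n φ.2 f.2⟩ := rfl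

/-- If `M` carries, besides the `A`-bimodule structure `B` used to compute the cohomology, an
`S`-bimodule structure `B'` commuting with `B`, then `Hⁿ(A, M)` is an `S`-bimodule, by
`s · [f] · t = [s · f(-) · t]`. -/
def inducedBimod (B : BimoduleStr k A M) (B' : BimoduleStr k S M)
    (hl : ∀ s, B'.left s ∈ B.endo) (hr : ∀ s, B'.right s ∈ B.endo) (n : ℕ) :
    BimoduleStr k S (HH B n) where
  left := (cohomologyAction B n).comp (B'.left.codRestrict B.endo hl)
  right := (cohomologyAction B n).comp (B'.right.codRestrict B.endo hr)
  comm s t := by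
    have h : Commute (B'.left.codRestrict B.endo hl s) (B'.right.codRestrict B.endo hr t) :=
      Subtype.ext (B'.comm s t)
    exact h.map (cohomologyAction B n)

end Cohomology

/-! ### The coefficient bimodules `A ⊗ A` and `A ⊗ A^τ` -/

section Coefficients

variable (k : Type*) {A : Type*} [CommRing k] [Ring A] [Algebra k A]

/-- The outer bimodule structure on `A ⊗ A^τ`: `a · (u ⊗ v) · b = a u ⊗ v τ(b)`. -/
def outerTwisted (τ : A →ₐ[k] A) : BimoduleStr k A (A ⊗[k] A) :=
  (BimoduleStr.regular k A).outer ((BimoduleStr.regular k A).twist (AlgHom.id k A) τ)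

/-- The inner bimodule structure on `A ⊗ A^τ` (which does not involve `τ`, as only the left action
on the second factor is used): `b · (u ⊗ v) · a = u a ⊗ b v`. -/
def innerTwisted (τ : A →ₐ[k] A) : BimoduleStr k A (A ⊗[k] A) :=
  (BimoduleStr.regular k A).inner ((BimoduleStr.regular k A).twist (AlgHom.id k A) τ)

theorem innerTwisted_left_mem (τ : A →ₐ[k] A) (s : A) :
    (innerTwisted k τ).left s ∈ (outerTwisted k τ).endo := by
  refine BimoduleStr.mem_endo.2 ⟨fun t m => ?_, fun t m => ?_⟩
  · induction m with
    | zero => simp only [map_zero]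
    | add x y hx hy => simp only [map_add, hx, hy]
    | tmul x y => rfl
  · induction m with
    | zero => simp only [map_zero]
    | add x y hx hy => simp only [map_add, hx, hy]
    | tmul x y =>
      exact congrArg (x ⊗ₜ[k] ·) (mul_assoc s y (τ t.unop)).symm

theorem innerTwisted_right_mem (τ : A →ₐ[k] A) (s : Aᵐᵒᵖ) :
    (innerTwisted k τ).right s ∈ (outerTwisted k τ).endo := by
  refine BimoduleStr.mem_endo.2 ⟨fun t m => ?_, fun t m => ?_⟩
  · induction m with
    | zero => simp only [map_zero]
    | add x y hx hy => simp only [map_add, hx, hy]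
    | tmul x y => exact congrArg (· ⊗ₜ[k] y) (mul_assoc t x s.unop)
  · induction m with
    | zero => simp only [map_zero]
    | add x y hx hy => simp only [map_add, hx, hy]
    | tmul x y => rfl

/-- `Hⁿ(A, A ⊗ A^τ)`, computed with the outer structure. -/
abbrev HHTwisted (τ : A →ₐ[k] A) (n : ℕ) : Type _ := HH (outerTwisted k τ) n

/-- The bimodule structure of `Hⁿ(A, A ⊗ A^τ)`, induced by the inner structure. -/
def bimodHHTwisted (τ : A →ₐ[k] A) (n : ℕ) : BimoduleStr k A (HHTwisted k τ n) :=
  inducedBimod (outerTwisted k τ) (innerTwisted k τ) (innerTwisted_left_mem k τ)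
    (innerTwisted_right_mem k τ) n

variable (A)

/-- `Hⁿ(A, A ⊗ A)`, computed with the outer structure. -/
abbrev HHEnv (n : ℕ) : Type _ := HHTwisted k (AlgHom.id k A) n

/-- The bimodule structure of `Hⁿ(A, A ⊗ A)`, induced by the inner structure. -/
def bimodHHEnv (n : ℕ) : BimoduleStr k A (HHEnv k A n) := bimodHHTwisted k (AlgHom.id k A) n

end Coefficients

/-! ### Finitely generated projective bimodule resolutions -/

section Resolution

universe u v

attribute [local instance] instModuleTensorProductMop

/-- `A` has a resolution (possibly of infinite length) by finitely generated projective modules over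
the enveloping algebra `Aᵉ = A ⊗ Aᵒᵖ`, where `(a ⊗ b) · m = a m b`. -/
def HasFGProjectiveResolution (k : Type u) (A : Type v) [CommRing k] [Ring A] [Algebra k A] :
    Prop :=
  ∃ P : CategoryTheory.ProjectiveResolution (ModuleCat.of.{v} (A ⊗[k] Aᵐᵒᵖ) A),
    ∀ n, Module.Finite (A ⊗[k] Aᵐᵒᵖ) (P.complex.X n)

end Resolution

/-! ### Ore extensions -/

/-- A `σ`-derivation of `A`: a `k`-linear map `δ` with `δ(ab) = δ(a) b + σ(a) δ(b)`. -/
structure SkewDerivation {k A : Type*} [CommRing k] [Ring A] [Algebra k A] (σ : A ≃ₐ[k] A) where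
  /-- the underlying linear map -/
  toLin : A →ₗ[k] A
  leibniz : ∀ a b, toLin (a * b) = toLin a * b + σ a * toLin b

/-- The Ore extension `A[x; σ, δ]`. An element `∑ aᵢ xⁱ` is its finitely supported family of
coefficients `aᵢ`, written on the left; the multiplication is defined below. -/
def OreExtension {k A : Type*} [CommRing k] [Ring A] [Algebra k A] (σ : A ≃ₐ[k] A)
    (_δ : SkewDerivation σ) : Type _ :=
  ℕ →₀ A

namespace OreExtension

variable {k A : Type*} [CommRing k] [Ring A] [Algebra k A] (σ : A ≃ₐ[k] A) (δ : SkewDerivation σ)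

/-- Left multiplication by `x`: `a xⁱ ↦ σ(a) xⁱ⁺¹ + δ(a) xⁱ`. -/
def mulX : Module.End k (ℕ →₀ A) :=
  Finsupp.lsum k fun i =>
    Finsupp.lsingle (i + 1) ∘ₗ σ.toLinearMap + Finsupp.lsingle i ∘ₗ δ.toLin

/-- Left multiplication by elements of `A`. -/
def mulC (k A : Type*) [CommRing k] [Ring A] [Algebra k A] :
    A →ₐ[k] Module.End k (ℕ →₀ A) :=
  Algebra.lsmul k k (ℕ →₀ A)

/-- Left multiplication: `∑ aᵢ xⁱ` acts by applying `x` repeatedly and then the coefficients. -/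
def mulLeftMap : (ℕ →₀ A) →ₗ[k] Module.End k (ℕ →₀ A) :=
  Finsupp.lsum k fun i => LinearMap.mulRight k (mulX σ δ ^ i) ∘ₗ (mulC k A).toLinearMap

theorem mulX_single (i : ℕ) (a : A) : mulX σ δ (Finsupp.single i a)
    = Finsupp.single (i + 1) (σ a) + Finsupp.single i (δ.toLin a) := by
  simp [mulX]

theorem mulLeftMap_single (i : ℕ) (a : A) : mulLeftMap σ δ (Finsupp.single i a)
    = mulC k A a * mulX σ δ ^ i := by
  simp [mulLeftMap]

theorem mulC_single (a b : A) (i : ℕ) :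
    mulC k A a (Finsupp.single i b) = Finsupp.single i (a * b) := by
  simp [mulC]

theorem toLin_one : δ.toLin 1 = 0 := by
  have h := δ.leibniz 1 1
  simpa using h

theorem mulX_pow_one (i : ℕ) :
    (mulX σ δ ^ i) (Finsupp.single 0 1) = Finsupp.single i 1 := by
  induction i with
  | zero => simp
  | succ i ih => rw [pow_succ', Module.End.mul_apply, ih, mulX_single]; simp [toLin_one]

theorem mulX_mulC (a : A) : mulX σ δ * mulC k A a
    = mulC k A (σ a) * mulX σ δ + mulC k A (δ.toLin a) := by
  refine Finsupp.lhom_ext fun i b => ?_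
  simp only [Module.End.mul_apply, LinearMap.add_apply, mulC_single, mulX_single, map_add,
    map_mul, δ.leibniz, Finsupp.single_add]
  abel

theorem mulLeftMap_mulC (a : A) (q : ℕ →₀ A) :
    mulLeftMap σ δ (mulC k A a q) = mulC k A a * mulLeftMap σ δ q := by
  induction q using Finsupp.induction_linear with
  | zero => simp
  | add p q hp hq => simp only [map_add, hp, hq, mul_add]
  | single i b => rw [mulC_single, mulLeftMap_single, mulLeftMap_single, map_mul, mul_assoc]

theorem mulLeftMap_mulX (q : ℕ →₀ A) :
    mulLeftMap σ δ (mulX σ δ q) = mulX σ δ * mulLeftMap σ δ q := by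
  induction q using Finsupp.induction_linear with
  | zero => simp
  | add p q hp hq => simp only [map_add, hp, hq, mul_add]
  | single i b =>
    rw [mulX_single, map_add, mulLeftMap_single, mulLeftMap_single, mulLeftMap_single, ← mul_assoc,
      mulX_mulC, add_mul, pow_succ', mul_assoc]

theorem mulLeftMap_mulX_pow (i : ℕ) (q : ℕ →₀ A) :
    mulLeftMap σ δ ((mulX σ δ ^ i) q) = mulX σ δ ^ i * mulLeftMap σ δ q := by
  induction i with
  | zero => simp
  | succ i ih => rw [pow_succ', Module.End.mul_apply, mulLeftMap_mulX, ih, mul_assoc]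

theorem mulLeftMap_mul (p q : ℕ →₀ A) :
    mulLeftMap σ δ (mulLeftMap σ δ p q) = mulLeftMap σ δ p * mulLeftMap σ δ q := by
  induction p using Finsupp.induction_linear with
  | zero => simp
  | add p q hp hq => simp only [map_add, LinearMap.add_apply, hp, hq, add_mul]
  | single i b =>
    rw [mulLeftMap_single, Module.End.mul_apply, mulLeftMap_mulC, mulLeftMap_mulX_pow, mul_assoc]

theorem mulLeftMap_one (p : ℕ →₀ A) : mulLeftMap σ δ (Finsupp.single 0 1) p = p := by
  rw [mulLeftMap_single, pow_zero, mul_one, map_one, Module.End.one_apply]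

theorem mulLeftMap_apply_one (p : ℕ →₀ A) : mulLeftMap σ δ p (Finsupp.single 0 1) = p := by
  induction p using Finsupp.induction_linear with
  | zero => rw [map_zero, LinearMap.zero_apply]
  | add p q hp hq => rw [map_add, LinearMap.add_apply, hp, hq]
  | single i b =>
    rw [mulLeftMap_single, Module.End.mul_apply, mulX_pow_one, mulC_single, mul_one]

instance : AddCommGroup (OreExtension σ δ) := inferInstanceAs (AddCommGroup (ℕ →₀ A))

instance : Module k (OreExtension σ δ) := inferInstanceAs (Module k (ℕ →₀ A))

instance : Ring (OreExtension σ δ) where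
  __ := (inferInstance : AddCommGroup (OreExtension σ δ))
  mul p q := (mulLeftMap σ δ p q : ℕ →₀ A)
  one := (Finsupp.single 0 1 : ℕ →₀ A)
  left_distrib p q r := (mulLeftMap σ δ p).map_add q r
  right_distrib p q r := LinearMap.congr_fun ((mulLeftMap σ δ).map_add p q) r
  zero_mul p := LinearMap.congr_fun (mulLeftMap σ δ).map_zero p
  mul_zero p := (mulLeftMap σ δ p).map_zero
  mul_assoc p q r := LinearMap.congr_fun (mulLeftMap_mul σ δ p q) r
  one_mul p := mulLeftMap_one σ δ p
  mul_one p := mulLeftMap_apply_one σ δ p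

instance : Algebra k (OreExtension σ δ) :=
  Algebra.ofModule
    (fun c p q => LinearMap.congr_fun ((mulLeftMap σ δ).map_smul c p) q)
    (fun c p q => (mulLeftMap σ δ p).map_smul c q)

/-- The element `x` of `A[x; σ, δ]`. -/
def X : OreExtension σ δ := (Finsupp.single 1 1 : ℕ →₀ A)

/-- The inclusion of `A` in `A[x; σ, δ]`. -/
def C : A →ₐ[k] OreExtension σ δ :=
  AlgHom.ofLinearMap (Finsupp.lsingle 0 : A →ₗ[k] (ℕ →₀ A)) rfl (fun a b => by
    change (Finsupp.single 0 (a * b) : ℕ →₀ A)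
      = mulLeftMap σ δ (Finsupp.single 0 a) (Finsupp.single 0 b)
    rw [mulLeftMap_single, Module.End.mul_apply, pow_zero, Module.End.one_apply, mulC_single])

theorem C_mul_X_pow (a : A) (i : ℕ) :
    C σ δ a * X σ δ ^ i = (Finsupp.single i a : ℕ →₀ A) := by
  have h : X σ δ ^ i = (Finsupp.single i 1 : ℕ →₀ A) := by
    induction i with
    | zero => rfl
    | succ i ih =>
      rw [pow_succ', ih]
      change mulLeftMap σ δ (Finsupp.single 1 1) (Finsupp.single i 1) = _
      simp [mulLeftMap_single, mulX_single, toLin_one]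
  rw [h]
  change mulLeftMap σ δ (Finsupp.single 0 a) (Finsupp.single i 1) = _
  rw [mulLeftMap_single, Module.End.mul_apply, pow_zero, Module.End.one_apply, mulC_single, mul_one]

/-- `A[x; σ, δ]` is a free left `A`-module with basis `1, x, x², …`. -/
theorem bijective_sum :
    Function.Bijective fun p : ℕ →₀ A => p.sum fun i a => C σ δ a * X σ δ ^ i := by
  have h : (fun p : ℕ →₀ A => p.sum fun i a => C σ δ a * X σ δ ^ i) = fun p => p := by
    funext p
    simp only [C_mul_X_pow]
    exact Finsupp.sum_single p
  rw [h]
  exact Function.bijective_id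

/-- The defining relation `x a = σ(a) x + δ(a)`. -/
theorem X_mul_C (a : A) :
    X σ δ * C σ δ a = C σ δ (σ a) * X σ δ + C σ δ (δ.toLin a) := by
  have h := C_mul_X_pow σ δ (σ a) 1
  rw [pow_one] at h
  rw [h]
  have key : mulLeftMap σ δ (Finsupp.single 1 1) (Finsupp.single 0 a)
      = Finsupp.single 1 (σ a) + Finsupp.single 0 (δ.toLin a) := by
    simp [mulLeftMap_single, mulX_single]
  exact key

end OreExtension

/-! ### The maps which describe the bimodule structure -/

section Formulas

variable {k A : Type*} [CommRing k] [Ring A] [Algebra k A] (σ : A ≃ₐ[k] A) (δ : SkewDerivation σ)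

/-- The automorphism `σ⁻¹` as an algebra morphism. -/
abbrev sigmaInv : A →ₐ[k] A := (σ.symm : A →ₐ[k] A)

/-- The linear map `δ ∘ σ⁻¹`. -/
def deltaSigmaInv : A →ₗ[k] A := δ.toLin ∘ₗ σ.symm.toLinearMap

/-- The map `qⁿᵢ : A → A`: the sum of all compositions `σ₁ σ₂ ⋯ σₙ` where each `σⱼ` is `σ⁻¹` or
`-δ σ⁻¹` and `σ⁻¹` occurs exactly `i` times (at the positions in the set `T`). -/
def qMap (n i : ℕ) : Module.End k A :=
  ∑ T ∈ Finset.powersetCard i (Finset.univ : Finset (Fin n)),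
    (List.ofFn fun j : Fin n =>
      if j ∈ T then (σ.symm.toLinearMap : Module.End k A) else -deltaSigmaInv σ δ).prod

/-- `(σ⁻¹ ⊗ id) ∘ g ∘ σ^{⊗ n}`. -/
def untwist {n : ℕ} (g : Cochain k A (A ⊗[k] A) n) : Cochain k A (A ⊗[k] A) n :=
  (LinearMap.rTensor A σ.symm.toLinearMap).compMultilinearMap
    (g.compLinearMap fun _ => σ.toLinearMap)

/-- `f₂ = (id ⊗ σ⁻¹) ∘ f`. -/
def f₂ {n : ℕ} (f : Cochain k A (A ⊗[k] A) n) : Cochain k A (A ⊗[k] A) n :=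
  (LinearMap.lTensor A σ.symm.toLinearMap).compMultilinearMap f

/-- `f₃ = (δ ⊗ id) ∘ f ∘ (σ⁻¹)^{⊗ n} + (id ⊗ δσ⁻¹) ∘ f
  - ∑_{j=1}^n f ∘ (id^{⊗ j-1} ⊗ δσ⁻¹ ⊗ (σ⁻¹)^{⊗ n-j})`. -/
def f₃ {n : ℕ} (f : Cochain k A (A ⊗[k] A) n) : Cochain k A (A ⊗[k] A) n :=
  (LinearMap.rTensor A δ.toLin).compMultilinearMap
      (f.compLinearMap fun _ => σ.symm.toLinearMap)
    + (LinearMap.lTensor A (deltaSigmaInv σ δ)).compMultilinearMap f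
    - ∑ j : Fin n, f.compLinearMap fun i =>
        if i < j then LinearMap.id
        else if i = j then deltaSigmaInv σ δ
        else σ.symm.toLinearMap

end Formulas

end

end OreHochschild

/- Write `E = A[x; σ, δ]`. For an `E`-bimodule `M` the action of `x` induces a map `[x, -]` from the
Hochschild cochains of `A` in `M` to those in `M` with left action twisted by `σ`. Its mapping cone
computes `H(E, M)`: this holds for coinduced bimodules, where it amounts to solving a recursion for
the coefficients of the powers of `x`, and every bimodule embeds in a coinduced one, so that the
general case follows by dimension shifting. Hence `H(A, -)` and `H(E, -)` are linked by a long exact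
sequence.

For `M = E ⊗ E`, which over `A` is the direct sum of the bimodules `A xⁱ ⊗ xʲ A`, the finiteness
of the resolution of `A` lets `H(A, -)` commute with this sum, and by assumption only degree `d`
survives. Ordering by the power of `x` in the left factor, `[x, -]` has leading term `σ`, which is
bijective: so `[x, -]` is injective on `Hᵈ`, and every class of its cokernel has a unique
representative of left degree `0`. What remains are the powers of `x` in the right factor, that is
`ω' ⊗ k[x]`. -/

namespace OreHochschild

noncomputable section

universe u v

section Cochains

variable {k A S T M N L : Type*} [CommRing k] [Ring A] [Algebra k A] [Ring S] [Algebra k S]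
  [Ring T] [Algebra k T]
  [AddCommGroup M] [Module k M] [AddCommGroup N] [Module k N] [AddCommGroup L] [Module k L]

/-- Splitting off the first argument of a cochain, so that operations on cochains can be defined,
and their identities proved, by recursion on the degree. -/
def curry {n : ℕ} : Cochain k A M (n + 1) ≃ₗ[k] (A →ₗ[k] Cochain k A M n) :=
  multilinearCurryLeftEquiv k (fun _ : Fin (n + 1) => A) M

theorem curry_apply {n : ℕ} (f : Cochain k A M (n + 1)) (a : A) (v : Fin n → A) :
    curry f a v = f (Fin.cons a v) := rfl

theorem ext_curry {n : ℕ} {f g : Cochain k A M (n + 1)} (h : ∀ a, curry f a = curry g a) : f = g :=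
  curry.injective (LinearMap.ext h)

/-- Composition of cochains with a linear map of the coefficients. -/
def push (A : Type*) [Ring A] [Algebra k A] (φ : M →ₗ[k] N) (n : ℕ) :
    Cochain k A M n →ₗ[k] Cochain k A N n where
  toFun f := φ.compMultilinearMap f
  map_add' f g := by ext; simp
  map_smul' c f := by ext; simp

theorem push_apply (φ : M →ₗ[k] N) (n : ℕ) (f : Cochain k A M n) (v : Fin n → A) :
    push A φ n f v = φ (f v) := rfl

theorem push_push (φ : M →ₗ[k] N) (ψ : N →ₗ[k] L) (n : ℕ) (f : Cochain k A M n) :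
    push A ψ n (push A φ n f) = push A (ψ ∘ₗ φ) n f := rfl

theorem push_add (φ ψ : M →ₗ[k] N) (n : ℕ) (f : Cochain k A M n) :
    push A (φ + ψ) n f = push A φ n f + push A ψ n f := rfl

theorem push_injective {φ : M →ₗ[k] N} (hφ : Function.Injective φ) (n : ℕ) :
    Function.Injective (push A φ n) := fun _ _ h =>
  MultilinearMap.ext fun v => hφ (congrArg (fun F : Cochain k A N n => F v) h)

theorem curry_push (φ : M →ₗ[k] N) {n : ℕ} (f : Cochain k A M (n + 1)) (a : A) :
    curry (push A φ (n + 1) f) a = push A φ n (curry f a) := rfl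

/-- Precomposition of cochains with a linear map in every argument. -/
def pull (M : Type*) [AddCommGroup M] [Module k M] (τ : T →ₗ[k] S) (n : ℕ) :
    Cochain k S M n →ₗ[k] Cochain k T M n where
  toFun f := f.compLinearMap fun _ => τ
  map_add' f g := by ext; simp
  map_smul' c f := by ext; simp

theorem pull_apply (τ : T →ₗ[k] S) (n : ℕ) (f : Cochain k S M n) (v : Fin n → T) :
    pull M τ n f v = f (fun i => τ (v i)) := rfl

theorem pull_push (τ : T →ₗ[k] S) (φ : M →ₗ[k] N) (n : ℕ) (f : Cochain k S M n) :
    pull N τ n (push S φ n f) = push T φ n (pull M τ n f) := rfl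

theorem curry_pull (τ : T →ₗ[k] S) {n : ℕ} (f : Cochain k S M (n + 1)) (t : T) :
    curry (pull M τ (n + 1) f) t = pull M τ n (curry f (τ t)) := by
  ext v
  rw [curry_apply, pull_apply, pull_apply, curry_apply]
  congr 1
  funext i
  exact Fin.cases rfl (fun _ => rfl) i

/-- The cochain `(b, …) ↦ f(ab, …)`. -/
def mulFirst (a : A) {n : ℕ} : Cochain k A M (n + 1) →ₗ[k] Cochain k A M (n + 1) :=
  curry.symm.toLinearMap ∘ₗ LinearMap.lcomp k _ (LinearMap.mulLeft k a) ∘ₗ curry.toLinearMap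

theorem curry_mulFirst (a b : A) {n : ℕ} (f : Cochain k A M (n + 1)) :
    curry (mulFirst a f) b = curry f (a * b) := rfl

theorem mulFirst_mulFirst (a b : A) {n : ℕ} (f : Cochain k A M (n + 1)) :
    mulFirst b (mulFirst a f) = mulFirst (a * b) f :=
  ext_curry fun c => by simp only [curry_mulFirst, mul_assoc]

/-- The term `a₀ · f(a₁, …, aₙ)` of the Hochschild differential, as a linear map in `f`. -/
def leftDifferential (B : BimoduleStr k A M) (n : ℕ) :
    Cochain k A M n →ₗ[k] Cochain k A M (n + 1) where
  toFun := leftTerm B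
  map_add' f g := by ext; simp [leftTerm]
  map_smul' c f := by ext; simp [leftTerm]

theorem curry_leftDifferential (B : BimoduleStr k A M) (n : ℕ) (f : Cochain k A M n) (a : A) :
    curry (leftDifferential B n f) a = push A (B.left a) n f := rfl

/-- The part of the Hochschild differential which does not involve the left action, with the
opposite sign. -/
def rightDifferential (B : BimoduleStr k A M) (n : ℕ) :
    Cochain k A M n →ₗ[k] Cochain k A M (n + 1) :=
  leftDifferential B n - differential B n

theorem differential_eq_sub (B : BimoduleStr k A M) (n : ℕ) (f : Cochain k A M n) :
    differential B n f = leftDifferential B n f - rightDifferential B n f := by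
  rw [rightDifferential, LinearMap.sub_apply, sub_sub_cancel]

theorem rightDifferential_apply (B : BimoduleStr k A M) (n : ℕ) (f : Cochain k A M n)
    (v : Fin (n + 1) → A) :
    rightDifferential B n f v
      = ∑ j : Fin n, (-1 : k) ^ (j : ℕ) • f (Fin.contractNth j.castSucc (· * ·) v)
        + (-1 : k) ^ n • B.right (MulOpposite.op (v (Fin.last n))) (f fun i => v i.castSucc) := by
  have h : leftDifferential B n f v = B.left (v 0) (f fun i => v i.succ) := rfl
  rw [rightDifferential, LinearMap.sub_apply, sub_apply, h, differential_apply]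
  simp only [pow_succ, mul_neg, mul_one, neg_smul, Finset.sum_neg_distrib]
  abel

theorem contractNth_zero_cons_cons {n : ℕ} (a b : A) (v : Fin n → A) :
    Fin.contractNth (Fin.castSucc (0 : Fin (n + 1))) (· * ·) (Fin.cons a (Fin.cons b v))
      = (Fin.cons (a * b) v : Fin (n + 1) → A) := by
  funext i
  refine Fin.cases ?_ (fun i => ?_) i <;> simp [Fin.contractNth]

theorem contractNth_succ_cons {n : ℕ} (j : Fin n) (a : A) (v : Fin (n + 1) → A) :
    Fin.contractNth (Fin.castSucc j.succ) (· * ·) (Fin.cons a v)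
      = (Fin.cons a (Fin.contractNth j.castSucc (· * ·) v) : Fin (n + 1) → A) := by
  funext i
  refine Fin.cases ?_ (fun i => ?_) i <;> simp [Fin.contractNth, Fin.castSucc_succ]

theorem contractNth_map (τ : T →ₐ[k] S) {n : ℕ} (j : Fin (n + 1)) (v : Fin (n + 1) → T) :
    (fun i => τ (Fin.contractNth j (· * ·) v i))
      = Fin.contractNth j (· * ·) (fun i => τ (v i)) := by
  funext i
  simp only [Fin.contractNth]
  split_ifs <;> simp

theorem curry_rightDifferential_zero (B : BimoduleStr k A M) (f : Cochain k A M 0) (a : A) :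
    curry (rightDifferential B 0 f) a = push A (B.right (MulOpposite.op a)) 0 f := by
  ext v
  rw [curry_apply, rightDifferential_apply, push_apply]
  simp only [Finset.univ_eq_empty, Finset.sum_empty, pow_zero, one_smul, zero_add]
  exact congrArg (fun w => B.right (MulOpposite.op a) (f w)) (Subsingleton.elim _ _)

theorem curry_rightDifferential_succ (B : BimoduleStr k A M) {n : ℕ} (f : Cochain k A M (n + 1))
    (a : A) :
    curry (rightDifferential B (n + 1) f) a
      = mulFirst a f - rightDifferential B n (curry f a) := by
  refine ext_curry fun b => MultilinearMap.ext fun w => ?_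
  rw [map_sub, LinearMap.sub_apply, curry_mulFirst, sub_apply]
  simp only [curry_apply, rightDifferential_apply, Fin.sum_univ_succ, contractNth_zero_cons_cons,
    contractNth_succ_cons]
  have hinit : (fun i : Fin (n + 1) => (Fin.cons a (Fin.cons b w) : Fin (n + 2) → A) i.castSucc)
      = Fin.cons a fun i : Fin n => (Fin.cons b w : Fin (n + 1) → A) i.castSucc := by
    funext i
    refine Fin.cases ?_ (fun i => ?_) i <;> simp [Fin.castSucc_succ]
  have hlast : (Fin.cons a (Fin.cons b w) : Fin (n + 2) → A) (Fin.last (n + 1))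
      = (Fin.cons b w : Fin (n + 1) → A) (Fin.last n) := rfl
  simp only [hinit, hlast, Fin.val_succ, Fin.val_zero, pow_succ, pow_zero, mul_neg, mul_one,
    neg_smul, one_smul, Finset.sum_neg_distrib]
  abel

theorem rightDifferential_push {B : BimoduleStr k A M} {B' : BimoduleStr k A N} {φ : M →ₗ[k] N}
    (h : ∀ a m, φ (B.right a m) = B'.right a (φ m)) (n : ℕ) (f : Cochain k A M n) :
    rightDifferential B' n (push A φ n f) = push A φ (n + 1) (rightDifferential B n f) := by
  ext v
  simp only [rightDifferential_apply, push_apply, map_add, map_sum, map_smul, h]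

theorem rightDifferential_pull {B' : BimoduleStr k T M} {B : BimoduleStr k S M} {τ : T →ₐ[k] S}
    (h : ∀ t, B'.right (MulOpposite.op t) = B.right (MulOpposite.op (τ t)))
    (n : ℕ) (f : Cochain k S M n) :
    rightDifferential B' n (pull M τ.toLinearMap n f)
      = pull M τ.toLinearMap (n + 1) (rightDifferential B n f) := by
  ext v
  simp only [rightDifferential_apply, pull_apply, AlgHom.toLinearMap_apply, contractNth_map, h]

theorem rightDifferential_mulFirst (B : BimoduleStr k A M) (a : A) {n : ℕ}
    (f : Cochain k A M (n + 1)) :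
    rightDifferential B (n + 1) (mulFirst a f) = mulFirst a (rightDifferential B (n + 1) f) :=
  ext_curry fun b => by
    rw [curry_mulFirst, curry_rightDifferential_succ, curry_rightDifferential_succ, curry_mulFirst,
      mulFirst_mulFirst]

theorem rightDifferential_rightDifferential (B : BimoduleStr k A M) (n : ℕ) (f : Cochain k A M n) :
    rightDifferential B (n + 1) (rightDifferential B n f) = 0 := by
  refine ext_curry fun a => ?_
  rw [curry_rightDifferential_succ, map_zero, LinearMap.zero_apply, sub_eq_zero]
  induction n generalizing a with
  | zero =>
    refine ext_curry fun b => ?_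
    rw [curry_mulFirst]
    simp only [curry_rightDifferential_zero, push_push, MulOpposite.op_mul, map_mul]
    rfl
  | succ n ih =>
    have hzero : rightDifferential B (n + 1) (rightDifferential B n (curry f a)) = 0 :=
      ext_curry fun b => by
        rw [curry_rightDifferential_succ, ih, sub_self, map_zero, LinearMap.zero_apply]
    rw [curry_rightDifferential_succ, map_sub, hzero, sub_zero, rightDifferential_mulFirst]

theorem differential_differential (B : BimoduleStr k A M) (n : ℕ) (f : Cochain k A M n) :
    differential B (n + 1) (differential B n f) = 0 := by
  have hleft : ∀ a, push A (B.left a) (n + 1) (leftDifferential B n f)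
      = mulFirst a (leftDifferential B n f) := fun a => ext_curry fun b => by
    rw [curry_push, curry_mulFirst, curry_leftDifferential, curry_leftDifferential, push_push,
      map_mul]
    rfl
  have hmixed : ∀ a, rightDifferential B n (push A (B.left a) n f)
      = push A (B.left a) (n + 1) (rightDifferential B n f) := fun a =>
    rightDifferential_push (fun b m => LinearMap.congr_fun (B.comm a b) m) n f
  refine ext_curry fun a => ?_
  simp only [differential_eq_sub, map_sub, LinearMap.sub_apply, curry_leftDifferential,
    curry_rightDifferential_succ, rightDifferential_rightDifferential, hleft, hmixed, sub_zero,
    map_zero, LinearMap.zero_apply]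
  abel

theorem coboundaries_le_cocycles (B : BimoduleStr k A M) (n : ℕ) :
    coboundaries B n ≤ cocycles B n := by
  cases n with
  | zero => exact bot_le
  | succ n =>
    rintro _ ⟨g, rfl⟩
    exact differential_differential B n g

theorem mem_cocycles {B : BimoduleStr k A M} {n : ℕ} {f : Cochain k A M n} :
    f ∈ cocycles B n ↔ differential B n f = 0 := Iff.rfl

theorem differential_mem_coboundaries (B : BimoduleStr k A M) (n : ℕ) (f : Cochain k A M n) :
    differential B n f ∈ coboundaries B (n + 1) := ⟨f, rfl⟩

theorem subsingleton_HH_iff (B : BimoduleStr k A M) (n : ℕ) :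
    Subsingleton (HH B n) ↔ cocycles B n ≤ coboundaries B n := by
  rw [Submodule.Quotient.subsingleton_iff, Submodule.eq_top_iff']
  exact ⟨fun h f hf => h ⟨f, hf⟩, fun h f => h f.2⟩

theorem HH.mk_eq_zero_iff (B : BimoduleStr k A M) (n : ℕ) (f : cocycles B n) :
    HH.mk B n f = 0 ↔ f.1 ∈ coboundaries B n :=
  (Submodule.Quotient.mk_eq_zero _).trans Iff.rfl

/-- A family of linear maps between Hochschild cochains, possibly over different algebras, which
commutes with the differentials. -/
def IsCochainMap (B : BimoduleStr k S M) (B' : BimoduleStr k T N)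
    (Φ : ∀ n, Cochain k S M n →ₗ[k] Cochain k T N n) : Prop :=
  ∀ n f, differential B' n (Φ n f) = Φ (n + 1) (differential B n f)

namespace IsCochainMap

variable {B : BimoduleStr k S M} {B' : BimoduleStr k T N}
  {Φ : ∀ n, Cochain k S M n →ₗ[k] Cochain k T N n} {n : ℕ} {f : Cochain k S M n}

theorem mem_cocycles (hΦ : IsCochainMap B B' Φ) (hf : f ∈ cocycles B n) :
    Φ n f ∈ cocycles B' n := by
  rw [OreHochschild.mem_cocycles] at hf ⊢
  rw [hΦ, hf, map_zero]

theorem mem_coboundaries (hΦ : IsCochainMap B B' Φ) (hf : f ∈ coboundaries B n) :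
    Φ n f ∈ coboundaries B' n := by
  cases n with
  | zero =>
    obtain rfl : f = 0 := hf
    rw [map_zero]
    exact zero_mem _
  | succ n =>
    obtain ⟨g, rfl⟩ := hf
    exact ⟨Φ n g, hΦ n g⟩

end IsCochainMap

theorem BimoduleStr.IsHom.isCochainMap_push {B : BimoduleStr k A M} {B' : BimoduleStr k A N}
    {φ : M →ₗ[k] N} (hφ : B.IsHom B' φ) : IsCochainMap B B' (push A φ) := fun n f => by
  ext v
  simp [differential_apply, push_apply, hφ.1, hφ.2]

theorem BimoduleStr.IsHom.push_mem_cocycles {B : BimoduleStr k A M} {B' : BimoduleStr k A N}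
    {φ : M →ₗ[k] N} (hφ : B.IsHom B' φ) {n : ℕ} {f : Cochain k A M n} (hf : f ∈ cocycles B n) :
    push A φ n f ∈ cocycles B' n :=
  hφ.isCochainMap_push.mem_cocycles hf

theorem BimoduleStr.IsHom.push_mem_coboundaries {B : BimoduleStr k A M} {B' : BimoduleStr k A N}
    {φ : M →ₗ[k] N} (hφ : B.IsHom B' φ) {n : ℕ} {f : Cochain k A M n}
    (hf : f ∈ coboundaries B n) : push A φ n f ∈ coboundaries B' n :=
  hφ.isCochainMap_push.mem_coboundaries hf

theorem BimoduleStr.IsHom.twist {B : BimoduleStr k S M} {B' : BimoduleStr k S N} {φ : M →ₗ[k] N}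
    (h : B.IsHom B' φ) (ν τ : T →ₐ[k] S) : (B.twist ν τ).IsHom (B'.twist ν τ) φ :=
  ⟨fun _ _ => h.1 _ _, fun _ _ => h.2 _ _⟩

theorem BimoduleStr.IsHom.comp {B : BimoduleStr k S M} {B' : BimoduleStr k S N}
    {B'' : BimoduleStr k S L} {φ : M →ₗ[k] N} {ψ : N →ₗ[k] L}
    (hψ : B'.IsHom B'' ψ) (hφ : B.IsHom B' φ) : B.IsHom B'' (ψ ∘ₗ φ) :=
  ⟨fun s m => by simp [hφ.1, hψ.1], fun s m => by simp [hφ.2, hψ.2]⟩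

theorem isCochainMap_pull (B : BimoduleStr k S M) (τ : T →ₐ[k] S) :
    IsCochainMap B (B.twist τ τ) (pull M τ.toLinearMap) := fun n f => by
  ext v
  simp [differential_apply, pull_apply, contractNth_map, BimoduleStr.twist]

end Cochains

section Skew

variable {k A S M N : Type*} [CommRing k] [Ring A] [Algebra k A] [Ring S] [Algebra k S]
  [AddCommGroup M] [Module k M] [AddCommGroup N] [Module k N] (σ : A ≃ₐ[k] A)
  (δ : SkewDerivation σ)

/-- The bimodule `{}^σ M`: the left action is twisted by `σ`. -/
def sigmaTwist (B : BimoduleStr k A M) : BimoduleStr k A M :=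
  B.twist σ.toAlgHom (AlgHom.id k A)

theorem rightDifferential_sigmaTwist (B : BimoduleStr k A M) (n : ℕ) (f : Cochain k A M n) :
    rightDifferential (sigmaTwist σ B) n f = rightDifferential B n f := by
  ext v
  rw [rightDifferential_apply, rightDifferential_apply]
  rfl

/-- Two endomorphisms `lx` and `rx` of an `A`-bimodule which are compatible with the actions of `A`
in the way in which the left and the right action of `x` on an `A[x; σ, δ]`-bimodule are. They are
not required to commute. -/
structure IsSkewPair (B : BimoduleStr k A M) (lx rx : Module.End k M) : Prop where
  left_left : ∀ a m, lx (B.left a m) = B.left (σ a) (lx m) + B.left (δ.toLin a) m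
  left_right : ∀ a m, lx (B.right a m) = B.right a (lx m)
  right_left : ∀ a m, rx (B.left a m) = B.left a (rx m)
  right_right : ∀ a m, B.right (MulOpposite.op a) (rx m)
    = rx (B.right (MulOpposite.op (σ a)) m) + B.right (MulOpposite.op (δ.toLin a)) m

/-- The map `f ↦ (f ∘ σ^{⊗ n}) · x + ∑ⱼ f ∘ (σ^{⊗ j-1} ⊗ δ ⊗ id^{⊗ n-j})` on cochains, where `rx` is
the right action of `x`. -/
def skewRight (rx : Module.End k M) : (n : ℕ) → Cochain k A M n →ₗ[k] Cochain k A M n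
  | 0 => push A rx 0
  | n + 1 => curry.symm.toLinearMap ∘ₗ
      (LinearMap.lcomp k _ δ.toLin
        + LinearMap.compRight k (skewRight rx n) ∘ₗ LinearMap.lcomp k _ σ.toLinearMap) ∘ₗ
      curry.toLinearMap

theorem curry_skewRight (rx : Module.End k M) {n : ℕ} (f : Cochain k A M (n + 1)) (a : A) :
    curry (skewRight σ δ rx (n + 1) f) a
      = curry f (δ.toLin a) + skewRight σ δ rx n (curry f (σ a)) := rfl

theorem skewRight_push {rx : Module.End k M} {rx' : Module.End k N} {φ : M →ₗ[k] N}
    (h : ∀ m, φ (rx m) = rx' (φ m)) (n : ℕ) (f : Cochain k A M n) :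
    skewRight σ δ rx' n (push A φ n f) = push A φ n (skewRight σ δ rx n f) := by
  induction n with
  | zero => exact MultilinearMap.ext fun w => (h (f w)).symm
  | succ n ih =>
    refine ext_curry fun a => ?_
    rw [curry_skewRight, curry_push, curry_push, curry_push, curry_skewRight, ih, map_add]

theorem skewRight_apply (rx : Module.End k M) (n : ℕ) (f : Cochain k A M n) (v : Fin n → A) :
    skewRight σ δ rx n f v = rx (f fun i => σ (v i)) + ∑ j : Fin n,
      f fun i => if i < j then σ (v i) else if i = j then δ.toLin (v i) else v i := by
  induction n with
  | zero =>
    rw [Finset.univ_eq_empty, Finset.sum_empty, add_zero]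
    exact congrArg (fun w => rx (f w)) (Subsingleton.elim _ _)
  | succ n ih =>
    obtain ⟨a, w, rfl⟩ : ∃ a w, Fin.cons a w = v := ⟨v 0, Fin.tail v, Fin.cons_self_tail v⟩
    have hσ : (fun i => σ ((Fin.cons a w : Fin (n + 1) → A) i))
        = Fin.cons (σ a) fun i => σ (w i) := by
      funext i; exact Fin.cases rfl (fun _ => rfl) i
    have hzero : (fun i : Fin (n + 1) => if i < 0 then σ ((Fin.cons a w : Fin (n + 1) → A) i)
        else if i = 0 then δ.toLin ((Fin.cons a w : Fin (n + 1) → A) i)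
        else (Fin.cons a w : Fin (n + 1) → A) i) = Fin.cons (δ.toLin a) w := by
      funext i; exact Fin.cases (by simp) (fun i => by simp) i
    have hsucc : ∀ j : Fin n, (fun i : Fin (n + 1) => if i < j.succ then
          σ ((Fin.cons a w : Fin (n + 1) → A) i)
        else if i = j.succ then δ.toLin ((Fin.cons a w : Fin (n + 1) → A) i)
        else (Fin.cons a w : Fin (n + 1) → A) i) = Fin.cons (σ a)
          fun i => if i < j then σ (w i) else if i = j then δ.toLin (w i) else w i := by
      intro j
      funext i; exact Fin.cases (by simp) (fun i => by simp) i
    rw [← curry_apply, curry_skewRight, add_apply, ih, Fin.sum_univ_succ]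
    simp only [hσ, hzero, hsucc, curry_apply]
    abel

/-- The map `f ↦ x f - skewRight f` on cochains, where `lx` and `rx` are the left and the right
action of `x`. -/
def skewCommutator (lx rx : Module.End k M) (n : ℕ) : Cochain k A M n →ₗ[k] Cochain k A M n :=
  push A lx n - skewRight σ δ rx n

theorem skewCommutator_apply (lx rx : Module.End k M) (n : ℕ) (f : Cochain k A M n) :
    skewCommutator σ δ lx rx n f = push A lx n f - skewRight σ δ rx n f := rfl

theorem skewCommutator_push {lx rx : Module.End k M} {lx' rx' : Module.End k N} {φ : M →ₗ[k] N}
    (hl : ∀ m, φ (lx m) = lx' (φ m)) (hr : ∀ m, φ (rx m) = rx' (φ m)) (n : ℕ)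
    (f : Cochain k A M n) :
    skewCommutator σ δ lx' rx' n (push A φ n f) = push A φ n (skewCommutator σ δ lx rx n f) := by
  have hlx : lx' ∘ₗ φ = φ ∘ₗ lx := LinearMap.ext fun m => (hl m).symm
  rw [skewCommutator_apply, skewCommutator_apply, map_sub, push_push, push_push, hlx,
    skewRight_push σ δ hr]

theorem skewRight_mulFirst (rx : Module.End k M) (a : A) {n : ℕ} (f : Cochain k A M (n + 1)) :
    skewRight σ δ rx (n + 1) (mulFirst (σ a) f) + mulFirst (δ.toLin a) f
      = mulFirst a (skewRight σ δ rx (n + 1) f) :=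
  ext_curry fun b => by
    rw [map_add, LinearMap.add_apply, curry_skewRight, curry_mulFirst, curry_mulFirst,
      curry_mulFirst, curry_mulFirst, curry_skewRight, map_mul σ, δ.leibniz, map_add]
    abel

namespace IsSkewPair

variable {σ δ} {B : BimoduleStr k A M} {lx rx : Module.End k M}

theorem skewRight_rightDifferential (h : IsSkewPair σ δ B lx rx) (n : ℕ) (f : Cochain k A M n) :
    skewRight σ δ rx (n + 1) (rightDifferential B n f)
      = rightDifferential B n (skewRight σ δ rx n f) := by
  induction n with
  | zero =>
    refine ext_curry fun a => MultilinearMap.ext fun w => ?_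
    simp only [curry_skewRight, curry_rightDifferential_zero]
    exact (add_comm _ _).trans (h.right_right a (f w)).symm
  | succ n ih =>
    refine ext_curry fun a => ?_
    simp only [curry_skewRight, curry_rightDifferential_succ, map_add, map_sub, ih,
      ← skewRight_mulFirst]
    abel

theorem isCochainMap_skewCommutator (h : IsSkewPair σ δ B lx rx) :
    IsCochainMap B (sigmaTwist σ B) (skewCommutator σ δ lx rx) := fun n f => by
  have hright : rightDifferential (sigmaTwist σ B) n (skewCommutator σ δ lx rx n f)
      = skewCommutator σ δ lx rx (n + 1) (rightDifferential B n f) := by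
    rw [rightDifferential_sigmaTwist, skewCommutator_apply, skewCommutator_apply,
      h.skewRight_rightDifferential, ← rightDifferential_push (h.left_right ·), map_sub]
  have hleft : leftDifferential (sigmaTwist σ B) n (skewCommutator σ δ lx rx n f)
      = skewCommutator σ δ lx rx (n + 1) (leftDifferential B n f) := by
    refine ext_curry fun a => ?_
    rw [skewCommutator_apply, skewCommutator_apply, map_sub (curry), LinearMap.sub_apply,
      curry_skewRight, curry_push, curry_leftDifferential, curry_leftDifferential,
      curry_leftDifferential, curry_leftDifferential,
      skewRight_push σ δ fun m => (h.right_left (σ a) m).symm]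
    ext w
    simp only [push_apply, sub_apply, add_apply, h.left_left]
    rw [add_comm, add_sub_add_left_eq_sub]
    exact map_sub (B.left (σ a)) _ _
  rw [differential_eq_sub, differential_eq_sub, hleft, hright, map_sub]

end IsSkewPair

end Skew

section Insert

variable {k A S M N : Type*} [CommRing k] [Ring A] [Algebra k A] [Ring S] [Algebra k S]
  [AddCommGroup M] [Module k M] [AddCommGroup N] [Module k N] (σ : A ≃ₐ[k] A)
  {δ : SkewDerivation σ} (c : A →ₐ[k] S) (x : S)

/-- Insertion of `x` with signs at all places of a cochain; the arguments to the left of `x` are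
twisted by `σ`. -/
def insertX (M : Type*) [AddCommGroup M] [Module k M] :
    (n : ℕ) → Cochain k S M (n + 1) →ₗ[k] Cochain k A M n
  | 0 => pull M c.toLinearMap 0 ∘ₗ LinearMap.applyₗ x ∘ₗ curry.toLinearMap
  | n + 1 => pull M c.toLinearMap (n + 1) ∘ₗ LinearMap.applyₗ x ∘ₗ curry.toLinearMap
      - curry.symm.toLinearMap ∘ₗ LinearMap.compRight k (insertX M n) ∘ₗ
        LinearMap.lcomp k _ (c.toLinearMap ∘ₗ σ.toLinearMap) ∘ₗ curry.toLinearMap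

theorem insertX_zero (f : Cochain k S M 1) :
    insertX σ c x M 0 f = pull M c.toLinearMap 0 (curry f x) := rfl

theorem curry_insertX {n : ℕ} (f : Cochain k S M (n + 2)) (a : A) :
    curry (insertX σ c x M (n + 1) f) a
      = pull M c.toLinearMap n (curry (curry f x) (c a))
        - insertX σ c x M n (curry f (c (σ a))) := by
  rw [← AlgHom.toLinearMap_apply c a, ← curry_pull]
  rfl

theorem insertX_push (φ : M →ₗ[k] N) (n : ℕ) (f : Cochain k S M (n + 1)) :
    insertX σ c x N n (push S φ (n + 1) f) = push A φ n (insertX σ c x M n f) := by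
  induction n with
  | zero => rfl
  | succ n ih =>
    refine ext_curry fun a => ?_
    simp only [curry_insertX, curry_push, ih, map_sub, pull_push]

theorem insertX_mulFirst (a : A) {n : ℕ} (f : Cochain k S M (n + 2)) :
    insertX σ c x M (n + 1) (mulFirst (c (σ a)) f)
        + pull M c.toLinearMap (n + 1) (mulFirst (c a) (curry f x))
      = mulFirst a (insertX σ c x M (n + 1) f)
        + pull M c.toLinearMap (n + 1) (curry f (c (σ a) * x)) :=
  ext_curry fun b => by
    simp only [map_add, LinearMap.add_apply, curry_insertX, curry_mulFirst, curry_pull,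
      AlgHom.toLinearMap_apply, map_mul]
    abel

variable {c x}

theorem isSkewPair_twist (hx : ∀ a, x * c a = c (σ a) * x + c (δ.toLin a))
    (B : BimoduleStr k S M) :
    IsSkewPair σ δ (B.twist c c) (B.left x) (B.right (MulOpposite.op x)) where
  left_left a m := by
    have h := LinearMap.congr_fun (congrArg B.left (hx a)) m
    rwa [map_mul, map_add, map_mul] at h
  left_right a m := LinearMap.congr_fun (B.comm x _) m
  right_left a m := (LinearMap.congr_fun (B.comm (c a) _) m).symm
  right_right a m := by
    have h := LinearMap.congr_fun (congrArg (fun s => B.right (MulOpposite.op s)) (hx a)) m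
    rwa [MulOpposite.op_mul, MulOpposite.op_add, map_mul, map_add, MulOpposite.op_mul, map_mul] at h

theorem insertX_leftDifferential (B : BimoduleStr k S M) (n : ℕ) (f : Cochain k S M (n + 1)) :
    insertX σ c x M (n + 1) (leftDifferential B (n + 1) f)
        + leftDifferential (sigmaTwist σ (B.twist c c)) n (insertX σ c x M n f)
      = push A (B.left x) (n + 1) (pull M c.toLinearMap (n + 1) f) :=
  ext_curry fun a => by
    rw [map_add, LinearMap.add_apply, curry_insertX, curry_leftDifferential,
      curry_leftDifferential, curry_leftDifferential, insertX_push]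
    refine (sub_add_cancel _ _).trans ?_
    rw [curry_push, curry_push, curry_pull, pull_push]
    rfl

theorem insertX_rightDifferential (hx : ∀ a, x * c a = c (σ a) * x + c (δ.toLin a))
    (B : BimoduleStr k S M) (n : ℕ) (f : Cochain k S M (n + 1)) :
    insertX σ c x M (n + 1) (rightDifferential B (n + 1) f)
        + rightDifferential (B.twist c c) n (insertX σ c x M n f)
      = skewRight σ δ (B.right (MulOpposite.op x)) (n + 1) (pull M c.toLinearMap (n + 1) f) := by
  have hpull : ∀ m (g : Cochain k S M m), rightDifferential (B.twist c c) m
      (pull M c.toLinearMap m g) = pull M c.toLinearMap (m + 1) (rightDifferential B m g) :=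
    rightDifferential_pull (B := B) (τ := c) fun _ => rfl
  induction n with
  | zero =>
    refine ext_curry fun a => ?_
    simp only [map_add, map_sub, LinearMap.add_apply, LinearMap.sub_apply, curry_insertX,
      curry_rightDifferential_succ, curry_rightDifferential_zero, curry_mulFirst, curry_skewRight,
      curry_pull, AlgHom.toLinearMap_apply, hx, insertX_zero]
    rw [pull_push]
    simp only [skewRight, pull_push, BimoduleStr.twist]
    change _ + push A (B.right (MulOpposite.op (c a))) 0 _ = _
    abel
  | succ n ih =>
    refine ext_curry fun a => ?_
    have hmul := insertX_mulFirst σ c x a f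
    simp only [map_add, map_sub, LinearMap.add_apply, LinearMap.sub_apply, curry_insertX,
      curry_rightDifferential_succ, curry_mulFirst, curry_skewRight,
      curry_pull, AlgHom.toLinearMap_apply, hx, ← ih, hpull]
    rw [← sub_eq_zero] at hmul ⊢
    rw [← neg_eq_zero, ← hmul]
    abel

theorem insertX_differential_zero (B : BimoduleStr k S M) (f : Cochain k S M 0) :
    insertX σ c x M 0 (differential B 0 f)
      = skewCommutator σ δ (B.left x) (B.right (MulOpposite.op x)) 0
        (pull M c.toLinearMap 0 f) := by
  rw [insertX_zero, differential_eq_sub, map_sub, LinearMap.sub_apply, curry_leftDifferential,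
    curry_rightDifferential_zero, map_sub]
  rfl

theorem insertX_differential (hx : ∀ a, x * c a = c (σ a) * x + c (δ.toLin a))
    (B : BimoduleStr k S M) (n : ℕ) (f : Cochain k S M (n + 1)) :
    insertX σ c x M (n + 1) (differential B (n + 1) f)
        + differential (sigmaTwist σ (B.twist c c)) n (insertX σ c x M n f)
      = skewCommutator σ δ (B.left x) (B.right (MulOpposite.op x)) (n + 1)
        (pull M c.toLinearMap (n + 1) f) := by
  rw [differential_eq_sub, differential_eq_sub, map_sub, rightDifferential_sigmaTwist,
    skewCommutator_apply, ← insertX_leftDifferential, ← insertX_rightDifferential σ hx]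
  abel

end Insert

section Coinduced

variable {k A S M N : Type*} [CommRing k] [Ring A] [Algebra k A] [Ring S] [Algebra k S]
  [AddCommGroup M] [Module k M] [AddCommGroup N] [Module k N]

theorem mem_cocycles_zero_iff {B : BimoduleStr k S M} {f : Cochain k S M 0} :
    f ∈ cocycles B 0 ↔
      ∀ s, B.left s (f Fin.elim0) = B.right (MulOpposite.op s) (f Fin.elim0) := by
  have h : ∀ s (w : Fin 0 → S), curry (differential B 0 f) s w
      = B.left s (f w) - B.right (MulOpposite.op s) (f w) := fun s w => by
    rw [differential_eq_sub, map_sub, LinearMap.sub_apply, curry_leftDifferential,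
      curry_rightDifferential_zero]
    rfl
  refine ⟨fun hf s => ?_, fun hf => ext_curry fun s => MultilinearMap.ext fun w => ?_⟩
  · rw [← sub_eq_zero, ← h, mem_cocycles.1 hf]
    rfl
  · rw [h, Subsingleton.elim w Fin.elim0, hf, sub_self]
    rfl

/-- The quotient of a bimodule by a stable submodule. -/
def BimoduleStr.quot (B : BimoduleStr k S M) (U : Submodule k M)
    (hl : ∀ s, U ≤ U.comap (B.left s)) (hr : ∀ s, U ≤ U.comap (B.right s)) :
    BimoduleStr k S (M ⧸ U) where
  left := AlgHom.ofLinearMap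
    { toFun s := U.mapQ U (B.left s) (hl s)
      map_add' s t := Submodule.linearMap_qext _ (LinearMap.ext fun m => by simp)
      map_smul' c t := Submodule.linearMap_qext _ (LinearMap.ext fun m => by simp) }
    (Submodule.linearMap_qext _ (LinearMap.ext fun m => by simp))
    (fun s t => Submodule.linearMap_qext _ (LinearMap.ext fun m => by simp))
  right := AlgHom.ofLinearMap
    { toFun s := U.mapQ U (B.right s) (hr s)
      map_add' s t := Submodule.linearMap_qext _ (LinearMap.ext fun m => by simp)
      map_smul' c t := Submodule.linearMap_qext _ (LinearMap.ext fun m => by simp) }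
    (Submodule.linearMap_qext _ (LinearMap.ext fun m => by simp))
    (fun s t => Submodule.linearMap_qext _ (LinearMap.ext fun m => by simp))
  comm s t := Submodule.linearMap_qext _ (LinearMap.ext fun m =>
    congrArg U.mkQ (LinearMap.congr_fun (B.comm s t) m))

/-- The coinduced bimodule `Hom_k(S, M)`, with `(s · g · t)(u) = g(us) t`. -/
def coind (B : BimoduleStr k S M) : BimoduleStr k S (S →ₗ[k] M) where
  left := AlgHom.ofLinearMap
    { toFun s := LinearMap.lcomp k M (LinearMap.mulRight k s)
      map_add' s t := by ext; simp [mul_add]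
      map_smul' c t := by ext; simp }
    (by ext; simp) (fun s t => by ext; simp [mul_assoc])
  right := AlgHom.ofLinearMap
    { toFun s := LinearMap.llcomp k S M M (B.right s)
      map_add' s t := by ext; simp
      map_smul' c t := by ext; simp }
    (by ext; simp) (fun s t => by ext; simp)
  comm s t := by ext; simp [LinearMap.lcomp_apply]

theorem coind_left_apply (B : BimoduleStr k S M) (s : S) (g : S →ₗ[k] M) (u : S) :
    (coind B).left s g u = g (u * s) := rfl

/-- The embedding `m ↦ (u ↦ u m)` of `M` in the coinduced bimodule. -/
def coindIncl (B : BimoduleStr k S M) : M →ₗ[k] (S →ₗ[k] M) := B.left.toLinearMap.flip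

theorem coindIncl_apply (B : BimoduleStr k S M) (m : M) (u : S) :
    coindIncl B m u = B.left u m := rfl

theorem coindIncl_isHom (B : BimoduleStr k S M) : B.IsHom (coind B) (coindIncl B) := by
  refine ⟨fun s m => ?_, fun s m => ?_⟩
  · ext u; simp [coindIncl_apply, coind_left_apply]
  · ext u; exact LinearMap.congr_fun (B.comm u s) m

theorem coindIncl_injective (B : BimoduleStr k S M) : Function.Injective (coindIncl B) := by
  intro m m' h
  simpa [coindIncl_apply] using LinearMap.congr_fun h 1

/-- The cokernel of the embedding of `M` in the coinduced bimodule. -/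
abbrev CoindQuot (B : BimoduleStr k S M) : Type _ :=
  (S →ₗ[k] M) ⧸ LinearMap.range (coindIncl B)

/-- The bimodule structure of the cokernel of `coindIncl`. -/
def coindQuot (B : BimoduleStr k S M) : BimoduleStr k S (CoindQuot B) :=
  (coind B).quot (LinearMap.range (coindIncl B))
    (by rintro s _ ⟨m, rfl⟩; exact ⟨B.left s m, (coindIncl_isHom B).1 s m⟩)
    (by rintro s _ ⟨m, rfl⟩; exact ⟨B.right s m, (coindIncl_isHom B).2 s m⟩)

/-- The projection to the cokernel of `coindIncl`. -/
def coindProj (B : BimoduleStr k S M) : (S →ₗ[k] M) →ₗ[k] CoindQuot B := Submodule.mkQ _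

theorem coindProj_isHom (B : BimoduleStr k S M) :
    (coind B).IsHom (coindQuot B) (coindProj B) := ⟨fun _ _ => rfl, fun _ _ => rfl⟩

/- Evaluation at `1` splits `coindIncl` over `k`, so that the sequence stays exact on cochains. -/
theorem exact_push_coindIncl_coindProj (A : Type*) [Ring A] [Algebra k A] (B : BimoduleStr k S M)
    (n : ℕ) : Function.Exact (push A (coindIncl B) n) (push A (coindProj B) n) := by
  refine fun f => ⟨fun hf => ⟨push A (LinearMap.applyₗ 1) n f, ?_⟩, ?_⟩
  · ext v : 1
    obtain ⟨m, hm⟩ := (Submodule.Quotient.mk_eq_zero _).1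
      (congrArg (fun F : Cochain k A (CoindQuot B) n => F v) hf)
    change coindIncl B (f v 1) = f v
    rw [← hm, coindIncl_apply, map_one, Module.End.one_apply]
  · rintro ⟨f, rfl⟩
    ext v
    exact (Submodule.Quotient.mk_eq_zero _).2 ⟨f v, rfl⟩

theorem push_coindProj_surjective (A : Type*) [Ring A] [Algebra k A] (B : BimoduleStr k S M)
    (n : ℕ) : Function.Surjective (push A (coindProj B) n) := by
  have hker : LinearMap.range (coindIncl B)
      ≤ LinearMap.ker (LinearMap.id - coindIncl B ∘ₗ LinearMap.applyₗ (1 : S)) := by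
    rintro _ ⟨m, rfl⟩
    ext u
    simp [coindIncl_apply]
  refine fun f => ⟨push A (Submodule.liftQ _ _ hker) n f, MultilinearMap.ext fun v => ?_⟩
  obtain ⟨g, hg⟩ := Submodule.mkQ_surjective _ (f v)
  rw [push_apply, push_apply, ← hg, Submodule.mkQ_apply, Submodule.liftQ_apply]
  refine (Submodule.Quotient.eq _).2 ⟨-g 1, ?_⟩
  ext u
  simp

/-- The cochain with values in linear maps which is obtained from a linear family of cochains. -/
def flipCochain {n : ℕ} (θ : S →ₗ[k] Cochain k A M n) : Cochain k A (S →ₗ[k] M) n where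
  toFun w :=
    { toFun s := θ s w
      map_add' s t := by rw [map_add]; rfl
      map_smul' c t := by rw [map_smul]; rfl }
  map_update_add' w i a b := by ext s; exact (θ s).map_update_add w i a b
  map_update_smul' w i a b := by ext s; exact (θ s).map_update_smul w i a b

theorem push_applyₗ_flipCochain {n : ℕ} (θ : S →ₗ[k] Cochain k A M n) (s : S) :
    push A (LinearMap.applyₗ s) n (flipCochain θ) = θ s := rfl

theorem ext_push_applyₗ {n : ℕ} {f g : Cochain k A (S →ₗ[k] M) n}
    (h : ∀ s : S, push A (LinearMap.applyₗ s) n f = push A (LinearMap.applyₗ s) n g) : f = g :=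
  MultilinearMap.ext fun v => LinearMap.ext fun s =>
    congrArg (fun F : Cochain k A M n => F v) (h s)

theorem push_left_curry_of_mem_cocycles {B : BimoduleStr k A M} {n : ℕ} {f : Cochain k A M (n + 1)}
    (hf : f ∈ cocycles B (n + 1)) (a b : A) : push A (B.left a) n (curry f b)
      = curry f (a * b) - curry (rightDifferential B n (curry f a)) b := by
  have h := congrArg (fun F => curry (curry F a) b) (mem_cocycles.1 hf)
  simp only [differential_eq_sub, map_sub, LinearMap.sub_apply, curry_leftDifferential,
    curry_rightDifferential_succ, curry_mulFirst, map_zero, LinearMap.zero_apply] at h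
  exact sub_eq_zero.1 h

/- For `s = ∑ bᵢ aᵢ` the value at `s` of a primitive of `G` is `∑ G(aᵢ, …)(bᵢ)`. -/
theorem cocycles_coind_twist_le {ι : Type*} (B : BimoduleStr k S M) (ν τ : A →ₐ[k] S) (b : ι → S)
    (coeff : S →ₗ[k] (ι →₀ A)) (sum_coeff : ∀ s, ((coeff s).sum fun i a => b i * ν a) = s)
    (coeff_mul : ∀ s a, coeff (s * ν a)
      = Finsupp.mapRange.linearMap (LinearMap.mulRight k a) (coeff s)) (n : ℕ) :
    cocycles ((coind B).twist ν τ) (n + 1) ≤ coboundaries ((coind B).twist ν τ) (n + 1) := by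
  intro G hG
  let ev : S → ((S →ₗ[k] M) →ₗ[k] M) := fun s => LinearMap.applyₗ s
  have hev : ∀ (m : ℕ) (s : S) (g : Cochain k A (S →ₗ[k] M) m),
      rightDifferential (B.twist ν τ) m (push A (ev s) m g)
        = push A (ev s) (m + 1) (rightDifferential ((coind B).twist ν τ) m g) := fun m s g =>
    rightDifferential_push (fun _ _ => rfl) m g
  let Θ : (ι →₀ A) →ₗ[k] Cochain k A M n :=
    Finsupp.lsum k fun i => push A (ev (b i)) n ∘ₗ curry G
  have hΘ : ∀ i c, Θ (Finsupp.single i c) = push A (ev (b i)) n (curry G c) := fun i c => by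
    simp [Θ]
  have hdΘ : ∀ (p : ι →₀ A) (a : A),
      push A (ev (p.sum fun i c => b i * ν c)) n (curry G a)
        = Θ (Finsupp.mapRange.linearMap (LinearMap.mulRight k a) p)
          - curry (rightDifferential (B.twist ν τ) n (Θ p)) a := by
    intro p a
    induction p using Finsupp.induction_linear with
    | zero => ext w; simp [ev, push_apply]
    | add p q hp hq =>
      rw [map_add, map_add, map_add, map_add, map_add, LinearMap.add_apply, add_sub_add_comm, ← hp,
        ← hq, Finsupp.sum_add_index' (by simp) (by simp [mul_add]), ← push_add]
      simp only [ev, map_add]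
    | single i c =>
      rw [Finsupp.mapRange.linearMap_apply, Finsupp.mapRange_single, hΘ, hΘ, hev,
        Finsupp.sum_single_index (by simp), curry_push, LinearMap.mulRight_apply, ← map_sub,
        ← push_left_curry_of_mem_cocycles hG]
      rfl
  refine ⟨flipCochain (Θ ∘ₗ coeff), ext_curry fun a => ext_push_applyₗ fun s => ?_⟩
  have hs := hdΘ (coeff s) a
  rw [sum_coeff, ← coeff_mul] at hs
  rw [differential_eq_sub, map_sub, LinearMap.sub_apply, map_sub, ← curry_push, ← curry_push,
    ← hev, push_applyₗ_flipCochain]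
  exact hs.symm

theorem cocycles_coind_le (B : BimoduleStr k S M) (n : ℕ) :
    cocycles (coind B) (n + 1) ≤ coboundaries (coind B) (n + 1) :=
  cocycles_coind_twist_le B (AlgHom.id k S) (AlgHom.id k S) (fun _ : Unit => 1)
    (Finsupp.lsingle ()) (fun s => by simp) (fun s a => by simp) n

end Coinduced

namespace OreExtension

section RightCoefficients

variable {k A : Type*} [CommRing k] [Ring A] [Algebra k A] (σ : A ≃ₐ[k] A) (δ : SkewDerivation σ)

theorem induction_left {p : OreExtension σ δ → Prop} (hadd : ∀ e e', p e → p e' → p (e + e'))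
    (h : ∀ a i, p (C σ δ a * X σ δ ^ i)) (e : OreExtension σ δ) : p e := by
  refine Finsupp.induction_linear (motive := p) e ?_ hadd fun i a => ?_
  · have := h 0 0
    rwa [map_zero, zero_mul] at this
  · have := h a i
    rwa [C_mul_X_pow] at this

/-- Right multiplication by `x` in terms of the coefficients on the right. -/
def rightMulX : Module.End k (ℕ →₀ A) :=
  Finsupp.lsum k fun j =>
    Finsupp.lsingle (j + 1) ∘ₗ σ.symm.toLinearMap - Finsupp.lsingle j ∘ₗ deltaSigmaInv σ δ

theorem rightMulX_single (j : ℕ) (b : A) : rightMulX σ δ (Finsupp.single j b)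
    = Finsupp.single (j + 1) (σ.symm b) - Finsupp.single j (δ.toLin (σ.symm b)) := by
  simp [rightMulX, deltaSigmaInv]

/-- The coefficients `bⱼ` of `∑ xʲ bⱼ`. -/
def rightCoeff : OreExtension σ δ →ₗ[k] (ℕ →₀ A) :=
  (Finsupp.lsum k fun n => (rightMulX σ δ ^ n) ∘ₗ Finsupp.lsingle 0 :
    (ℕ →₀ A) →ₗ[k] (ℕ →₀ A))

/-- The element `∑ xʲ bⱼ`. -/
def ofRightCoeff : (ℕ →₀ A) →ₗ[k] OreExtension σ δ :=
  Finsupp.lsum k fun j => LinearMap.mulLeft k (X σ δ ^ j) ∘ₗ (C σ δ).toLinearMap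

theorem ofRightCoeff_apply (q : ℕ →₀ A) :
    ofRightCoeff σ δ q = q.sum fun j b => X σ δ ^ j * C σ δ b := rfl

theorem ofRightCoeff_single (j : ℕ) (b : A) :
    ofRightCoeff σ δ (Finsupp.single j b) = X σ δ ^ j * C σ δ b := by
  simp [ofRightCoeff]

theorem C_mul_X (a : A) : C σ δ a * X σ δ
    = X σ δ * C σ δ (σ.symm a) - C σ δ (δ.toLin (σ.symm a)) := by
  rw [X_mul_C, add_sub_cancel_right, AlgEquiv.apply_symm_apply]

theorem ofRightCoeff_rightMulX (q : ℕ →₀ A) :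
    ofRightCoeff σ δ (rightMulX σ δ q) = ofRightCoeff σ δ q * X σ δ := by
  induction q using Finsupp.induction_linear with
  | zero => simp
  | add p q hp hq => rw [map_add, map_add, map_add, hp, hq, add_mul]
  | single j b =>
    rw [rightMulX_single, map_sub, ofRightCoeff_single, ofRightCoeff_single, ofRightCoeff_single,
      mul_assoc, C_mul_X, mul_sub, pow_succ, mul_assoc]

theorem rightCoeff_C_mul_X_pow (a : A) (i : ℕ) :
    rightCoeff σ δ (C σ δ a * X σ δ ^ i) = (rightMulX σ δ ^ i) (Finsupp.single 0 a) := by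
  rw [C_mul_X_pow]
  exact Finsupp.lsum_single k (fun n => (rightMulX σ δ ^ n) ∘ₗ Finsupp.lsingle 0) i a

theorem ofRightCoeff_rightCoeff (e : OreExtension σ δ) :
    ofRightCoeff σ δ (rightCoeff σ δ e) = e := by
  induction e using induction_left with
  | hadd e e' h h' => rw [map_add, map_add, h, h']
  | h a i =>
    rw [rightCoeff_C_mul_X_pow]
    induction i with
    | zero => simp [ofRightCoeff_single]
    | succ i ih =>
      rw [pow_succ', Module.End.mul_apply, ofRightCoeff_rightMulX, ih, mul_assoc, ← pow_succ]

theorem induction_right {p : OreExtension σ δ → Prop} (hadd : ∀ e e', p e → p e' → p (e + e'))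
    (h : ∀ b j, p (X σ δ ^ j * C σ δ b)) (e : OreExtension σ δ) : p e := by
  rw [← ofRightCoeff_rightCoeff σ δ e]
  induction rightCoeff σ δ e using Finsupp.induction_linear with
  | zero =>
    have := h 0 0
    rwa [map_zero, mul_zero] at this
  | add q q' hq hq' => rw [map_add]; exact hadd _ _ hq hq'
  | single j b => rw [ofRightCoeff_single]; exact h b j

theorem rightCoeff_mul_X (e : OreExtension σ δ) :
    rightCoeff σ δ (e * X σ δ) = rightMulX σ δ (rightCoeff σ δ e) := by
  induction e using induction_left with
  | hadd e e' h h' => rw [add_mul, map_add, map_add, map_add, h, h']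
  | h a i =>
    rw [mul_assoc, ← pow_succ, rightCoeff_C_mul_X_pow, rightCoeff_C_mul_X_pow, pow_succ',
      Module.End.mul_apply]

theorem rightCoeff_C (a : A) : rightCoeff σ δ (C σ δ a) = Finsupp.single 0 a := by
  simpa using rightCoeff_C_mul_X_pow σ δ a 0

theorem rightMulX_lmapDomain_succ (q : ℕ →₀ A) :
    rightMulX σ δ (Finsupp.lmapDomain A k Nat.succ q)
      = Finsupp.lmapDomain A k Nat.succ (rightMulX σ δ q) := by
  induction q using Finsupp.induction_linear with
  | zero => simp
  | add p q hp hq => simp only [map_add, hp, hq]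
  | single j b =>
    rw [rightMulX_single, map_sub]
    simp only [Finsupp.lmapDomain_apply, Finsupp.mapDomain_single, rightMulX_single]

theorem rightCoeff_X_mul (e : OreExtension σ δ) :
    rightCoeff σ δ (X σ δ * e) = Finsupp.lmapDomain A k Nat.succ (rightCoeff σ δ e) := by
  induction e using induction_left with
  | hadd e e' h h' => rw [mul_add, map_add, map_add, map_add, h, h']
  | h a i =>
    induction i with
    | zero =>
      rw [pow_zero, mul_one, X_mul_C, map_add, rightCoeff_mul_X, rightCoeff_C, rightCoeff_C,
        rightCoeff_C, rightMulX_single]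
      simp
    | succ i ih =>
      rw [pow_succ, ← mul_assoc, ← mul_assoc, mul_assoc (X σ δ), rightCoeff_mul_X, ih,
        rightMulX_lmapDomain_succ, ← rightCoeff_mul_X, mul_assoc]

theorem rightCoeff_X_pow_mul_C (j : ℕ) (b : A) :
    rightCoeff σ δ (X σ δ ^ j * C σ δ b) = Finsupp.single j b := by
  induction j with
  | zero => rw [pow_zero, one_mul, rightCoeff_C]
  | succ j ih =>
    rw [pow_succ', mul_assoc, rightCoeff_X_mul, ih, Finsupp.lmapDomain_apply,
      Finsupp.mapDomain_single]

theorem rightCoeff_mul_C (e : OreExtension σ δ) (a : A) :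
    rightCoeff σ δ (e * C σ δ a)
      = Finsupp.mapRange.linearMap (LinearMap.mulRight k a) (rightCoeff σ δ e) := by
  induction e using induction_right with
  | hadd e e' h h' => rw [add_mul, map_add, map_add, map_add, h, h']
  | h b j =>
    rw [mul_assoc, ← map_mul, rightCoeff_X_pow_mul_C, rightCoeff_X_pow_mul_C]
    simp

end RightCoefficients

end OreExtension

namespace OreExtension

section Cone

variable {k A M N : Type*} [CommRing k] [Ring A] [Algebra k A] {σ : A ≃ₐ[k] A}
  {δ : SkewDerivation σ} [AddCommGroup M] [Module k M] [AddCommGroup N] [Module k N]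

/-- The restriction of an `A[x; σ, δ]`-bimodule to `A`. -/
def res (B : BimoduleStr k (OreExtension σ δ) M) : BimoduleStr k A M :=
  B.twist (C σ δ) (C σ δ)

/-- The restriction of an `A[x; σ, δ]`-bimodule to `A`, with the left action twisted by `σ`. -/
abbrev resTwist (B : BimoduleStr k (OreExtension σ δ) M) : BimoduleStr k A M :=
  sigmaTwist σ (res B)

theorem isHom_res {B : BimoduleStr k (OreExtension σ δ) M}
    {B' : BimoduleStr k (OreExtension σ δ) N} {φ : M →ₗ[k] N} (h : B.IsHom B' φ) :
    (res B).IsHom (res B') φ := h.twist _ _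

theorem isHom_resTwist {B : BimoduleStr k (OreExtension σ δ) M}
    {B' : BimoduleStr k (OreExtension σ δ) N} {φ : M →ₗ[k] N} (h : B.IsHom B' φ) :
    (resTwist B).IsHom (resTwist B') φ := (isHom_res h).twist _ _

/-- The skew commutator with `x`, for coefficients in an `A[x; σ, δ]`-bimodule. -/
def commX (B : BimoduleStr k (OreExtension σ δ) M) (n : ℕ) :
    Cochain k A M n →ₗ[k] Cochain k A M n :=
  skewCommutator σ δ (B.left (X σ δ)) (B.right (MulOpposite.op (X σ δ))) n

theorem isCochainMap_commX (B : BimoduleStr k (OreExtension σ δ) M) :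
    IsCochainMap (res B) (resTwist B) (commX B) :=
  (isSkewPair_twist σ (X_mul_C σ δ) B).isCochainMap_skewCommutator

theorem commX_push {B : BimoduleStr k (OreExtension σ δ) M}
    {B' : BimoduleStr k (OreExtension σ δ) N} {φ : M →ₗ[k] N} (h : B.IsHom B' φ) (n : ℕ)
    (f : Cochain k A M n) : commX B' n (push A φ n f) = push A φ n (commX B n f) :=
  skewCommutator_push σ δ (h.1 _) (h.2 _) n f

/-- Restriction of cochains to `A`. -/
abbrev pullC (σ : A ≃ₐ[k] A) (δ : SkewDerivation σ) (M : Type*) [AddCommGroup M] [Module k M]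
    (n : ℕ) : Cochain k (OreExtension σ δ) M n →ₗ[k] Cochain k A M n :=
  pull M (C σ δ).toLinearMap n

/-- Insertion of `x` in a cochain of `A[x; σ, δ]`, followed by restriction to `A`. -/
abbrev insertC (σ : A ≃ₐ[k] A) (δ : SkewDerivation σ) (M : Type*) [AddCommGroup M] [Module k M]
    (n : ℕ) : Cochain k (OreExtension σ δ) M (n + 1) →ₗ[k] Cochain k A M n :=
  insertX σ (C σ δ) (X σ δ) M n

/-- The differential of the mapping cone of `commX`, in positive degrees. Its cohomology turns out
to be the Hochschild cohomology of `A[x; σ, δ]`. -/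
def coneDifferential (B : BimoduleStr k (OreExtension σ δ) M) (n : ℕ) :
    Cochain k A M (n + 1) × Cochain k A M n →ₗ[k]
      Cochain k A M (n + 2) × Cochain k A M (n + 1) :=
  (differential (res B) (n + 1) ∘ₗ LinearMap.fst k _ _).prod
    (commX B (n + 1) ∘ₗ LinearMap.fst k _ _
      - differential (resTwist B) n ∘ₗ LinearMap.snd k _ _)

/-- The differential of the mapping cone of `commX`, in degree `0`. -/
def coneDifferentialZero (B : BimoduleStr k (OreExtension σ δ) M) :
    Cochain k A M 0 →ₗ[k] Cochain k A M 1 × Cochain k A M 0 :=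
  (differential (res B) 0).prod (commX B 0)

/-- The coboundaries of the mapping cone of `commX` in degree `n + 1`. -/
def coneCoboundaries (B : BimoduleStr k (OreExtension σ δ) M) :
    (n : ℕ) → Submodule k (Cochain k A M (n + 1) × Cochain k A M n)
  | 0 => LinearMap.range (coneDifferentialZero B)
  | n + 1 => LinearMap.range (coneDifferential B n)

/-- The comparison of the Hochschild cochains of `A[x; σ, δ]` with the mapping cone of `commX`. -/
def toCone (σ : A ≃ₐ[k] A) (δ : SkewDerivation σ) (M : Type*) [AddCommGroup M] [Module k M]
    (n : ℕ) : Cochain k (OreExtension σ δ) M (n + 1) →ₗ[k]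
      Cochain k A M (n + 1) × Cochain k A M n :=
  (pullC σ δ M (n + 1)).prod (insertC σ δ M n)

/-- Composition of the cochains of a mapping cone with a linear map of the coefficients. -/
def pushCone (A : Type*) [Ring A] [Algebra k A] (φ : M →ₗ[k] N) (n : ℕ) :
    Cochain k A M (n + 1) × Cochain k A M n →ₗ[k] Cochain k A N (n + 1) × Cochain k A N n :=
  (push A φ (n + 1)).prodMap (push A φ n)

theorem mem_coneCoboundaries_iff {B : BimoduleStr k (OreExtension σ δ) M} {n : ℕ}
    {p : Cochain k A M (n + 1)} {q : Cochain k A M n} :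
    (p, q) ∈ coneCoboundaries B n ↔
      ∃ g, p = differential (res B) n g ∧ q - commX B n g ∈ coboundaries (resTwist B) n := by
  cases n with
  | zero =>
    refine exists_congr fun g => Prod.ext_iff.trans (and_congr eq_comm ?_)
    exact eq_comm.trans (sub_eq_zero.symm.trans Iff.rfl)
  | succ n =>
    refine ⟨?_, ?_⟩
    · rintro ⟨⟨g, h⟩, hgh⟩
      obtain ⟨rfl, rfl⟩ := Prod.ext_iff.1 hgh
      refine ⟨g, rfl, -h, ?_⟩
      change _ = commX B (n + 1) g - differential (resTwist B) n h - commX B (n + 1) g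
      rw [map_neg, sub_sub_cancel_left]
    · rintro ⟨g, rfl, h, hh⟩
      refine ⟨(g, -h), Prod.ext rfl ?_⟩
      change commX B (n + 1) g - differential (resTwist B) n (-h) = q
      rw [map_neg, hh, sub_neg_eq_add, add_sub_cancel]

theorem coneDifferential_coneDifferentialZero (B : BimoduleStr k (OreExtension σ δ) M)
    (g : Cochain k A M 0) : coneDifferential B 0 (coneDifferentialZero B g) = 0 :=
  Prod.ext (differential_differential (res B) 0 g)
    (sub_eq_zero.2 (isCochainMap_commX B 0 g).symm)

theorem coneDifferential_coneDifferential (B : BimoduleStr k (OreExtension σ δ) M) (n : ℕ)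
    (c : Cochain k A M (n + 1) × Cochain k A M n) :
    coneDifferential B (n + 1) (coneDifferential B n c) = 0 := by
  refine Prod.ext (differential_differential (res B) (n + 1) c.1) ?_
  change commX B (n + 2) (differential (res B) (n + 1) c.1)
    - differential (resTwist B) (n + 1) (commX B (n + 1) c.1 - differential (resTwist B) n c.2) = 0
  rw [map_sub, differential_differential, sub_zero, isCochainMap_commX, sub_self]

theorem coneDifferential_of_mem_coneCoboundaries {B : BimoduleStr k (OreExtension σ δ) M} {n : ℕ}
    {c : Cochain k A M (n + 1) × Cochain k A M n} (hc : c ∈ coneCoboundaries B n) :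
    coneDifferential B n c = 0 := by
  cases n with
  | zero =>
    obtain ⟨g, rfl⟩ := hc
    exact coneDifferential_coneDifferentialZero B g
  | succ n =>
    obtain ⟨b, rfl⟩ := hc
    exact coneDifferential_coneDifferential B n b

theorem toCone_differential_zero (B : BimoduleStr k (OreExtension σ δ) M)
    (f : Cochain k (OreExtension σ δ) M 0) :
    toCone σ δ M 0 (differential B 0 f) = coneDifferentialZero B (pullC σ δ M 0 f) :=
  Prod.ext (isCochainMap_pull B (C σ δ) 0 f).symm (insertX_differential_zero σ B f)

theorem toCone_differential (B : BimoduleStr k (OreExtension σ δ) M) (n : ℕ)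
    (f : Cochain k (OreExtension σ δ) M (n + 1)) :
    toCone σ δ M (n + 1) (differential B (n + 1) f)
      = coneDifferential B n (toCone σ δ M n f) :=
  Prod.ext (isCochainMap_pull B (C σ δ) (n + 1) f).symm
    (eq_sub_of_add_eq (insertX_differential σ (X_mul_C σ δ) B n f))

theorem pullC_zero_surjective : Function.Surjective (pullC σ δ M 0) := by
  refine fun f => ⟨MultilinearMap.constOfIsEmpty k (fun _ : Fin 0 => OreExtension σ δ)
    (f Fin.elim0), ?_⟩
  ext w
  rw [Subsingleton.elim w Fin.elim0]
  rfl

theorem differential_eq_zero_of_coneDifferentialZero (B : BimoduleStr k (OreExtension σ δ) M)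
    {f : Cochain k (OreExtension σ δ) M 0}
    (hf : coneDifferentialZero B (pullC σ δ M 0 f) = 0) : differential B 0 f = 0 := by
  obtain ⟨hA, hX⟩ := Prod.ext_iff.1 hf
  have hpull : pullC σ δ M 0 f Fin.elim0 = f Fin.elim0 := congrArg f (Subsingleton.elim _ _)
  have hC : ∀ a, B.left (C σ δ a) (f Fin.elim0)
      = B.right (MulOpposite.op (C σ δ a)) (f Fin.elim0) := fun a => by
    have := mem_cocycles_zero_iff.1 (mem_cocycles.2 hA) a
    rwa [hpull] at this
  have hX : B.left (X σ δ) (f Fin.elim0) = B.right (MulOpposite.op (X σ δ)) (f Fin.elim0) := by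
    have := congrArg (fun F : Cochain k A M 0 => F Fin.elim0) hX
    change B.left _ (pullC σ δ M 0 f Fin.elim0) - B.right _ (pullC σ δ M 0 f Fin.elim0) = 0 at this
    rwa [hpull, sub_eq_zero] at this
  have hmul : ∀ s t, B.left s (f Fin.elim0) = B.right (MulOpposite.op s) (f Fin.elim0) →
      B.left t (f Fin.elim0) = B.right (MulOpposite.op t) (f Fin.elim0) →
      B.left (s * t) (f Fin.elim0) = B.right (MulOpposite.op (s * t)) (f Fin.elim0) := by
    intro s t hs ht
    rw [map_mul, Module.End.mul_apply, ht, MulOpposite.op_mul, map_mul, Module.End.mul_apply, ← hs]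
    exact LinearMap.congr_fun (B.comm s (MulOpposite.op t)) _
  refine mem_cocycles.1 (mem_cocycles_zero_iff.2 fun e => ?_)
  induction e using induction_left with
  | hadd e e' h h' =>
    rw [map_add, MulOpposite.op_add, map_add, LinearMap.add_apply, LinearMap.add_apply, h, h']
  | h a i =>
    refine hmul _ _ (hC a) ?_
    induction i with
    | zero => rw [pow_zero, MulOpposite.op_one, map_one, map_one]
    | succ i ih => exact hmul _ _ ih hX

section Push

variable {B : BimoduleStr k (OreExtension σ δ) M} {B' : BimoduleStr k (OreExtension σ δ) N}
  {φ : M →ₗ[k] N}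

theorem toCone_push (φ : M →ₗ[k] N) (n : ℕ) (f : Cochain k (OreExtension σ δ) M (n + 1)) :
    toCone σ δ N n (push _ φ (n + 1) f) = pushCone A φ n (toCone σ δ M n f) :=
  Prod.ext rfl (insertX_push σ (C σ δ) (X σ δ) φ n f)

theorem coneDifferentialZero_push (h : B.IsHom B' φ) (g : Cochain k A M 0) :
    coneDifferentialZero B' (push A φ 0 g) = pushCone A φ 0 (coneDifferentialZero B g) :=
  Prod.ext ((isHom_res h).isCochainMap_push 0 g) (commX_push h 0 g)

theorem coneDifferential_push (h : B.IsHom B' φ) (n : ℕ)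
    (c : Cochain k A M (n + 1) × Cochain k A M n) :
    coneDifferential B' n (pushCone A φ n c) = pushCone A φ (n + 1) (coneDifferential B n c) := by
  refine Prod.ext ((isHom_res h).isCochainMap_push (n + 1) c.1) ?_
  refine Eq.trans ?_ (map_sub (push A φ (n + 1)) _ _).symm
  exact congrArg₂ (· - ·) (commX_push h (n + 1) c.1) ((isHom_resTwist h).isCochainMap_push n c.2)

theorem pushCone_mem_coneCoboundaries (h : B.IsHom B' φ) {n : ℕ}
    {c : Cochain k A M (n + 1) × Cochain k A M n} (hc : c ∈ coneCoboundaries B n) :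
    pushCone A φ n c ∈ coneCoboundaries B' n := by
  cases n with
  | zero =>
    obtain ⟨g, rfl⟩ := hc
    exact ⟨_, coneDifferentialZero_push h g⟩
  | succ n =>
    obtain ⟨b, rfl⟩ := hc
    exact ⟨_, coneDifferential_push h n b⟩

theorem pushCone_injective (hφ : Function.Injective φ) (n : ℕ) :
    Function.Injective (pushCone A φ n) :=
  (push_injective hφ (n + 1)).prodMap (push_injective hφ n)

theorem pushCone_coindProj_surjective (B : BimoduleStr k (OreExtension σ δ) M) (n : ℕ) :
    Function.Surjective (pushCone A (coindProj B) n) :=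
  (push_coindProj_surjective A B (n + 1)).prodMap (push_coindProj_surjective A B n)

theorem exists_mem_coneCoboundaries_of_coindProj {B : BimoduleStr k (OreExtension σ δ) M} {n : ℕ}
    {c : Cochain k A (CoindQuot B) (n + 1) × Cochain k A (CoindQuot B) n}
    (hc : c ∈ coneCoboundaries (coindQuot B) n) :
    ∃ b ∈ coneCoboundaries (coind B) n, pushCone A (coindProj B) n b = c := by
  cases n with
  | zero =>
    obtain ⟨g, rfl⟩ := hc
    obtain ⟨g, rfl⟩ := push_coindProj_surjective A B 0 g
    exact ⟨_, ⟨g, rfl⟩, (coneDifferentialZero_push (coindProj_isHom B) g).symm⟩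
  | succ n =>
    obtain ⟨b, rfl⟩ := hc
    obtain ⟨b, rfl⟩ := pushCone_coindProj_surjective B n b
    exact ⟨_, ⟨b, rfl⟩, (coneDifferential_push (coindProj_isHom B) n b).symm⟩

theorem exact_pushCone_coindIncl_coindProj (B : BimoduleStr k (OreExtension σ δ) M) (n : ℕ) :
    Function.Exact (pushCone A (coindIncl B) n) (pushCone A (coindProj B) n) := fun c => by
  refine Iff.trans ?_ Prod.exists.symm
  refine Prod.ext_iff.trans ((and_congr (exact_push_coindIncl_coindProj A B (n + 1) c.1)
    (exact_push_coindIncl_coindProj A B n c.2)).trans ?_)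
  exact ⟨fun ⟨⟨p, hp⟩, q, hq⟩ => ⟨p, q, Prod.ext hp hq⟩,
    fun ⟨p, q, hpq⟩ => ⟨⟨p, congrArg Prod.fst hpq⟩, q, congrArg Prod.snd hpq⟩⟩

end Push

end Cone

section CoinducedCone

variable {k A M : Type*} [CommRing k] [Ring A] [Algebra k A] {σ : A ≃ₐ[k] A}
  {δ : SkewDerivation σ} [AddCommGroup M] [Module k M]
  (B : BimoduleStr k (OreExtension σ δ) M)

theorem cocycles_res_coind_le (n : ℕ) :
    cocycles (res (coind B)) (n + 1) ≤ coboundaries (res (coind B)) (n + 1) :=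
  cocycles_coind_twist_le B (C σ δ) (C σ δ) (fun i => X σ δ ^ i) (rightCoeff σ δ)
    (ofRightCoeff_rightCoeff σ δ) (rightCoeff_mul_C σ δ) n

theorem cocycles_resTwist_coind_le (n : ℕ) :
    cocycles (resTwist (coind B)) (n + 1) ≤ coboundaries (resTwist (coind B)) (n + 1) := by
  refine cocycles_coind_twist_le B ((C σ δ).comp σ.toAlgHom) (C σ δ) (fun i => X σ δ ^ i)
    (Finsupp.mapRange.linearMap σ.symm.toLinearMap ∘ₗ rightCoeff σ δ)
    (fun e => ?_) (fun e a => ?_) n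
  · conv_rhs => rw [← ofRightCoeff_rightCoeff σ δ e, ofRightCoeff_apply]
    rw [LinearMap.comp_apply, Finsupp.mapRange.linearMap_apply, Finsupp.sum_mapRange_index]
    · simp
    · simp
  · rw [LinearMap.comp_apply, AlgHom.comp_apply, rightCoeff_mul_C]
    ext i
    simp

/-- The linear map `∑ xʲ bⱼ ↦ ∑ mⱼ bⱼ`, a homomorphism of right `A`-modules. -/
def linearOfSeq (m : ℕ → M) : OreExtension σ δ →ₗ[k] M :=
  (Finsupp.lsum k fun j =>
    LinearMap.applyₗ (m j) ∘ₗ (res B).right.toLinearMap ∘ₗ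
      (MulOpposite.opLinearEquiv k).toLinearMap) ∘ₗ rightCoeff σ δ

theorem linearOfSeq_X_pow_mul_C (m : ℕ → M) (j : ℕ) (b : A) :
    linearOfSeq B m (X σ δ ^ j * C σ δ b) = (res B).right (MulOpposite.op b) (m j) := by
  rw [linearOfSeq, LinearMap.comp_apply, rightCoeff_X_pow_mul_C, Finsupp.lsum_single]
  rfl

theorem linearOfSeq_mul_C (m : ℕ → M) (e : OreExtension σ δ) (a : A) :
    linearOfSeq B m (e * C σ δ a) = (res B).right (MulOpposite.op a) (linearOfSeq B m e) := by
  induction e using induction_right with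
  | hadd e e' h h' => rw [add_mul, map_add, map_add, map_add, h, h']
  | h b j =>
    rw [mul_assoc, ← map_mul, linearOfSeq_X_pow_mul_C, linearOfSeq_X_pow_mul_C,
      MulOpposite.op_mul, map_mul, Module.End.mul_apply]

theorem exists_commutator_linearOfSeq (y : OreExtension σ δ →ₗ[k] M)
    (hy : ∀ e a, y (e * C σ δ (σ a)) = (res B).right (MulOpposite.op a) (y e)) :
    ∃ m, ∀ e, linearOfSeq B m (e * X σ δ)
      - B.right (MulOpposite.op (X σ δ)) (linearOfSeq B m e) = y e := by
  let m : ℕ → M := Nat.rec 0 fun j mj =>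
    B.right (MulOpposite.op (X σ δ)) mj + y (X σ δ ^ j)
  have hm : ∀ j, m (j + 1) = B.right (MulOpposite.op (X σ δ)) (m j) + y (X σ δ ^ j) :=
    fun _ => rfl
  refine ⟨m, fun e => ?_⟩
  induction e using induction_right with
  | hadd e e' h h' =>
    rw [add_mul, map_add, map_add, map_add, map_add, add_sub_add_comm, h, h']
  | h b j =>
    have hyb := hy (X σ δ ^ j) (σ.symm b)
    have hXb := (isSkewPair_twist σ (X_mul_C σ δ) B).right_right (σ.symm b) (m j)
    rw [AlgEquiv.apply_symm_apply] at hyb hXb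
    rw [hyb, mul_assoc, C_mul_X, mul_sub, ← mul_assoc, ← pow_succ, map_sub,
      linearOfSeq_X_pow_mul_C, linearOfSeq_X_pow_mul_C, linearOfSeq_X_pow_mul_C, hm, map_add]
    simp only [res]
    rw [hXb]
    abel

theorem exists_commX_coind_zero {y : Cochain k A (OreExtension σ δ →ₗ[k] M) 0}
    (hy : y ∈ cocycles (resTwist (coind B)) 0) :
    ∃ z ∈ cocycles (res (coind B)) 0, commX (coind B) 0 z = y := by
  obtain ⟨m, hm⟩ := exists_commutator_linearOfSeq B (y Fin.elim0)
    fun e a => LinearMap.congr_fun (mem_cocycles_zero_iff.1 hy a) e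
  refine ⟨MultilinearMap.constOfIsEmpty k (fun _ : Fin 0 => A) (linearOfSeq B m),
    mem_cocycles_zero_iff.2 fun a => LinearMap.ext fun e => linearOfSeq_mul_C B m e a, ?_⟩
  ext w e
  rw [Subsingleton.elim w Fin.elim0]
  exact hm e

theorem mem_coneCoboundaries_coind {n : ℕ}
    {c : Cochain k A (OreExtension σ δ →ₗ[k] M) (n + 1) × Cochain k A (OreExtension σ δ →ₗ[k] M) n}
    (hc : coneDifferential (coind B) n c = 0) : c ∈ coneCoboundaries (coind B) n := by
  obtain ⟨p, q⟩ := c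
  obtain ⟨hp, hpq⟩ := Prod.ext_iff.1 hc
  obtain ⟨g, rfl⟩ := cocycles_res_coind_le B n (mem_cocycles.2 hp)
  have hq : q - commX (coind B) n g ∈ cocycles (resTwist (coind B)) n := by
    rw [mem_cocycles, map_sub, isCochainMap_commX, sub_eq_zero]
    exact (sub_eq_zero.1 hpq).symm
  rw [mem_coneCoboundaries_iff]
  cases n with
  | zero =>
    obtain ⟨z, hz, hzq⟩ := exists_commX_coind_zero B hq
    refine ⟨g + z, ?_, ?_⟩
    · rw [map_add, mem_cocycles.1 hz, add_zero]
    · rw [map_add, hzq, add_sub_cancel, sub_self]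
      exact zero_mem _
  | succ n => exact ⟨g, rfl, cocycles_resTwist_coind_le B n hq⟩

end CoinducedCone

section Comparison

variable {k : Type u} {A : Type v} [CommRing k] [Ring A] [Algebra k A] {σ : A ≃ₐ[k] A}
  {δ : SkewDerivation σ}

section DimensionShift

variable {M : Type*} [AddCommGroup M] [Module k M] {B : BimoduleStr k (OreExtension σ δ) M}

theorem mem_coboundaries_one_of_toCone {F : Cochain k (OreExtension σ δ) M 1}
    (hF : F ∈ cocycles B 1) (hc : toCone σ δ M 0 F ∈ coneCoboundaries B 0) :
    F ∈ coboundaries B 1 := by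
  have hι := coindIncl_isHom B
  obtain ⟨g, hg⟩ := hc
  obtain ⟨g, rfl⟩ := pullC_zero_surjective (σ := σ) (δ := δ) g
  obtain ⟨G, hG⟩ := cocycles_coind_le B 0 (hι.push_mem_cocycles hF)
  have hcentral : differential (coind B) 0 (G - push _ (coindIncl B) 0 g) = 0 := by
    refine differential_eq_zero_of_coneDifferentialZero _ ?_
    rw [← toCone_differential_zero, map_sub, hG, map_sub, toCone_differential_zero, pull_push,
      coneDifferentialZero_push hι, hg, toCone_push, sub_self]
  refine ⟨g, push_injective (coindIncl_injective B) 1 ?_⟩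
  rw [map_sub, sub_eq_zero, hG, hι.isCochainMap_push] at hcentral
  exact hcentral.symm

theorem mem_coboundaries_succ_of_toCone {n : ℕ}
    (ih : ∀ G ∈ cocycles (coindQuot B) (n + 1),
      toCone σ δ _ n G ∈ coneCoboundaries (coindQuot B) n → G ∈ coboundaries (coindQuot B) (n + 1))
    {F : Cochain k (OreExtension σ δ) M (n + 2)} (hF : F ∈ cocycles B (n + 2))
    (hc : toCone σ δ M (n + 1) F ∈ coneCoboundaries B (n + 1)) : F ∈ coboundaries B (n + 2) := by
  have hι := coindIncl_isHom B
  have hπ := coindProj_isHom B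
  obtain ⟨c, hc⟩ := hc
  obtain ⟨G, hG⟩ := cocycles_coind_le B (n + 1) (hι.push_mem_cocycles hF)
  have hGc : toCone σ δ _ n G - pushCone A (coindIncl B) n c ∈ coneCoboundaries (coind B) n := by
    refine mem_coneCoboundaries_coind B ?_
    rw [map_sub, ← toCone_differential, hG, coneDifferential_push hι, hc, toCone_push, sub_self]
  have hπG : push _ (coindProj B) (n + 1) G ∈ cocycles (coindQuot B) (n + 1) := by
    rw [mem_cocycles, hπ.isCochainMap_push, hG]
    exact (exact_push_coindIncl_coindProj _ B (n + 2)).apply_apply_eq_zero F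
  obtain ⟨H, hH⟩ : push _ (coindProj B) (n + 1) G ∈ coboundaries (coindQuot B) (n + 1) := by
    refine ih _ hπG ?_
    have := pushCone_mem_coneCoboundaries hπ hGc
    rwa [map_sub, (exact_pushCone_coindIncl_coindProj B n).apply_apply_eq_zero, sub_zero,
      ← toCone_push] at this
  obtain ⟨H, rfl⟩ := push_coindProj_surjective _ B n H
  obtain ⟨u, hu⟩ := (exact_push_coindIncl_coindProj _ B (n + 1)
    (G - differential (coind B) n H)).1 (by rw [map_sub, ← hH, hπ.isCochainMap_push, sub_self])
  refine ⟨u, push_injective (coindIncl_injective B) _ ?_⟩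
  rw [← hι.isCochainMap_push, hu, map_sub, hG, differential_differential, sub_zero]

theorem exists_toCone_zero_eq {c : Cochain k A M 1 × Cochain k A M 0}
    (hc : coneDifferential B 0 c = 0) : ∃ F ∈ cocycles B 1, toCone σ δ M 0 F = c := by
  have hι := coindIncl_isHom B
  have hπ := coindProj_isHom B
  obtain ⟨z, hz⟩ : pushCone A (coindIncl B) 0 c ∈ coneCoboundaries (coind B) 0 :=
    mem_coneCoboundaries_coind B (by rw [coneDifferential_push hι, hc, map_zero])
  obtain ⟨z, rfl⟩ := pullC_zero_surjective (σ := σ) (δ := δ) z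
  have hπz : push _ (coindProj B) 1 (differential (coind B) 0 z) = 0 := by
    rw [← hπ.isCochainMap_push]
    refine differential_eq_zero_of_coneDifferentialZero _ ?_
    rw [pull_push, coneDifferentialZero_push hπ, hz]
    exact (exact_pushCone_coindIncl_coindProj B 0).apply_apply_eq_zero c
  obtain ⟨F, hF⟩ := (exact_push_coindIncl_coindProj _ B 1 _).1 hπz
  refine ⟨F, ?_, pushCone_injective (coindIncl_injective B) 0 ?_⟩
  · refine push_injective (coindIncl_injective B) _ ?_
    rw [← hι.isCochainMap_push, hF, differential_differential, map_zero]
  · rw [← toCone_push, hF, toCone_differential_zero, hz]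

theorem exists_toCone_succ_sub_mem {n : ℕ}
    (ih : ∀ c, coneDifferential (coindQuot B) n c = 0 → ∃ F ∈ cocycles (coindQuot B) (n + 1),
      toCone σ δ _ n F - c ∈ coneCoboundaries (coindQuot B) n)
    {c : Cochain k A M (n + 2) × Cochain k A M (n + 1)} (hc : coneDifferential B (n + 1) c = 0) :
    ∃ F ∈ cocycles B (n + 2), toCone σ δ M (n + 1) F - c ∈ coneCoboundaries B (n + 1) := by
  have hι := coindIncl_isHom B
  have hπ := coindProj_isHom B
  obtain ⟨Y, hY⟩ : pushCone A (coindIncl B) (n + 1) c ∈ coneCoboundaries (coind B) (n + 1) :=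
    mem_coneCoboundaries_coind B (by rw [coneDifferential_push hι, hc, map_zero])
  obtain ⟨F, hF, hFY⟩ := ih (pushCone A (coindProj B) n Y) (by
    rw [coneDifferential_push hπ, hY]
    exact (exact_pushCone_coindIncl_coindProj B (n + 1)).apply_apply_eq_zero c)
  obtain ⟨F, rfl⟩ := push_coindProj_surjective _ B (n + 1) F
  obtain ⟨b, hb, hbF⟩ : ∃ b ∈ coneCoboundaries (coind B) n, pushCone A (coindProj B) n b
      = toCone σ δ _ n (push _ (coindProj B) (n + 1) F) - pushCone A (coindProj B) n Y :=
    exists_mem_coneCoboundaries_of_coindProj hFY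
  obtain ⟨w, hw⟩ := (exact_pushCone_coindIncl_coindProj B n (toCone σ δ _ n F - Y - b)).1
    (by rw [map_sub, map_sub, hbF, toCone_push, sub_self])
  rw [mem_cocycles, hπ.isCochainMap_push] at hF
  obtain ⟨F', hF'⟩ := (exact_push_coindIncl_coindProj _ B (n + 2) _).1 hF
  refine ⟨F', ?_, w, pushCone_injective (coindIncl_injective B) _ ?_⟩
  · refine push_injective (coindIncl_injective B) _ ?_
    rw [← hι.isCochainMap_push, hF', differential_differential, map_zero]
  · rw [← coneDifferential_push hι, hw, map_sub, map_sub, hY,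
      coneDifferential_of_mem_coneCoboundaries hb, sub_zero, ← toCone_differential, ← hF',
      toCone_push, map_sub]

end DimensionShift

theorem mem_coboundaries_of_toCone {M : Type v} [AddCommGroup M] [Module k M]
    {B : BimoduleStr k (OreExtension σ δ) M} {n : ℕ} {F : Cochain k (OreExtension σ δ) M (n + 1)}
    (hF : F ∈ cocycles B (n + 1)) (hc : toCone σ δ M n F ∈ coneCoboundaries B n) :
    F ∈ coboundaries B (n + 1) := by
  induction n generalizing M with
  | zero => exact mem_coboundaries_one_of_toCone hF hc
  | succ n ih => exact mem_coboundaries_succ_of_toCone (fun G hG hGc => ih hG hGc) hF hc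

theorem exists_toCone_sub_mem {M : Type v} [AddCommGroup M] [Module k M]
    {B : BimoduleStr k (OreExtension σ δ) M} {n : ℕ}
    {c : Cochain k A M (n + 1) × Cochain k A M n} (hc : coneDifferential B n c = 0) :
    ∃ F ∈ cocycles B (n + 1), toCone σ δ M n F - c ∈ coneCoboundaries B n := by
  induction n generalizing M with
  | zero =>
    obtain ⟨F, hF, rfl⟩ := exists_toCone_zero_eq hc
    exact ⟨F, hF, by rw [sub_self]; exact zero_mem _⟩
  | succ n ih => exact exists_toCone_succ_sub_mem (fun c hc => ih hc) hc

end Comparison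

end OreExtension

section Env

variable {k A M N : Type*} [CommRing k] [Ring A] [Algebra k A] [AddCommGroup M] [Module k M]
  [AddCommGroup N] [Module k N]

/-- The action of the enveloping algebra on a bimodule. -/
def BimoduleStr.env (B : BimoduleStr k A M) : A ⊗[k] Aᵐᵒᵖ →ₐ[k] Module.End k M :=
  Algebra.TensorProduct.lift B.left B.right B.comm

theorem BimoduleStr.env_tmul (B : BimoduleStr k A M) (a : A) (b : Aᵐᵒᵖ) (m : M) :
    B.env (a ⊗ₜ b) m = B.left a (B.right b m) := by
  simp [BimoduleStr.env]

theorem BimoduleStr.IsHom.map_env {B : BimoduleStr k A M} {B' : BimoduleStr k A N}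
    {φ : M →ₗ[k] N} (h : B.IsHom B' φ) (r : A ⊗[k] Aᵐᵒᵖ) (m : M) :
    φ (B.env r m) = B'.env r (φ m) := by
  induction r with
  | zero => simp
  | add r s hr hs => simp only [map_add, LinearMap.add_apply, hr, hs]
  | tmul a b => rw [env_tmul, env_tmul, h.1, h.2]

variable (k A M) [Module (A ⊗[k] Aᵐᵒᵖ) M] [IsScalarTower k (A ⊗[k] Aᵐᵒᵖ) M]

/-- The bimodule structure of a module over the enveloping algebra. -/
def BimoduleStr.ofEnv : BimoduleStr k A M where
  left := (Algebra.lsmul k k M).comp Algebra.TensorProduct.includeLeft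
  right := (Algebra.lsmul k k M).comp Algebra.TensorProduct.includeRight
  comm a b := by
    refine Commute.map (f := Algebra.lsmul k k M) ?_
    change (a ⊗ₜ[k] (1 : Aᵐᵒᵖ)) * ((1 : A) ⊗ₜ[k] b) = ((1 : A) ⊗ₜ[k] b) * (a ⊗ₜ[k] (1 : Aᵐᵒᵖ))
    simp

variable {k A M}

theorem BimoduleStr.ofEnv_left (a : A) (m : M) :
    (BimoduleStr.ofEnv k A M).left a m = (a ⊗ₜ[k] (1 : Aᵐᵒᵖ)) • m := rfl

theorem BimoduleStr.ofEnv_right (b : Aᵐᵒᵖ) (m : M) :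
    (BimoduleStr.ofEnv k A M).right b m = ((1 : A) ⊗ₜ[k] b) • m := rfl

theorem BimoduleStr.ofEnv_env (r : A ⊗[k] Aᵐᵒᵖ) (m : M) :
    (BimoduleStr.ofEnv k A M).env r m = r • m := by
  induction r with
  | zero => exact LinearMap.zero_apply m |>.trans (zero_smul (A ⊗[k] Aᵐᵒᵖ) m).symm
  | add r s hr hs => rw [map_add, LinearMap.add_apply, hr, hs, add_smul]
  | tmul a b =>
    rw [env_tmul, ofEnv_left, ofEnv_right, smul_smul, Algebra.TensorProduct.tmul_mul_tmul, mul_one,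
      one_mul]

theorem BimoduleStr.ofEnv_isHom [Module (A ⊗[k] Aᵐᵒᵖ) N] [IsScalarTower k (A ⊗[k] Aᵐᵒᵖ) N]
    (φ : M →ₗ[A ⊗[k] Aᵐᵒᵖ] N) :
    (BimoduleStr.ofEnv k A M).IsHom (BimoduleStr.ofEnv k A N) (φ.restrictScalars k) :=
  ⟨fun _ _ => φ.map_smul _ _, fun _ _ => φ.map_smul _ _⟩

end Env

section Projective

theorem exists_isHom_comp_eq_of_projective {k A M N : Type*} [CommRing k] [Ring A] [Algebra k A]
    [AddCommGroup M] [Module k M] [AddCommGroup N] [Module k N] {X : Type*}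
    [AddCommGroup X] [Module k X] [Module (A ⊗[k] Aᵐᵒᵖ) X] [IsScalarTower k (A ⊗[k] Aᵐᵒᵖ) X]
    [Module.Projective (A ⊗[k] Aᵐᵒᵖ) X] {B : BimoduleStr k A M} {B' : BimoduleStr k A N}
    {π : M →ₗ[k] N} (hπ : B.IsHom B' π) (hs : Function.Surjective π) {φ : X →ₗ[k] N}
    (hφ : (BimoduleStr.ofEnv k A X).IsHom B' φ) :
    ∃ θ : X →ₗ[k] M, (BimoduleStr.ofEnv k A X).IsHom B θ ∧ π ∘ₗ θ = φ := by
  let _ : Module (A ⊗[k] Aᵐᵒᵖ) M := Module.compHom M B.env.toRingHom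
  let _ : Module (A ⊗[k] Aᵐᵒᵖ) N := Module.compHom N B'.env.toRingHom
  have hM : ∀ (r : A ⊗[k] Aᵐᵒᵖ) (m : M), r • m = B.env r m := fun _ _ => rfl
  have : IsScalarTower k (A ⊗[k] Aᵐᵒᵖ) M := ⟨fun c r m => by
    rw [hM, hM, map_smul, LinearMap.smul_apply]⟩
  let π' : M →ₗ[A ⊗[k] Aᵐᵒᵖ] N := { π with map_smul' := hπ.map_env }
  have hφ' : ∀ (r : A ⊗[k] Aᵐᵒᵖ) (x : X), φ (r • x) = r • φ x := fun r x => by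
    rw [← BimoduleStr.ofEnv_env]
    exact hφ.map_env r x
  obtain ⟨θ, hθ⟩ := Module.projective_lifting_property π' { φ with map_smul' := hφ' } hs
  refine ⟨θ.restrictScalars k, ⟨fun a x => ?_, fun b x => ?_⟩,
    LinearMap.ext fun x => LinearMap.congr_fun hθ x⟩
  · refine (θ.map_smul (a ⊗ₜ[k] (1 : Aᵐᵒᵖ)) x).trans ?_
    rw [hM, BimoduleStr.env_tmul, map_one, Module.End.one_apply]
    rfl
  · refine (θ.map_smul ((1 : A) ⊗ₜ[k] b) x).trans ?_
    rw [hM, BimoduleStr.env_tmul, map_one, Module.End.one_apply]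
    rfl

variable {k R X Z : Type*} [CommRing k] [Ring R] [Algebra k R] [AddCommGroup X] [Module k X]
  [Module R X] [IsScalarTower k R X] [AddCommGroup Z] [Module k Z] [Module R Z]
  [IsScalarTower k R Z]

variable (R) in
theorem projective_of_projective_algebra [Module.Projective k R] [Module.Projective R X] :
    Module.Projective k X := by
  obtain ⟨s, hs⟩ := Module.projective_def'.1 (inferInstance : Module.Projective R X)
  have : Module.Projective k (X →₀ R) := by
    classical
    exact Module.Projective.of_equiv' (finsuppLequivDFinsupp (ι := X) (M := R) k).symm
  exact Module.Projective.of_split (s.restrictScalars k)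
    ((Finsupp.linearCombination R (id : X → X)).restrictScalars k)
    (LinearMap.ext fun x => LinearMap.congr_fun hs x)

theorem projective_ker_of_surjective [Module.Projective k X] [Module.Projective k Z]
    {π : X →ₗ[R] Z} (hπ : Function.Surjective π) : Module.Projective k (LinearMap.ker π) := by
  obtain ⟨s, hs⟩ := LinearMap.exists_rightInverse_of_surjective (π.restrictScalars k)
    (LinearMap.range_eq_top.2 hπ)
  have hs' : ∀ z, π (s z) = z := LinearMap.congr_fun hs
  have hker : ∀ x : X, π (x - s (π x)) = 0 := fun x => by rw [map_sub, hs', sub_self]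
  refine Module.Projective.of_split ((LinearMap.ker π).subtype.restrictScalars k)
    ((LinearMap.id - s ∘ₗ π.restrictScalars k).codRestrict
      ((LinearMap.ker π).restrictScalars k) hker) (LinearMap.ext fun z => Subtype.ext ?_)
  change z.1 - s (π z.1) = z.1
  rw [z.2, map_zero, sub_zero]

end Projective

section Universal

variable {k : Type u} {A : Type v} [CommRing k] [Ring A] [Algebra k A]

section Coinduced

variable {K N : Type*} [AddCommGroup K] [Module k K] [AddCommGroup N] [Module k N]

theorem exists_isHom_coindIncl_comp_eq {B' : BimoduleStr k A K} {B : BimoduleStr k A N}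
    {χ : K →ₗ[k] (A →ₗ[k] N)} (hχ : B'.IsHom (coind B) χ) (h : coindProj B ∘ₗ χ = 0) :
    ∃ φ : K →ₗ[k] N, B'.IsHom B φ ∧ coindIncl B ∘ₗ φ = χ := by
  have hφ : ∀ z, coindIncl B (χ z 1) = χ z := fun z => by
    obtain ⟨m, hm⟩ := (Submodule.Quotient.mk_eq_zero _).1 (LinearMap.congr_fun h z)
    rw [← hm, coindIncl_apply, map_one, Module.End.one_apply]
  have hinj := coindIncl_injective B
  refine ⟨LinearMap.applyₗ 1 ∘ₗ χ, ⟨fun a z => hinj ?_, fun a z => hinj ?_⟩, LinearMap.ext hφ⟩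
  · exact (hφ _).trans ((hχ.1 a z).trans
      ((congrArg _ (hφ z).symm).trans ((coindIncl_isHom B).1 a _).symm))
  · exact (hφ _).trans ((hχ.2 a z).trans
      ((congrArg _ (hφ z).symm).trans ((coindIncl_isHom B).2 a _).symm))

theorem exists_cocycle_of_push_coindProj {B : BimoduleStr k A N} {n : ℕ}
    {f : Cochain k A (CoindQuot B) n} (hf : f ∈ coboundaries (coindQuot B) n) :
    ∃ b ∈ cocycles (coind B) n, push A (coindProj B) n b = f := by
  cases n with
  | zero =>
    obtain rfl : f = 0 := hf
    exact ⟨0, zero_mem _, map_zero _⟩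
  | succ n =>
    obtain ⟨g, rfl⟩ := hf
    obtain ⟨g, rfl⟩ := push_coindProj_surjective A B n g
    exact ⟨_, coboundaries_le_cocycles _ _ (differential_mem_coboundaries _ n g),
      ((coindProj_isHom B).isCochainMap_push n g).symm⟩

end Coinduced

/-- A cocycle is universal if every cocycle of the same degree is cohomologous to its image under a
homomorphism of bimodules. -/
def IsUniversalCocycle {Z : Type v} [AddCommGroup Z] [Module k Z] (B : BimoduleStr k A Z) {n : ℕ}
    (c : Cochain k A Z n) : Prop :=
  c ∈ cocycles B n ∧ ∀ (N : Type v) [AddCommGroup N] [Module k N] (B' : BimoduleStr k A N),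
    ∀ f ∈ cocycles B' n, ∃ φ : Z →ₗ[k] N, B.IsHom B' φ ∧ f - push A φ n c ∈ coboundaries B' n

section Syzygy

variable {Z X : Type v} [AddCommGroup Z] [Module k Z] [Module (A ⊗[k] Aᵐᵒᵖ) Z]
  [IsScalarTower k (A ⊗[k] Aᵐᵒᵖ) Z] [AddCommGroup X] [Module k X] [Module (A ⊗[k] Aᵐᵒᵖ) X]
  [IsScalarTower k (A ⊗[k] Aᵐᵒᵖ) X] {π : X →ₗ[A ⊗[k] Aᵐᵒᵖ] Z} {s : Z →ₗ[k] X} {n : ℕ}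
  {c : Cochain k A Z n}

theorem IsUniversalCocycle.exists_isHom_of_succ [Module.Projective (A ⊗[k] Aᵐᵒᵖ) X]
    (hc : IsUniversalCocycle (BimoduleStr.ofEnv k A Z) c)
    (hs : π.restrictScalars k ∘ₗ s = LinearMap.id)
    {c' : Cochain k A (LinearMap.ker π) (n + 1)}
    (hc' : push A ((LinearMap.ker π).subtype.restrictScalars k) (n + 1) c'
      = differential (BimoduleStr.ofEnv k A X) n (push A s n c))
    {N : Type v} [AddCommGroup N] [Module k N] {B : BimoduleStr k A N}
    {f : Cochain k A N (n + 1)} (hf : f ∈ cocycles B (n + 1)) :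
    ∃ φ : LinearMap.ker π →ₗ[k] N, (BimoduleStr.ofEnv k A (LinearMap.ker π)).IsHom B φ ∧
      f - push A φ (n + 1) c' ∈ coboundaries B (n + 1) := by
  have hι := coindIncl_isHom B
  have hρ := coindProj_isHom B
  have hi : (BimoduleStr.ofEnv k A (LinearMap.ker π)).IsHom (BimoduleStr.ofEnv k A X)
      ((LinearMap.ker π).subtype.restrictScalars k) := BimoduleStr.ofEnv_isHom (N := X) _
  obtain ⟨g, hg⟩ := cocycles_coind_le B n (hι.push_mem_cocycles hf)
  have hgc : push A (coindProj B) n g ∈ cocycles (coindQuot B) n := by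
    rw [mem_cocycles, hρ.isCochainMap_push, hg]
    exact (exact_push_coindIncl_coindProj A B (n + 1)).apply_apply_eq_zero f
  obtain ⟨ψ, hψ, hψc⟩ := hc.2 _ _ _ hgc
  obtain ⟨θ, hθ, hθψ⟩ := exists_isHom_comp_eq_of_projective hρ (Submodule.mkQ_surjective _)
    (hψ.comp (BimoduleStr.ofEnv_isHom (k := k) (A := A) π))
  obtain ⟨φ, hφ, hφθ⟩ := exists_isHom_coindIncl_comp_eq
    (hθ.comp hi) (by
      refine LinearMap.ext fun z => (LinearMap.congr_fun hθψ z).trans ?_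
      change ψ (π z) = 0
      rw [z.2, map_zero])
  obtain ⟨b, hb, hbψ⟩ := exists_cocycle_of_push_coindProj hψc
  have hθs : (coindProj B ∘ₗ θ) ∘ₗ s = ψ := by
    rw [hθψ, LinearMap.comp_assoc, hs, LinearMap.comp_id]
  obtain ⟨w, hw⟩ := (exact_push_coindIncl_coindProj A B n (g - push A θ n (push A s n c) - b)).1
    (by rw [map_sub, hbψ, map_sub, push_push, push_push, hθs, sub_self])
  refine ⟨φ, hφ, w, push_injective (coindIncl_injective B) _ ?_⟩
  rw [← hι.isCochainMap_push, hw, map_sub, map_sub, map_sub, hg, mem_cocycles.1 hb,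
    hθ.isCochainMap_push, ← hc', push_push, push_push, hφθ, sub_zero]

theorem IsUniversalCocycle.exists_ker [Module.Projective k Z] [Module.Projective (A ⊗[k] Aᵐᵒᵖ) X]
    (hc : IsUniversalCocycle (BimoduleStr.ofEnv k A Z) c) (hπ : Function.Surjective π) :
    ∃ c' : Cochain k A (LinearMap.ker π) (n + 1),
      IsUniversalCocycle (BimoduleStr.ofEnv k A (LinearMap.ker π)) c' := by
  obtain ⟨s, hs⟩ := LinearMap.exists_rightInverse_of_surjective (π.restrictScalars k)
    (LinearMap.range_eq_top.2 hπ)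
  have hker : push A (π.restrictScalars k) (n + 1)
      (differential (BimoduleStr.ofEnv k A X) n (push A s n c)) = 0 := by
    rw [← (BimoduleStr.ofEnv_isHom (k := k) (A := A) π).isCochainMap_push, push_push, hs]
    exact hc.1
  let c' : Cochain k A (LinearMap.ker π) (n + 1) :=
    (differential (BimoduleStr.ofEnv k A X) n (push A s n c)).codRestrict
      (LinearMap.ker (π.restrictScalars k)) fun v =>
        congrArg (fun F : Cochain k A Z (n + 1) => F v) hker
  have hc' : push A ((LinearMap.ker π).subtype.restrictScalars k) (n + 1) c'
      = differential (BimoduleStr.ofEnv k A X) n (push A s n c) := rfl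
  have hi : (BimoduleStr.ofEnv k A (LinearMap.ker π)).IsHom (BimoduleStr.ofEnv k A X)
      ((LinearMap.ker π).subtype.restrictScalars k) := BimoduleStr.ofEnv_isHom (N := X) _
  refine ⟨c', ?_, fun N _ _ B f hf => hc.exists_isHom_of_succ hs hc' hf⟩
  refine push_injective (φ := (LinearMap.ker π).subtype.restrictScalars k)
    Subtype.val_injective _ ?_
  rw [← hi.isCochainMap_push, hc', differential_differential, map_zero]

theorem IsUniversalCocycle.exists_of_ker_eq [Module.Projective k Z] [Module.Projective k X]
    [Module.Projective (A ⊗[k] Aᵐᵒᵖ) X] (hc : IsUniversalCocycle (BimoduleStr.ofEnv k A Z) c)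
    (hπ : Function.Surjective π) {U : Submodule (A ⊗[k] Aᵐᵒᵖ) X} (hU : LinearMap.ker π = U) :
    Module.Projective k U ∧
      ∃ c' : Cochain k A U (n + 1), IsUniversalCocycle (BimoduleStr.ofEnv k A U) c' := by
  subst hU
  exact ⟨projective_ker_of_surjective hπ, hc.exists_ker hπ⟩

end Syzygy

theorem exists_isUniversalCocycle_range [Module.Projective k A] {X : ℕ → Type v}
    [∀ i, AddCommGroup (X i)] [∀ i, Module k (X i)] [∀ i, Module (A ⊗[k] Aᵐᵒᵖ) (X i)]
    [∀ i, IsScalarTower k (A ⊗[k] Aᵐᵒᵖ) (X i)] [∀ i, Module.Projective (A ⊗[k] Aᵐᵒᵖ) (X i)]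
    {d : ∀ i, X (i + 1) →ₗ[A ⊗[k] Aᵐᵒᵖ] X i} (hd : ∀ i, Function.Exact (d (i + 1)) (d i))
    [Module.Projective k (LinearMap.range (d 0))] {c : Cochain k A (LinearMap.range (d 0)) 1}
    (hc : IsUniversalCocycle (BimoduleStr.ofEnv k A (LinearMap.range (d 0))) c) (n : ℕ) :
    Module.Projective k (LinearMap.range (d n)) ∧
      ∃ c : Cochain k A (LinearMap.range (d n)) (n + 1),
        IsUniversalCocycle (BimoduleStr.ofEnv k A (LinearMap.range (d n))) c := by
  induction n with
  | zero => exact ⟨inferInstance, c, hc⟩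
  | succ n ih =>
    obtain ⟨_, c, hc⟩ := ih
    have : Module.Projective k Aᵐᵒᵖ := Module.Projective.of_equiv' (MulOpposite.opLinearEquiv k)
    have : Module.Projective k (X (n + 1)) := projective_of_projective_algebra (A ⊗[k] Aᵐᵒᵖ)
    exact hc.exists_of_ker_eq (d n).surjective_rangeRestrict
      ((LinearMap.ker_rangeRestrict _).trans (hd n).linearMap_ker_eq)

/- A homomorphism out of a finitely generated bimodule is determined by finitely many values. -/
theorem IsUniversalCocycle.eventually_sub_push_mem_coboundaries {Y N : Type v} [AddCommGroup Y]
    [Module k Y] [Module (A ⊗[k] Aᵐᵒᵖ) Y] [IsScalarTower k (A ⊗[k] Aᵐᵒᵖ) Y]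
    [Module.Finite (A ⊗[k] Aᵐᵒᵖ) Y] {d : ℕ} {c : Cochain k A Y d}
    (hc : IsUniversalCocycle (BimoduleStr.ofEnv k A Y) c) [AddCommGroup N] [Module k N]
    {B : BimoduleStr k A N} {ι : Type*} {l : Filter ι} (P : ι → N →ₗ[k] N)
    (hP : ∀ i, B.IsHom B (P i)) (hfin : ∀ m, ∀ᶠ i in l, P i m = m) {f : Cochain k A N d}
    (hf : f ∈ cocycles B d) : ∀ᶠ i in l, f - push A (P i) d f ∈ coboundaries B d := by
  obtain ⟨φ, hφ, hfφ⟩ := hc.2 N B f hf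
  obtain ⟨T, hT⟩ := Module.Finite.fg_top (R := A ⊗[k] Aᵐᵒᵖ) (M := Y)
  filter_upwards [(Filter.eventually_all_finset T).2 fun y _ => hfin (φ y)] with i hi
  have hPφ : P i ∘ₗ φ = φ := by
    ext y
    have hy : y ∈ Submodule.span (A ⊗[k] Aᵐᵒᵖ) (T : Set Y) := hT ▸ Submodule.mem_top
    rw [LinearMap.comp_apply]
    induction hy using Submodule.span_induction with
    | mem y hy => exact hi y hy
    | zero => rw [map_zero, map_zero]
    | add x y _ _ hx hy => rw [map_add, map_add, hx, hy]
    | smul r y _ hy => rw [← BimoduleStr.ofEnv_env, hφ.map_env, (hP i).map_env, hy]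
  have h := sub_mem hfφ ((hP i).push_mem_coboundaries hfφ)
  rwa [map_sub, push_push, hPφ, sub_sub_sub_cancel_right] at h

section Regular

attribute [local instance] instModuleTensorProductMop

theorem isScalarTower_env : IsScalarTower k (A ⊗[k] Aᵐᵒᵖ) A :=
  ⟨fun r ab a => by
    change TensorProduct.Algebra.moduleAux _ _ = _ • TensorProduct.Algebra.moduleAux _ _
    rw [map_smul, LinearMap.smul_apply]⟩

attribute [local instance] isScalarTower_env

theorem isUniversalCocycle_one :
    IsUniversalCocycle (BimoduleStr.ofEnv k A A)
      (MultilinearMap.constOfIsEmpty k (fun _ : Fin 0 => A) 1) := by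
  have hl : ∀ a b : A, (BimoduleStr.ofEnv k A A).left a b = a * b := fun a b => by
    rw [BimoduleStr.ofEnv_left, TensorProduct.Algebra.smul_def, one_smul]
    rfl
  have hr : ∀ (a : Aᵐᵒᵖ) (b : A), (BimoduleStr.ofEnv k A A).right a b = b * a.unop := fun a b => by
    rw [BimoduleStr.ofEnv_right, TensorProduct.Algebra.smul_def, one_smul]
    rfl
  refine ⟨mem_cocycles_zero_iff.2 fun a => ?_, fun N _ _ B f hf => ?_⟩
  · rw [hl, hr]
    exact (mul_one a).trans (one_mul a).symm
  · rw [mem_cocycles_zero_iff] at hf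
    refine ⟨B.left.toLinearMap.flip (f Fin.elim0), ⟨fun a b => ?_, fun a b => ?_⟩, ?_⟩
    · rw [hl]
      simp
    · rw [hr]
      simp only [LinearMap.flip_apply, AlgHom.toLinearMap_apply, map_mul, Module.End.mul_apply]
      rw [hf]
      exact LinearMap.congr_fun (B.comm b a) _
    · rw [coboundaries, Submodule.mem_bot, sub_eq_zero]
      ext w
      rw [Subsingleton.elim w Fin.elim0]
      change _ = B.left 1 _
      rw [map_one]
      rfl

theorem eventually_sub_push_mem_coboundaries [Module.Projective k A]
    (hres : HasFGProjectiveResolution k A) {N : Type v} [AddCommGroup N] [Module k N]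
    {B : BimoduleStr k A N} {ι : Type*} {l : Filter ι} (P : ι → N →ₗ[k] N)
    (hP : ∀ i, B.IsHom B (P i)) (hfin : ∀ m, ∀ᶠ i in l, P i m = m) {d : ℕ}
    {f : Cochain k A N d} (hf : f ∈ cocycles B d) :
    ∀ᶠ i in l, f - push A (P i) d f ∈ coboundaries B d := by
  obtain ⟨R, _⟩ := hres
  let _ : ∀ i, Module k (R.complex.X i) := fun i => Module.compHom _ (algebraMap k (A ⊗[k] Aᵐᵒᵖ))
  have : ∀ i, IsScalarTower k (A ⊗[k] Aᵐᵒᵖ) (R.complex.X i) := fun i =>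
    ⟨fun c r x => (congrArg (· • x) (Algebra.smul_def c r)).trans (mul_smul _ r x)⟩
  have : ∀ i, Module.Projective (A ⊗[k] Aᵐᵒᵖ) (R.complex.X i) := fun i =>
    (IsProjective.iff_projective (R.complex.X i)).2 (R.projective i)
  have : Module.Projective k Aᵐᵒᵖ := Module.Projective.of_equiv' (MulOpposite.opLinearEquiv k)
  have : Module.Projective k (R.complex.X 0) := projective_of_projective_algebra (A ⊗[k] Aᵐᵒᵖ)
  let ε : R.complex.X 0 →ₗ[A ⊗[k] Aᵐᵒᵖ] A := (R.π.f 0).hom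
  let D : ∀ i, R.complex.X (i + 1) →ₗ[A ⊗[k] Aᵐᵒᵖ] R.complex.X i :=
    fun i => (R.complex.d (i + 1) i).hom
  have hε : Function.Surjective ε := (ModuleCat.epi_iff_surjective _).1 inferInstance
  have h₀ : Function.Exact (D 0) ε :=
    (CategoryTheory.ShortComplex.ShortExact.moduleCat_exact_iff_function_exact _).1 R.exact₀
  have hsucc : ∀ i, Function.Exact (D (i + 1)) (D i) := fun i =>
    (CategoryTheory.ShortComplex.ShortExact.moduleCat_exact_iff_function_exact _).1
      (R.exact_succ i)
  cases d with
  | zero =>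
    have : Module.Finite (A ⊗[k] Aᵐᵒᵖ) A := Module.Finite.of_surjective ε hε
    exact isUniversalCocycle_one.eventually_sub_push_mem_coboundaries P hP hfin hf
  | succ n =>
    obtain ⟨_, c, hc⟩ := isUniversalCocycle_one.exists_of_ker_eq hε h₀.linearMap_ker_eq
    obtain ⟨_, c, hc⟩ := exists_isUniversalCocycle_range (X := fun i => R.complex.X i)
      (d := D) hsucc hc n
    exact hc.eventually_sub_push_mem_coboundaries P hP hfin hf

end Regular

end Universal

section Decomposition

variable {k A M N₀ N : Type*} [CommRing k] [Ring A] [Algebra k A] [AddCommGroup M] [Module k M]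
  [AddCommGroup N₀] [Module k N₀] [AddCommGroup N] [Module k N]

/-- A decomposition of the bimodule `N` as a direct sum of copies of `N₀` indexed by `ι`. -/
structure BimoduleDecomp (ι : Type*) (B₀ : BimoduleStr k A N₀) (B : BimoduleStr k A N) where
  /-- the coordinates of an element -/
  equiv : N ≃ₗ[k] (ι →₀ N₀)
  isHom_coord : ∀ i, B.IsHom B₀ (Finsupp.lapply i ∘ₗ equiv.toLinearMap)

namespace BimoduleDecomp

variable {ι : Type*} {B₀ : BimoduleStr k A N₀} {B : BimoduleStr k A N} (D : BimoduleDecomp ι B₀ B)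

/-- The inclusion of the `i`-th summand of a decomposition. -/
def incl (i : ι) : N₀ →ₗ[k] N := D.equiv.symm.toLinearMap ∘ₗ Finsupp.lsingle i

/-- The projection onto the `i`-th summand of a decomposition. -/
def proj (i : ι) : N →ₗ[k] N₀ := Finsupp.lapply i ∘ₗ D.equiv.toLinearMap

theorem proj_isHom (i : ι) : B.IsHom B₀ (D.proj i) :=
  D.isHom_coord i

theorem proj_incl (i j : ι) (m : N₀) : D.proj j (D.incl i m) = Finsupp.single i m j := by
  simp [proj, incl]

theorem incl_isHom (i : ι) : B₀.IsHom B (D.incl i) := by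
  have hinj : ∀ {x y : N}, (∀ j, D.proj j x = D.proj j y) → x = y := fun h =>
    D.equiv.injective (Finsupp.ext h)
  refine ⟨fun s m => hinj fun j => ?_, fun s m => hinj fun j => ?_⟩
  · rw [(D.proj_isHom j).1, proj_incl, proj_incl, ← Finsupp.mapRange_single (hf := map_zero _),
      Finsupp.mapRange_apply]
  · rw [(D.proj_isHom j).2, proj_incl, proj_incl, ← Finsupp.mapRange_single (hf := map_zero _),
      Finsupp.mapRange_apply]

theorem push_proj_incl_self (i : ι) (n : ℕ) (f : Cochain k A N₀ n) :
    push A (D.proj i) n (push A (D.incl i) n f) = f := by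
  ext v
  simp only [push_apply, proj_incl, Finsupp.single_eq_same]

theorem push_proj_incl_of_ne {i j : ι} (h : i ≠ j) (n : ℕ) (f : Cochain k A N₀ n) :
    push A (D.proj j) n (push A (D.incl i) n f) = 0 := by
  ext v
  simp only [push_apply, proj_incl, Finsupp.single_eq_of_ne' h, _root_.zero_apply]

theorem eventually_sum_incl_proj (m : N) :
    ∀ᶠ s : Finset ι in Filter.atTop, ∑ i ∈ s, D.incl i (D.proj i m) = m := by
  filter_upwards [Filter.eventually_ge_atTop (D.equiv m).support] with s hs
  have h := congrArg D.equiv.symm (Finsupp.sum_of_support_subset (D.equiv m) hs Finsupp.single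
    fun _ _ => Finsupp.single_zero _)
  rw [Finsupp.sum_single, LinearEquiv.symm_apply_apply, map_sum] at h
  exact h.symm

/-- Twisting the left action of a decomposition. -/
def sigmaTwist (σ : A ≃ₐ[k] A) :
    BimoduleDecomp ι (OreHochschild.sigmaTwist σ B₀) (OreHochschild.sigmaTwist σ B) where
  equiv := D.equiv
  isHom_coord i := (D.isHom_coord i).twist _ _

theorem isHom_sigmaTwist_incl (σ : A ≃ₐ[k] A) (i : ι) :
    (OreHochschild.sigmaTwist σ B₀).IsHom (OreHochschild.sigmaTwist σ B) (D.incl i) :=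
  (D.incl_isHom i).twist _ _

theorem isHom_sigmaTwist_proj (σ : A ≃ₐ[k] A) (i : ι) :
    (OreHochschild.sigmaTwist σ B).IsHom (OreHochschild.sigmaTwist σ B₀) (D.proj i) :=
  (D.proj_isHom i).twist _ _

end BimoduleDecomp

end Decomposition

section Decomposition

variable {k : Type u} {A N₀ N : Type v} [CommRing k] [Ring A] [Algebra k A] [Module.Projective k A]
  [AddCommGroup N₀] [Module k N₀] [AddCommGroup N] [Module k N]
  {B₀ : BimoduleStr k A N₀} {B : BimoduleStr k A N} {ι : Type*}

namespace BimoduleDecomp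

theorem eventually_sub_sum_mem_coboundaries (hres : HasFGProjectiveResolution k A)
    (D : BimoduleDecomp ι B₀ B) {d : ℕ} {f : Cochain k A N d} (hf : f ∈ cocycles B d) :
    ∀ᶠ s : Finset ι in Filter.atTop,
      f - ∑ i ∈ s, push A (D.incl i) d (push A (D.proj i) d f) ∈ coboundaries B d := by
  have hP (s : Finset ι) : B.IsHom B (∑ i ∈ s, D.incl i ∘ₗ D.proj i) :=
    BimoduleStr.mem_endo.1 <| sum_mem fun i _ =>
      BimoduleStr.mem_endo.2 ((D.incl_isHom i).comp (D.proj_isHom i))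
  refine (eventually_sub_push_mem_coboundaries hres _ hP (fun m => ?_) hf).mono fun s hs => ?_
  · simpa only [LinearMap.sum_apply, LinearMap.comp_apply] using D.eventually_sum_incl_proj m
  · convert hs using 2
    ext v
    simp [push_apply]

theorem eventually_sub_sum_mem_coboundaries_sigmaTwist (hres : HasFGProjectiveResolution k A)
    (D : BimoduleDecomp ι B₀ B) (σ : A ≃ₐ[k] A) {d : ℕ} {f : Cochain k A N d}
    (hf : f ∈ cocycles (OreHochschild.sigmaTwist σ B) d) :
    ∀ᶠ s : Finset ι in Filter.atTop, f - ∑ i ∈ s, push A (D.incl i) d (push A (D.proj i) d f)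
      ∈ coboundaries (OreHochschild.sigmaTwist σ B) d :=
  (D.sigmaTwist σ).eventually_sub_sum_mem_coboundaries hres hf

theorem cocycles_le_coboundaries (hres : HasFGProjectiveResolution k A)
    (D : BimoduleDecomp ι B₀ B) {d : ℕ} (h : cocycles B₀ d ≤ coboundaries B₀ d) :
    cocycles B d ≤ coboundaries B d := by
  intro f hf
  obtain ⟨s, hs⟩ := (D.eventually_sub_sum_mem_coboundaries hres hf).exists
  refine (Submodule.sub_mem_iff_left _ (Submodule.sum_mem _ fun i _ => ?_)).1 hs
  exact (D.incl_isHom i).push_mem_coboundaries (h ((D.proj_isHom i).push_mem_cocycles hf))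

end BimoduleDecomp

end Decomposition

section TensorHom

variable {k S M M' N N' P : Type*} [CommRing k] [Ring S] [Algebra k S]
  [AddCommGroup M] [Module k M] [AddCommGroup N] [Module k N] [AddCommGroup P] [Module k P]
  [AddCommGroup M'] [Module k M'] [AddCommGroup N'] [Module k N']

theorem BimoduleStr.isHom_of_tmul {B : BimoduleStr k S (M ⊗[k] N)} {B' : BimoduleStr k S P}
    {φ : M ⊗[k] N →ₗ[k] P} (hl : ∀ s m n, φ (B.left s (m ⊗ₜ n)) = B'.left s (φ (m ⊗ₜ n)))
    (hr : ∀ s m n, φ (B.right s (m ⊗ₜ n)) = B'.right s (φ (m ⊗ₜ n))) : B.IsHom B' φ :=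
  ⟨fun s => LinearMap.congr_fun
      (TensorProduct.ext' (g := φ ∘ₗ B.left s) (h := B'.left s ∘ₗ φ) (hl s)),
    fun s => LinearMap.congr_fun
      (TensorProduct.ext' (g := φ ∘ₗ B.right s) (h := B'.right s ∘ₗ φ) (hr s))⟩

namespace BimoduleDecomp

variable {ι : Type*} [DecidableEq ι]

/-- The decomposition of `M ⊗ N`, with its outer structure, given by a decomposition of `M` as a
left module. -/
def outerLeft {B : BimoduleStr k S M} {B' : BimoduleStr k S M'} (B'' : BimoduleStr k S N)
    (e : M ≃ₗ[k] (ι →₀ M')) (he : ∀ s m i, e (B.left s m) i = B'.left s (e m i)) :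
    BimoduleDecomp ι (B'.outer B'') (B.outer B'') where
  equiv := TensorProduct.congr e (.refl k N) ≪≫ₗ TensorProduct.finsuppLeft k k M' N ι
  isHom_coord i := BimoduleStr.isHom_of_tmul
    (fun s m n => by
      simp [BimoduleStr.outer_left_tmul, TensorProduct.finsuppLeft_apply_tmul_apply, he])
    fun s m n => by
      simp [BimoduleStr.outer_right_tmul, TensorProduct.finsuppLeft_apply_tmul_apply]

theorem outerLeft_incl_tmul {B : BimoduleStr k S M} {B' : BimoduleStr k S M'}
    (B'' : BimoduleStr k S N) (e : M ≃ₗ[k] (ι →₀ M'))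
    (he : ∀ s m i, e (B.left s m) i = B'.left s (e m i)) (i : ι) (m : M') (n : N) :
    (outerLeft B'' e he).incl i (m ⊗ₜ n) = e.symm (Finsupp.single i m) ⊗ₜ n := by
  simp [incl, outerLeft, TensorProduct.finsuppLeft_symm_apply_single]

/-- The decomposition of `M ⊗ N`, with its outer structure, given by a decomposition of `N` as a
right module. -/
def outerRight {B : BimoduleStr k S N} {B' : BimoduleStr k S N'} (B'' : BimoduleStr k S M)
    (e : N ≃ₗ[k] (ι →₀ N')) (he : ∀ s n i, e (B.right s n) i = B'.right s (e n i)) :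
    BimoduleDecomp ι (B''.outer B') (B''.outer B) where
  equiv := TensorProduct.congr (.refl k M) e ≪≫ₗ TensorProduct.finsuppRight k k M N' ι
  isHom_coord i := BimoduleStr.isHom_of_tmul
    (fun s m n => by
      simp [BimoduleStr.outer_left_tmul, TensorProduct.finsuppRight_apply_tmul_apply])
    fun s m n => by
      simp [BimoduleStr.outer_right_tmul, TensorProduct.finsuppRight_apply_tmul_apply, he]

theorem outerRight_incl_tmul {B : BimoduleStr k S N} {B' : BimoduleStr k S N'}
    (B'' : BimoduleStr k S M) (e : N ≃ₗ[k] (ι →₀ N'))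
    (he : ∀ s n i, e (B.right s n) i = B'.right s (e n i)) (i : ι) (m : M) (n : N') :
    (outerRight B'' e he).incl i (m ⊗ₜ n) = m ⊗ₜ e.symm (Finsupp.single i n) := by
  simp [incl, outerRight, TensorProduct.finsuppRight_symm_apply_single]

end BimoduleDecomp

end TensorHom

namespace OreExtension

section Tensor

variable {k A : Type*} [CommRing k] [Ring A] [Algebra k A] (σ : A ≃ₐ[k] A) (δ : SkewDerivation σ)

/-- The coefficients `aᵢ` of `∑ aᵢ xⁱ`. -/
def leftCoeffEquiv : OreExtension σ δ ≃ₗ[k] (ℕ →₀ A) := LinearEquiv.refl k (ℕ →₀ A)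

theorem leftCoeffEquiv_symm_single (i : ℕ) (a : A) :
    (leftCoeffEquiv σ δ).symm (Finsupp.single i a) = C σ δ a * X σ δ ^ i :=
  (C_mul_X_pow σ δ a i).symm

theorem leftCoeffEquiv_C_mul (a : A) (e : OreExtension σ δ) (i : ℕ) :
    leftCoeffEquiv σ δ (C σ δ a * e) i = a * leftCoeffEquiv σ δ e i := by
  have hmul : leftCoeffEquiv σ δ (C σ δ a * e) = mulC k A a (leftCoeffEquiv σ δ e) := by
    change mulLeftMap σ δ (Finsupp.single 0 a) e = mulC k A a e
    rw [mulLeftMap_single, pow_zero, mul_one]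
  rw [hmul]
  rfl

/-- The coefficients `bⱼ` of `∑ xʲ bⱼ`. -/
def rightCoeffEquiv : OreExtension σ δ ≃ₗ[k] (ℕ →₀ A) :=
  .ofLinearMap (rightCoeff σ δ) (ofRightCoeff σ δ)
    (Finsupp.lhom_ext fun j b => by
      rw [LinearMap.comp_apply, ofRightCoeff_single, rightCoeff_X_pow_mul_C, LinearMap.id_apply])
    (LinearMap.ext (ofRightCoeff_rightCoeff σ δ))

theorem rightCoeffEquiv_symm_single (j : ℕ) (b : A) :
    (rightCoeffEquiv σ δ).symm (Finsupp.single j b) = X σ δ ^ j * C σ δ b :=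
  ofRightCoeff_single σ δ j b

theorem rightCoeffEquiv_mul_C (e : OreExtension σ δ) (a : A) (j : ℕ) :
    rightCoeffEquiv σ δ (e * C σ δ a) j = rightCoeffEquiv σ δ e j * a :=
  DFunLike.congr_fun (rightCoeff_mul_C σ δ e a) j

/-- The bimodule `E ⊗ E` for `E = A[x; σ, δ]`. -/
abbrev outerE : BimoduleStr k (OreExtension σ δ) (OreExtension σ δ ⊗[k] OreExtension σ δ) :=
  outerTwisted k (AlgHom.id k (OreExtension σ δ))

/-- The `A`-bimodule `A ⊗ E` for `E = A[x; σ, δ]`. -/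
def outerMid : BimoduleStr k A (A ⊗[k] OreExtension σ δ) :=
  (BimoduleStr.regular k A).outer (res (BimoduleStr.regular k (OreExtension σ δ)))

/-- The decomposition `E ⊗ E = ⨁ A xⁱ ⊗ E`. -/
def decompLeft : BimoduleDecomp ℕ (outerMid σ δ) (res (outerE σ δ)) :=
  .outerLeft (B := res (BimoduleStr.regular k (OreExtension σ δ)))
    (B' := BimoduleStr.regular k A) (res (BimoduleStr.regular k (OreExtension σ δ)))
    (leftCoeffEquiv σ δ) (leftCoeffEquiv_C_mul σ δ)

theorem decompLeft_incl_tmul (i : ℕ) (a : A) (e : OreExtension σ δ) :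
    (decompLeft σ δ).incl i (a ⊗ₜ e) = (C σ δ a * X σ δ ^ i) ⊗ₜ e := by
  rw [← leftCoeffEquiv_symm_single]
  exact BimoduleDecomp.outerLeft_incl_tmul _ _ _ i a e

/-- The decomposition `A ⊗ E = ⨁ A ⊗ xʲ A`. -/
def decompRight : BimoduleDecomp ℕ (outerTwisted k (AlgHom.id k A)) (outerMid σ δ) :=
  .outerRight (B' := (BimoduleStr.regular k A).twist (AlgHom.id k A) (AlgHom.id k A))
    (BimoduleStr.regular k A) (rightCoeffEquiv σ δ)
    fun s e j => rightCoeffEquiv_mul_C σ δ e s.unop j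

theorem decompRight_incl_tmul (j : ℕ) (a b : A) :
    (decompRight σ δ).incl j (a ⊗ₜ b) = a ⊗ₜ (X σ δ ^ j * C σ δ b) := by
  rw [← rightCoeffEquiv_symm_single]
  exact BimoduleDecomp.outerRight_incl_tmul _ _ _ j a b

end Tensor

end OreExtension

section QMap

variable {k A : Type*} [CommRing k] [Ring A] [Algebra k A] (σ : A ≃ₐ[k] A) (δ : SkewDerivation σ)

theorem sum_powersetCard_fin_succ {R : Type*} [AddCommMonoid R] (n i : ℕ)
    (F : Finset (Fin (n + 1)) → R) :
    ∑ T ∈ Finset.powersetCard (i + 1) (Finset.univ : Finset (Fin (n + 1))), F T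
      = ∑ T ∈ Finset.powersetCard (i + 1) (Finset.univ : Finset (Fin n)),
          F (T.map (Fin.succEmb n))
        + ∑ T ∈ Finset.powersetCard i (Finset.univ : Finset (Fin n)),
          F (insert 0 (T.map (Fin.succEmb n))) := by
  have h0 : (0 : Fin (n + 1)) ∉ Finset.map (Fin.succEmb n) Finset.univ := by
    simp
  have hu : (Finset.univ : Finset (Fin (n + 1)))
      = insert 0 (Finset.map (Fin.succEmb n) Finset.univ) := by
    rw [Fin.univ_succ, Finset.cons_eq_insert]
    rfl
  rw [hu, Finset.powersetCard_succ_insert h0, Finset.sum_union, Finset.sum_image,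
    Finset.powersetCard_map, Finset.powersetCard_map, Finset.sum_map, Finset.sum_map]
  · rfl
  · intro T hT T' hT' h
    have hT0 : (0 : Fin (n + 1)) ∉ T := fun h => h0 ((Finset.mem_powersetCard.1 hT).1 h)
    have hT0' : (0 : Fin (n + 1)) ∉ T' := fun h => h0 ((Finset.mem_powersetCard.1 hT').1 h)
    rw [← Finset.erase_insert hT0, h, Finset.erase_insert hT0']
  · rw [Finset.disjoint_left]
    intro T hT hT'
    obtain ⟨T', _, rfl⟩ := Finset.mem_image.1 hT'
    exact h0 ((Finset.mem_powersetCard.1 hT).1 (Finset.mem_insert_self _ _))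

theorem qMap_zero_zero : qMap σ δ 0 0 = 1 := by
  simp [qMap]

theorem qMap_of_lt {n i : ℕ} (h : n < i) : qMap σ δ n i = 0 := by
  rw [qMap, Finset.powersetCard_eq_empty.2 (by simpa using h), Finset.sum_empty]

theorem qMap_succ_zero (n : ℕ) : qMap σ δ (n + 1) 0 = -deltaSigmaInv σ δ * qMap σ δ n 0 := by
  simp [qMap, List.ofFn_succ]

theorem qMap_succ_succ (n i : ℕ) : qMap σ δ (n + 1) (i + 1)
    = (σ.symm.toLinearMap : Module.End k A) * qMap σ δ n i
      + -deltaSigmaInv σ δ * qMap σ δ n (i + 1) := by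
  rw [qMap, sum_powersetCard_fin_succ, add_comm, qMap, qMap, Finset.mul_sum, Finset.mul_sum]
  refine congrArg₂ (· + ·) (Finset.sum_congr rfl fun T _ => ?_) (Finset.sum_congr rfl fun T _ => ?_)
  · rw [List.ofFn_succ, List.prod_cons, if_pos (Finset.mem_insert_self _ _)]
    simp [Fin.succ_ne_zero]
  · rw [List.ofFn_succ, List.prod_cons, if_neg (by simp)]
    simp

namespace OreExtension

theorem X_pow_mul_C_mul_X (i : ℕ) (a : A) :
    X σ δ ^ i * C σ δ a * X σ δ = X σ δ ^ (i + 1) * C σ δ (σ.symm a)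
      + X σ δ ^ i * C σ δ ((-deltaSigmaInv σ δ) a) := by
  rw [mul_assoc, C_mul_X, mul_sub, pow_succ, mul_assoc, sub_eq_add_neg, LinearMap.neg_apply,
    map_neg, mul_neg]
  rfl

theorem C_mul_X_pow_eq_sum (n : ℕ) (a : A) : C σ δ a * X σ δ ^ n
    = ∑ i ∈ Finset.range (n + 1), X σ δ ^ i * C σ δ (qMap σ δ n i a) := by
  induction n with
  | zero => simp [qMap_zero_zero]
  | succ n ih =>
    set g : ℕ → OreExtension σ δ := fun i =>
      X σ δ ^ i * C σ δ ((-deltaSigmaInv σ δ) (qMap σ δ n i a)) with hg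
    have hg_shift : ∑ i ∈ Finset.range (n + 1), g i
        = ∑ i ∈ Finset.range (n + 1), g (i + 1) + g 0 := by
      have hlast : g (n + 1) = 0 := by simp [hg, qMap_of_lt σ δ n.lt_succ_self]
      rw [← Finset.sum_range_succ', Finset.sum_range_succ _ (n + 1), hlast, add_zero]
    calc C σ δ a * X σ δ ^ (n + 1)
        = ∑ i ∈ Finset.range (n + 1),
            (X σ δ ^ (i + 1) * C σ δ (σ.symm (qMap σ δ n i a)) + g i) := by
          rw [pow_succ, ← mul_assoc, ih, Finset.sum_mul]
          exact Finset.sum_congr rfl fun i _ => X_pow_mul_C_mul_X σ δ i _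
      _ = ∑ i ∈ Finset.range (n + 1),
            (X σ δ ^ (i + 1) * C σ δ (σ.symm (qMap σ δ n i a)) + g (i + 1)) + g 0 := by
          rw [Finset.sum_add_distrib, hg_shift, ← add_assoc, ← Finset.sum_add_distrib]
      _ = ∑ i ∈ Finset.range (n + 2), X σ δ ^ i * C σ δ (qMap σ δ (n + 1) i a) := by
          rw [Finset.sum_range_succ' _ (n + 1), qMap_succ_zero]
          refine congrArg (· + g 0) (Finset.sum_congr rfl fun i _ => ?_)
          rw [qMap_succ_succ, hg, ← mul_add, ← map_add]
          rfl

end OreExtension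

end QMap

section Quotient

variable {R T P Q : Type*} [Ring R] [AddCommGroup T] [Module R T] [AddCommGroup P] [Module R P]
  [AddCommGroup Q] [Module R Q]

/-- Two quotients of a module with the same kernel are isomorphic. -/
def equivOfKerEq (p : T →ₗ[R] P) (q : T →ₗ[R] Q) (hp : Function.Surjective p)
    (hq : Function.Surjective q) (h : LinearMap.ker p = LinearMap.ker q) : P ≃ₗ[R] Q :=
  (p.quotKerEquivOfSurjective hp).symm ≪≫ₗ Submodule.quotEquivOfEq _ _ h ≪≫ₗ
    q.quotKerEquivOfSurjective hq

theorem equivOfKerEq_apply (p : T →ₗ[R] P) (q : T →ₗ[R] Q) (hp : Function.Surjective p)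
    (hq : Function.Surjective q) (h : LinearMap.ker p = LinearMap.ker q) (t : T) :
    equivOfKerEq p q hp hq h (p t) = q t := by
  have hmk : (p.quotKerEquivOfSurjective hp).symm (p t) = Submodule.Quotient.mk t :=
    (LinearEquiv.symm_apply_eq _).2 rfl
  rw [equivOfKerEq, LinearEquiv.trans_apply, LinearEquiv.trans_apply, hmk]
  rfl

end Quotient

namespace OreExtension

section CommCoker

variable {k A M : Type*} [CommRing k] [Ring A] [Algebra k A] {σ : A ≃ₐ[k] A}
  {δ : SkewDerivation σ} [AddCommGroup M] [Module k M]
  {B : BimoduleStr k (OreExtension σ δ) M} {n : ℕ}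

theorem coneDifferential_toCone {F : Cochain k (OreExtension σ δ) M (n + 1)}
    (hF : F ∈ cocycles B (n + 1)) : coneDifferential B n (toCone σ δ M n F) = 0 := by
  rw [← toCone_differential, mem_cocycles.1 hF, map_zero]

theorem commX_pullC {F : Cochain k (OreExtension σ δ) M (n + 1)}
    (hF : F ∈ cocycles B (n + 1)) : commX B (n + 1) (pullC σ δ M (n + 1) F)
      = differential (resTwist B) n (insertC σ δ M n F) :=
  sub_eq_zero.1 (congrArg Prod.snd (coneDifferential_toCone hF))

theorem commX_pullC_zero {F : Cochain k (OreExtension σ δ) M 0} (hF : F ∈ cocycles B 0) :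
    commX B 0 (pullC σ δ M 0 F) = 0 := by
  have h := toCone_differential_zero B F
  rw [mem_cocycles.1 hF, map_zero] at h
  exact (congrArg Prod.snd h).symm

theorem insertC_sub_commX_mem_cocycles {F : Cochain k (OreExtension σ δ) M (n + 1)}
    (hF : F ∈ cocycles B (n + 1)) {g : Cochain k A M n}
    (hg : differential (res B) n g = pullC σ δ M (n + 1) F) :
    insertC σ δ M n F - commX B n g ∈ cocycles (resTwist B) n := by
  rw [mem_cocycles, map_sub, isCochainMap_commX, hg, commX_pullC hF, sub_self]

theorem toCone_sub_mem_coneCoboundaries {F : Cochain k (OreExtension σ δ) M (n + 1)}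
    {g : Cochain k A M n} (hg : differential (res B) n g = pullC σ δ M (n + 1) F) :
    toCone σ δ M n F - (0, insertC σ δ M n F - commX B n g) ∈ coneCoboundaries B n := by
  refine mem_coneCoboundaries_iff.2 ⟨g, (sub_zero _).trans hg.symm, ?_⟩
  rw [sub_right_comm]
  exact (sub_self (insertC σ δ M n F - commX B n g)).symm ▸ zero_mem _

theorem pullC_zero_injective : Function.Injective (pullC σ δ M 0) := fun f g h => by
  ext v
  have hpull (F : Cochain k (OreExtension σ δ) M 0) : pullC σ δ M 0 F Fin.elim0 = F v :=
    congrArg F (Subsingleton.elim _ _)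
  rw [← hpull f, h, hpull]

variable (B n) in
/-- The coboundaries and the skew commutators of `x` with cocycles. -/
def commBoundaries : Submodule k (Cochain k A M n) :=
  coboundaries (resTwist B) n ⊔ (cocycles (res B) n).map (commX B n)

theorem mem_commBoundaries_iff {y : Cochain k A M n} : y ∈ commBoundaries B n ↔
    ((0, y) : Cochain k A M (n + 1) × Cochain k A M n) ∈ coneCoboundaries B n := by
  rw [mem_coneCoboundaries_iff, commBoundaries, Submodule.mem_sup]
  constructor
  · rintro ⟨b, hb, _, ⟨z, hz, rfl⟩, rfl⟩
    exact ⟨z, (mem_cocycles.1 hz).symm, by rwa [add_sub_cancel_right]⟩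
  · rintro ⟨z, hz, hb⟩
    exact ⟨_, hb, _, ⟨z, mem_cocycles.2 hz.symm, rfl⟩, sub_add_cancel _ _⟩

variable (B n) in
/-- The cokernel of the skew commutator with `x`, as a map from the cohomology of `res B` to that
of `resTwist B`. -/
abbrev CommCoker : Type _ :=
  cocycles (resTwist B) n ⧸ (commBoundaries B n).comap (cocycles (resTwist B) n).subtype

variable (B n) in
/-- The class of a cocycle in the cokernel of the skew commutator. -/
def CommCoker.mk : cocycles (resTwist B) n →ₗ[k] CommCoker B n := Submodule.mkQ _

theorem CommCoker.mk_surjective : Function.Surjective (CommCoker.mk B n) :=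
  Submodule.mkQ_surjective _

theorem CommCoker.mk_eq_zero_iff {y : cocycles (resTwist B) n} :
    CommCoker.mk B n y = 0 ↔ y.1 ∈ commBoundaries B n :=
  (Submodule.Quotient.mk_eq_zero _).trans Iff.rfl

theorem CommCoker.mk_eq_mk_iff {y z : cocycles (resTwist B) n} :
    CommCoker.mk B n y = CommCoker.mk B n z ↔ y.1 - z.1 ∈ commBoundaries B n := by
  rw [← sub_eq_zero, ← map_sub, CommCoker.mk_eq_zero_iff]
  rfl

variable (B n) in
/-- The pairs of a cocycle `F` of `A[x; σ, δ]` and a cocycle `y` of `A` such that `F` and `(0, y)`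
have the same class in the cohomology of the mapping cone of `commX`. -/
def matchingCocycles : Submodule k (cocycles B (n + 1) × cocycles (resTwist B) n) :=
  (coneCoboundaries B n).comap
    ((toCone σ δ M n ∘ₗ (cocycles B (n + 1)).subtype).coprod
      (-(LinearMap.inr k _ _ ∘ₗ (cocycles (resTwist B) n).subtype)))

theorem mem_matchingCocycles {p : cocycles B (n + 1) × cocycles (resTwist B) n} :
    p ∈ matchingCocycles B n ↔ toCone σ δ M n p.1 - (0, p.2.1) ∈ coneCoboundaries B n := by
  rw [sub_eq_add_neg]
  rfl

theorem map_mem_matchingCocycles {φ : Module.End k M} (h : B.IsHom B φ)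
    {p : cocycles B (n + 1) × cocycles (resTwist B) n} (hp : p ∈ matchingCocycles B n) :
    ((⟨push _ φ (n + 1) p.1.1, h.push_mem_cocycles p.1.2⟩,
      ⟨push A φ n p.2.1, (isHom_resTwist h).push_mem_cocycles p.2.2⟩) :
        cocycles B (n + 1) × cocycles (resTwist B) n) ∈ matchingCocycles B n := by
  have hpush := pushCone_mem_coneCoboundaries h (mem_matchingCocycles.1 hp)
  rw [map_sub, ← toCone_push] at hpush
  refine mem_matchingCocycles.2 ?_
  convert hpush using 2
  exact Prod.ext (map_zero (push A φ (n + 1))).symm rfl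

end CommCoker

section CohomologyEquivCoker

variable {k : Type u} {A M : Type v} [CommRing k] [Ring A] [Algebra k A] {σ : A ≃ₐ[k] A}
  {δ : SkewDerivation σ} [AddCommGroup M] [Module k M]
  {B : BimoduleStr k (OreExtension σ δ) M} {n : ℕ}

theorem toCone_mem_coneCoboundaries_iff {F : Cochain k (OreExtension σ δ) M (n + 1)}
    (hF : F ∈ cocycles B (n + 1)) :
    toCone σ δ M n F ∈ coneCoboundaries B n ↔ F ∈ coboundaries B (n + 1) := by
  refine ⟨mem_coboundaries_of_toCone hF, ?_⟩
  rintro ⟨G, rfl⟩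
  cases n with
  | zero => exact ⟨_, (toCone_differential_zero B G).symm⟩
  | succ n => exact ⟨_, (toCone_differential B n G).symm⟩

theorem mem_coboundaries_of_resTwist {F : Cochain k (OreExtension σ δ) M (n + 1)}
    (hF : F ∈ cocycles B (n + 1)) (hpull : pullC σ δ M (n + 1) F ∈ coboundaries (res B) (n + 1))
    (h : cocycles (resTwist B) n ≤ coboundaries (resTwist B) n) :
    F ∈ coboundaries B (n + 1) := by
  obtain ⟨g, hg⟩ := hpull
  exact (toCone_mem_coneCoboundaries_iff hF).1
    (mem_coneCoboundaries_iff.2 ⟨g, hg.symm, h (insertC_sub_commX_mem_cocycles hF hg)⟩)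

theorem exists_mem_matchingCocycles (y : cocycles (resTwist B) n) :
    ∃ F, (F, y) ∈ matchingCocycles B n := by
  obtain ⟨F, hF, h⟩ := exists_toCone_sub_mem (B := B) (c := (0, y.1)) <|
    Prod.ext (map_zero (differential (res B) (n + 1))) <| by
      change commX B (n + 1) 0 - differential (resTwist B) n y.1 = 0
      rw [map_zero, mem_cocycles.1 y.2, sub_zero]
  exact ⟨⟨F, hF⟩, mem_matchingCocycles.2 h⟩

theorem exists_matchingCocycles_of_pullC {F : cocycles B (n + 1)}
    (hF : pullC σ δ M (n + 1) F ∈ coboundaries (res B) (n + 1)) :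
    ∃ y, (F, y) ∈ matchingCocycles B n := by
  obtain ⟨g, hg⟩ := hF
  exact ⟨⟨_, insertC_sub_commX_mem_cocycles F.2 hg⟩,
    mem_matchingCocycles.2 (toCone_sub_mem_coneCoboundaries hg)⟩

theorem mk_eq_zero_iff_of_mem_matchingCocycles {F : cocycles B (n + 1)}
    {y : cocycles (resTwist B) n} (h : (F, y) ∈ matchingCocycles B n) :
    HH.mk B (n + 1) F = 0 ↔ CommCoker.mk B n y = 0 := by
  rw [HH.mk_eq_zero_iff, ← toCone_mem_coneCoboundaries_iff F.2, CommCoker.mk_eq_zero_iff,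
    mem_commBoundaries_iff]
  refine ⟨fun hF => ?_, (Submodule.sub_mem_iff_left _ · |>.1 (mem_matchingCocycles.1 h))⟩
  exact (Submodule.sub_mem_iff_right _ hF).1 (mem_matchingCocycles.1 h)

variable (B n) in
/-- The class of `F` for a pair `(F, y)` of matching cocycles. -/
def matchingToHH : matchingCocycles B n →ₗ[k] HH B (n + 1) :=
  HH.mk B (n + 1) ∘ₗ LinearMap.fst k _ _ ∘ₗ (matchingCocycles B n).subtype

variable (B n) in
/-- The class of `y` for a pair `(F, y)` of matching cocycles. -/
def matchingToCoker : matchingCocycles B n →ₗ[k] CommCoker B n :=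
  CommCoker.mk B n ∘ₗ LinearMap.snd k _ _ ∘ₗ (matchingCocycles B n).subtype

variable (B n) in
theorem ker_matchingToHH : LinearMap.ker (matchingToHH B n) = LinearMap.ker (matchingToCoker B n) :=
  Submodule.ext fun p => mk_eq_zero_iff_of_mem_matchingCocycles p.2

theorem matchingToCoker_surjective : Function.Surjective (matchingToCoker B n) := fun η => by
  obtain ⟨y, rfl⟩ := CommCoker.mk_surjective η
  obtain ⟨F, h⟩ := exists_mem_matchingCocycles y
  exact ⟨⟨(F, y), h⟩, rfl⟩

theorem matchingToHH_surjective
    (hB : ∀ F ∈ cocycles B (n + 1), pullC σ δ M (n + 1) F ∈ coboundaries (res B) (n + 1)) :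
    Function.Surjective (matchingToHH B n) := fun ξ => by
  obtain ⟨F, rfl⟩ := Submodule.mkQ_surjective _ ξ
  obtain ⟨y, h⟩ := exists_matchingCocycles_of_pullC (hB F.1 F.2)
  exact ⟨⟨(F, y), h⟩, rfl⟩

/-- If all cocycles of `A[x; σ, δ]` become coboundaries on `A`, the cohomology of `A[x; σ, δ]` is
the cokernel of the skew commutator with `x` on the cohomology of `A` in degree one less. -/
def cohomologyEquivCoker
    (hB : ∀ F ∈ cocycles B (n + 1), pullC σ δ M (n + 1) F ∈ coboundaries (res B) (n + 1)) :
    HH B (n + 1) ≃ₗ[k] CommCoker B n :=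
  equivOfKerEq (T := matchingCocycles B n) (matchingToHH B n) (matchingToCoker B n)
    (matchingToHH_surjective hB) matchingToCoker_surjective (ker_matchingToHH B n)

variable {hB : ∀ F ∈ cocycles B (n + 1), pullC σ δ M (n + 1) F ∈ coboundaries (res B) (n + 1)}

theorem cohomologyEquivCoker_mk {F : cocycles B (n + 1)} {y : cocycles (resTwist B) n}
    (h : (F, y) ∈ matchingCocycles B n) :
    cohomologyEquivCoker hB (HH.mk B (n + 1) F) = CommCoker.mk B n y := by
  have hF : HH.mk B (n + 1) F = matchingToHH B n ⟨(F, y), h⟩ := rfl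
  rw [hF, cohomologyEquivCoker, equivOfKerEq_apply]
  rfl

theorem cohomologyEquivCoker_cohomologyMap (φ : B.endo) {ξ : HH B (n + 1)}
    {y : cocycles (resTwist B) n} (h : cohomologyEquivCoker hB ξ = CommCoker.mk B n y) :
    cohomologyEquivCoker hB (cohomologyMap B (n + 1) φ ξ) = CommCoker.mk B n
      ⟨push A φ.1 n y.1, (isHom_resTwist (BimoduleStr.mem_endo.1 φ.2)).push_mem_cocycles y.2⟩ := by
  have hφ := BimoduleStr.mem_endo.1 φ.2
  obtain ⟨F, hF⟩ := exists_mem_matchingCocycles y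
  obtain rfl : ξ = HH.mk B (n + 1) F := by
    apply (cohomologyEquivCoker hB).injective
    rw [h, cohomologyEquivCoker_mk hF]
  have hpush : cohomologyMap B (n + 1) φ (HH.mk B (n + 1) F)
      = HH.mk B (n + 1) ⟨push _ φ.1 (n + 1) F.1, hφ.push_mem_cocycles F.2⟩ := rfl
  rw [hpush, cohomologyEquivCoker_mk (map_mem_matchingCocycles hφ hF)]

end CohomologyEquivCoker

end OreExtension

section Retract

variable {k A M N : Type*} [CommRing k] [Ring A] [Algebra k A] [AddCommGroup M] [Module k M]
  [AddCommGroup N] [Module k N] {B : BimoduleStr k A M} {B' : BimoduleStr k A N}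
  {φ : M →ₗ[k] N} {ψ : N →ₗ[k] M}

theorem push_push_of_comp_eq_id (h : ψ ∘ₗ φ = LinearMap.id) (n : ℕ) (f : Cochain k A M n) :
    push A ψ n (push A φ n f) = f := by
  rw [push_push, h]
  rfl

theorem push_mem_coboundaries_iff (hφ : B.IsHom B' φ) (hψ : B'.IsHom B ψ)
    (h : ψ ∘ₗ φ = LinearMap.id) {n : ℕ} {f : Cochain k A M n} :
    push A φ n f ∈ coboundaries B' n ↔ f ∈ coboundaries B n := by
  refine ⟨fun hf => ?_, hφ.push_mem_coboundaries⟩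
  rw [← push_push_of_comp_eq_id h n f]
  exact hψ.push_mem_coboundaries hf

theorem cocycles_le_coboundaries_of_comp_eq_id (hφ : B.IsHom B' φ) (hψ : B'.IsHom B ψ)
    (h : ψ ∘ₗ φ = LinearMap.id) {n : ℕ} (hB' : cocycles B' n ≤ coboundaries B' n) :
    cocycles B n ≤ coboundaries B n := fun _ hf =>
  (push_mem_coboundaries_iff hφ hψ h).1 (hB' (hφ.push_mem_cocycles hf))

end Retract

section SigmaTensor

variable {k A : Type*} [CommRing k] [Ring A] [Algebra k A] (σ : A ≃ₐ[k] A)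
  (N : Type*) [AddCommGroup N] [Module k N] (B : BimoduleStr k A N)

/-- The map `σ ⊗ id` on `A ⊗ N`. -/
abbrev sigmaTensor : Module.End k (A ⊗[k] N) := LinearMap.rTensor N σ.toLinearMap

theorem sigmaTensor_symm_comp : sigmaTensor σ.symm N ∘ₗ sigmaTensor σ N = LinearMap.id := by
  ext
  simp

theorem sigmaTensor_comp_symm : sigmaTensor σ N ∘ₗ sigmaTensor σ.symm N = LinearMap.id :=
  sigmaTensor_symm_comp σ.symm N

variable {N}

theorem isHom_sigmaTensor : ((BimoduleStr.regular k A).outer B).IsHom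
    (sigmaTwist σ ((BimoduleStr.regular k A).outer B)) (sigmaTensor σ N) :=
  BimoduleStr.isHom_of_tmul (fun s a m => congrArg (· ⊗ₜ[k] m) (map_mul σ s a)) fun _ _ _ => rfl

theorem isHom_sigmaTensor_symm : (sigmaTwist σ ((BimoduleStr.regular k A).outer B)).IsHom
    ((BimoduleStr.regular k A).outer B) (sigmaTensor σ.symm N) :=
  BimoduleStr.isHom_of_tmul (fun s a m => congrArg (· ⊗ₜ[k] m) <|
    (map_mul σ.symm (σ s) a).trans (by rw [AlgEquiv.symm_apply_apply]; rfl)) fun _ _ _ => rfl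

theorem push_sigmaTensor_mem_coboundaries_iff {n : ℕ} {f : Cochain k A (A ⊗[k] N) n} :
    push A (sigmaTensor σ N) n f
        ∈ coboundaries (sigmaTwist σ ((BimoduleStr.regular k A).outer B)) n
      ↔ f ∈ coboundaries ((BimoduleStr.regular k A).outer B) n :=
  push_mem_coboundaries_iff (isHom_sigmaTensor σ B) (isHom_sigmaTensor_symm σ B)
    (sigmaTensor_symm_comp σ N)

end SigmaTensor

namespace OreExtension

section CommMid

variable {k A : Type*} [CommRing k] [Ring A] [Algebra k A] (σ : A ≃ₐ[k] A) (δ : SkewDerivation σ)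

/-- Right multiplication by `x` on `A ⊗ E` for `E = A[x; σ, δ]`. -/
def rxMid : Module.End k (A ⊗[k] OreExtension σ δ) :=
  LinearMap.lTensor A (LinearMap.mulRight k (X σ δ))

/-- The skew commutator on the cochains with values in `A ⊗ E` for `E = A[x; σ, δ]` in which
`δ ⊗ id` takes the place of the left action of `x`. -/
def commMid (n : ℕ) :
    Cochain k A (A ⊗[k] OreExtension σ δ) n →ₗ[k] Cochain k A (A ⊗[k] OreExtension σ δ) n :=
  skewCommutator σ δ (LinearMap.rTensor _ δ.toLin) (rxMid σ δ) n

theorem isSkewPair_mid :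
    IsSkewPair σ δ (outerMid σ δ) (LinearMap.rTensor _ δ.toLin) (rxMid σ δ) where
  left_left a := LinearMap.congr_fun <| TensorProduct.ext'
    (g := LinearMap.rTensor _ δ.toLin ∘ₗ (outerMid σ δ).left a)
    (h := (outerMid σ δ).left (σ a) ∘ₗ LinearMap.rTensor _ δ.toLin
      + (outerMid σ δ).left (δ.toLin a)) fun b e =>
    (congrArg (· ⊗ₜ[k] e) ((δ.leibniz a b).trans (add_comm _ _))).trans
      (TensorProduct.add_tmul _ _ _)
  left_right a := LinearMap.congr_fun <| TensorProduct.ext'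
    (g := LinearMap.rTensor _ δ.toLin ∘ₗ (outerMid σ δ).right a)
    (h := (outerMid σ δ).right a ∘ₗ LinearMap.rTensor _ δ.toLin) fun _ _ => rfl
  right_left a := LinearMap.congr_fun <| TensorProduct.ext'
    (g := rxMid σ δ ∘ₗ (outerMid σ δ).left a)
    (h := (outerMid σ δ).left a ∘ₗ rxMid σ δ) fun _ _ => rfl
  right_right a := LinearMap.congr_fun <| TensorProduct.ext'
    (g := (outerMid σ δ).right (MulOpposite.op a) ∘ₗ rxMid σ δ)
    (h := rxMid σ δ ∘ₗ (outerMid σ δ).right (MulOpposite.op (σ a))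
      + (outerMid σ δ).right (MulOpposite.op (δ.toLin a))) fun b e => by
    have hx : e * X σ δ * C σ δ a = e * C σ δ (σ a) * X σ δ + e * C σ δ (δ.toLin a) := by
      rw [mul_assoc, X_mul_C, mul_add, mul_assoc]
    exact (congrArg (b ⊗ₜ[k] ·) hx).trans (TensorProduct.tmul_add _ _ _)

theorem isCochainMap_commMid :
    IsCochainMap (outerMid σ δ) (sigmaTwist σ (outerMid σ δ)) (commMid σ δ) :=
  (isSkewPair_mid σ δ).isCochainMap_skewCommutator

theorem left_X_incl (i : ℕ) (m : A ⊗[k] OreExtension σ δ) :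
    (outerE σ δ).left (X σ δ) ((decompLeft σ δ).incl i m)
      = (decompLeft σ δ).incl (i + 1) (sigmaTensor σ _ m)
        + (decompLeft σ δ).incl i (LinearMap.rTensor _ δ.toLin m) := by
  have h : (outerE σ δ).left (X σ δ) ∘ₗ (decompLeft σ δ).incl i
      = (decompLeft σ δ).incl (i + 1) ∘ₗ sigmaTensor σ _
        + (decompLeft σ δ).incl i ∘ₗ LinearMap.rTensor _ δ.toLin :=
    TensorProduct.ext' fun a e => by
      have hx : X σ δ * (C σ δ a * X σ δ ^ i)
          = C σ δ (σ a) * X σ δ ^ (i + 1) + C σ δ (δ.toLin a) * X σ δ ^ i := by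
        rw [← mul_assoc, X_mul_C, add_mul, pow_succ', mul_assoc]
      simp only [LinearMap.comp_apply, LinearMap.add_apply, LinearMap.rTensor_tmul,
        decompLeft_incl_tmul, AlgEquiv.toLinearMap_apply]
      exact (congrArg (· ⊗ₜ[k] e) hx).trans (TensorProduct.add_tmul _ _ _)
  exact LinearMap.congr_fun h m

theorem right_X_incl (i : ℕ) (m : A ⊗[k] OreExtension σ δ) :
    (outerE σ δ).right (MulOpposite.op (X σ δ)) ((decompLeft σ δ).incl i m)
      = (decompLeft σ δ).incl i (rxMid σ δ m) := by
  have h : (outerE σ δ).right (MulOpposite.op (X σ δ)) ∘ₗ (decompLeft σ δ).incl i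
      = (decompLeft σ δ).incl i ∘ₗ rxMid σ δ := TensorProduct.ext' fun a e => by
    simp only [LinearMap.comp_apply, rxMid, LinearMap.lTensor_tmul, decompLeft_incl_tmul]
    rfl
  exact LinearMap.congr_fun h m

theorem commX_incl (i n : ℕ) (f : Cochain k A (A ⊗[k] OreExtension σ δ) n) :
    commX (outerE σ δ) n (push A ((decompLeft σ δ).incl i) n f)
      = push A ((decompLeft σ δ).incl (i + 1)) n (push A (sigmaTensor σ _) n f)
        + push A ((decompLeft σ δ).incl i) n (commMid σ δ n f) := by
  rw [commX, skewCommutator_apply, skewRight_push σ δ fun m => (right_X_incl σ δ i m).symm,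
    commMid, skewCommutator_apply, map_sub (push A ((decompLeft σ δ).incl i) n), ← add_sub_assoc]
  refine congrArg (· - _) (MultilinearMap.ext fun v => ?_)
  exact left_X_incl σ δ i (f v)

end CommMid

section LeadingCoefficient

variable {k A : Type*} [CommRing k] [Ring A] [Algebra k A] {σ : A ≃ₐ[k] A} {δ : SkewDerivation σ}
  {n : ℕ}

theorem push_proj_sum_commX (w : Cochain k A (A ⊗[k] OreExtension σ δ) n)
    (g : ℕ → Cochain k A (A ⊗[k] OreExtension σ δ) n) (N : ℕ) :
    push A ((decompLeft σ δ).proj (N + 1)) n (push A ((decompLeft σ δ).incl 0) n w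
        + ∑ i ∈ Finset.range (N + 1),
          commX (outerE σ δ) n (push A ((decompLeft σ δ).incl i) n (g i)))
      = push A (sigmaTensor σ _) n (g N) := by
  have hlt : ∀ i < N + 1, ∀ f,
      push A ((decompLeft σ δ).proj (N + 1)) n (push A ((decompLeft σ δ).incl i) n f) = 0 :=
    fun i hi f => (decompLeft σ δ).push_proj_incl_of_ne hi.ne n f
  rw [map_add, hlt 0 N.succ_pos, zero_add, map_sum, Finset.sum_range_succ, Finset.sum_eq_zero,
    zero_add, commX_incl, map_add, hlt N N.lt_succ_self, add_zero,
    (decompLeft σ δ).push_proj_incl_self]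
  intro i hi
  have hi : i < N := Finset.mem_range.1 hi
  rw [commX_incl, map_add, hlt i (by lia), hlt (i + 1) (by lia), add_zero]

/- The coefficient of highest degree in `x` of `∑ [x, xⁱ gᵢ]` is `σ(g_N)`, so that the `gᵢ` are
coboundaries one after the other. -/
theorem mem_coboundaries_of_sum_commX {w : Cochain k A (A ⊗[k] OreExtension σ δ) n}
    {g : ℕ → Cochain k A (A ⊗[k] OreExtension σ δ) n} {N : ℕ}
    (h : push A ((decompLeft σ δ).incl 0) n w + ∑ i ∈ Finset.range N,
        commX (outerE σ δ) n (push A ((decompLeft σ δ).incl i) n (g i))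
      ∈ coboundaries (resTwist (outerE σ δ)) n) :
    w ∈ coboundaries (sigmaTwist σ (outerMid σ δ)) n ∧
      ∀ i < N, g i ∈ coboundaries (outerMid σ δ) n := by
  have hproj := (decompLeft σ δ).isHom_sigmaTwist_proj σ
  induction N with
  | zero =>
    rw [Finset.sum_range_zero, add_zero] at h
    refine ⟨?_, fun i hi => absurd hi (Nat.not_lt_zero i)⟩
    have h0 := (hproj 0).push_mem_coboundaries h
    rwa [(decompLeft σ δ).push_proj_incl_self] at h0
  | succ N ih =>
    have hN : g N ∈ coboundaries (outerMid σ δ) n := by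
      have htop := (hproj (N + 1)).push_mem_coboundaries h
      rw [push_proj_sum_commX] at htop
      exact (push_sigmaTensor_mem_coboundaries_iff σ _).1 htop
    rw [Finset.sum_range_succ, ← add_assoc] at h
    obtain ⟨hw, hg⟩ := ih <| (Submodule.add_mem_iff_left _ <|
      (isCochainMap_commX (outerE σ δ)).mem_coboundaries <|
        ((decompLeft σ δ).incl_isHom N).push_mem_coboundaries hN).1 h
    refine ⟨hw, fun i hi => ?_⟩
    rcases Nat.lt_succ_iff_lt_or_eq.1 hi with hi | rfl
    · exact hg i hi
    · exact hN

end LeadingCoefficient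

section Vanishing

variable {k : Type u} {A : Type v} [CommRing k] [Ring A] [Algebra k A] [Module.Projective k A]
  {σ : A ≃ₐ[k] A} {δ : SkewDerivation σ}

theorem exists_sub_sum_mem_coboundaries (hres : HasFGProjectiveResolution k A) {n : ℕ}
    {f : Cochain k A (OreExtension σ δ ⊗[k] OreExtension σ δ) n}
    (hf : f ∈ cocycles (res (outerE σ δ)) n) :
    ∃ N, f - ∑ i ∈ Finset.range N,
      push A ((decompLeft σ δ).incl i) n (push A ((decompLeft σ δ).proj i) n f)
        ∈ coboundaries (res (outerE σ δ)) n :=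
  (Filter.tendsto_finset_range.eventually <|
    BimoduleDecomp.eventually_sub_sum_mem_coboundaries hres (decompLeft σ δ) hf).exists

theorem mem_coboundaries_of_commX (hres : HasFGProjectiveResolution k A) {n : ℕ}
    {f : Cochain k A (OreExtension σ δ ⊗[k] OreExtension σ δ) n}
    (hf : f ∈ cocycles (res (outerE σ δ)) n)
    (h : commX (outerE σ δ) n f ∈ coboundaries (resTwist (outerE σ δ)) n) :
    f ∈ coboundaries (res (outerE σ δ)) n := by
  obtain ⟨N, hN⟩ := exists_sub_sum_mem_coboundaries hres hf
  have hcomm := (isCochainMap_commX (outerE σ δ)).mem_coboundaries hN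
  rw [map_sub, map_sum, Submodule.sub_mem_iff_right _ h] at hcomm
  obtain ⟨-, hcoeff⟩ := mem_coboundaries_of_sum_commX (w := 0)
    (g := fun i => push A ((decompLeft σ δ).proj i) n f) (by rwa [map_zero, zero_add])
  refine (Submodule.sub_mem_iff_left _ (Submodule.sum_mem _ fun i hi => ?_)).1 hN
  exact ((decompLeft σ δ).incl_isHom i).push_mem_coboundaries (hcoeff i (Finset.mem_range.1 hi))

theorem cocycles_outerMid_le (hres : HasFGProjectiveResolution k A) {n : ℕ}
    (h : Subsingleton (HHEnv k A n)) : cocycles (outerMid σ δ) n ≤ coboundaries (outerMid σ δ) n :=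
  BimoduleDecomp.cocycles_le_coboundaries hres (decompRight σ δ) ((subsingleton_HH_iff _ _).1 h)

theorem cocycles_res_outerE_le (hres : HasFGProjectiveResolution k A) {n : ℕ}
    (h : Subsingleton (HHEnv k A n)) :
    cocycles (res (outerE σ δ)) n ≤ coboundaries (res (outerE σ δ)) n :=
  BimoduleDecomp.cocycles_le_coboundaries hres (decompLeft σ δ) (cocycles_outerMid_le hres h)

theorem cocycles_resTwist_outerE_le (hres : HasFGProjectiveResolution k A) {n : ℕ}
    (h : Subsingleton (HHEnv k A n)) :
    cocycles (resTwist (outerE σ δ)) n ≤ coboundaries (resTwist (outerE σ δ)) n :=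
  BimoduleDecomp.cocycles_le_coboundaries hres ((decompLeft σ δ).sigmaTwist σ) <|
    cocycles_le_coboundaries_of_comp_eq_id (isHom_sigmaTensor_symm σ _) (isHom_sigmaTensor σ _)
      (sigmaTensor_comp_symm σ _) (cocycles_outerMid_le hres h)

variable {d : ℕ} (hd : ∀ i : ℕ, i ≠ d → Subsingleton (HHEnv k A i))
include hd

theorem pullC_mem_coboundaries (hres : HasFGProjectiveResolution k A) {n : ℕ}
    {F : Cochain k (OreExtension σ δ) (OreExtension σ δ ⊗[k] OreExtension σ δ) (n + 1)}
    (hF : F ∈ cocycles (outerE σ δ) (n + 1)) :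
    pullC σ δ _ (n + 1) F ∈ coboundaries (res (outerE σ δ)) (n + 1) := by
  have hpull := (isCochainMap_pull (outerE σ δ) (C σ δ)).mem_cocycles hF
  by_cases hn : n + 1 = d
  · refine mem_coboundaries_of_commX hres hpull ?_
    rw [commX_pullC hF]
    exact differential_mem_coboundaries _ _ _
  · exact cocycles_res_outerE_le hres (hd _ hn) hpull

theorem cocycles_outerE_le (hres : HasFGProjectiveResolution k A) {i : ℕ} (hi : i ≠ d + 1) :
    cocycles (outerE σ δ) i ≤ coboundaries (outerE σ δ) i := by
  intro F hF
  cases i with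
  | zero =>
    have hpull : pullC σ δ _ 0 F ∈ coboundaries (res (outerE σ δ)) 0 := by
      refine mem_coboundaries_of_commX hres
        ((isCochainMap_pull (outerE σ δ) (C σ δ)).mem_cocycles hF) ?_
      rw [commX_pullC_zero hF]
      exact zero_mem _
    have hzero : F = 0 :=
      pullC_zero_injective (((Submodule.mem_bot k).1 hpull).trans (map_zero _).symm)
    exact (Submodule.mem_bot k).2 hzero
  | succ n =>
    exact mem_coboundaries_of_resTwist hF (pullC_mem_coboundaries hd hres hF)
      (cocycles_resTwist_outerE_le hres (hd n (by lia)))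

end Vanishing

end OreExtension

section Ext

variable {k S M : Type*} [CommRing k] [Ring S] [Algebra k S] [AddCommGroup M] [Module k M]

theorem BimoduleStr.ext {B B' : BimoduleStr k S M} (hl : B.left = B'.left)
    (hr : B.right = B'.right) : B = B' := by
  cases B
  cases hl
  cases hr
  rfl

end Ext

section Bijective

variable {k S T M N : Type*} [CommRing k] [Ring S] [Algebra k S] [Ring T] [Algebra k T]
  [AddCommGroup M] [Module k M] [AddCommGroup N] [Module k N]
  {B : BimoduleStr k S M} {B' : BimoduleStr k T N}
  {Φ : ∀ n, Cochain k S M n →ₗ[k] Cochain k T N n} {n : ℕ} {f : Cochain k S M n}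

theorem IsCochainMap.mem_cocycles_iff (hΦ : IsCochainMap B B' Φ)
    (hinj : Function.Injective (Φ (n + 1))) : Φ n f ∈ cocycles B' n ↔ f ∈ cocycles B n := by
  rw [OreHochschild.mem_cocycles, OreHochschild.mem_cocycles, hΦ, map_eq_zero_iff _ hinj]

theorem IsCochainMap.mem_coboundaries_iff (hΦ : IsCochainMap B B' Φ)
    (hbij : ∀ n, Function.Bijective (Φ n)) :
    Φ n f ∈ coboundaries B' n ↔ f ∈ coboundaries B n := by
  refine ⟨fun h => ?_, hΦ.mem_coboundaries⟩
  cases n with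
  | zero => exact (map_eq_zero_iff _ (hbij 0).1).1 h
  | succ n =>
    obtain ⟨g, hg⟩ := h
    obtain ⟨g, rfl⟩ := (hbij n).2 g
    exact ⟨g, (hbij (n + 1)).1 ((hΦ n g).symm.trans hg)⟩

theorem pull_bijective (e : T ≃ₐ[k] S) (n : ℕ) :
    Function.Bijective (pull M (e : T →ₐ[k] S).toLinearMap n) := by
  refine Function.bijective_iff_has_inverse.2
    ⟨pull M (e.symm : S →ₐ[k] T).toLinearMap n, fun f => ?_, fun f => ?_⟩ <;>
  · ext v
    simp [pull_apply]

end Bijective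

section SigmaInv

variable {k A : Type*} [CommRing k] [Ring A] [Algebra k A] (σ : A ≃ₐ[k] A)

theorem outerTwisted_sigmaInv_twist : (outerTwisted k (sigmaInv σ)).twist σ.toAlgHom σ.toAlgHom
    = sigmaTwist σ (outerTwisted k (AlgHom.id k A)) :=
  BimoduleStr.ext rfl <| AlgHom.ext fun s => TensorProduct.ext' fun a b =>
    congrArg (fun c => a ⊗ₜ[k] (b * c)) (σ.symm_apply_apply s.unop)

theorem isCochainMap_pull_sigma : IsCochainMap (outerTwisted k (sigmaInv σ))
    (sigmaTwist σ (outerTwisted k (AlgHom.id k A))) (pull _ (σ : A →ₐ[k] A).toLinearMap) := by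
  rw [← outerTwisted_sigmaInv_twist]
  exact isCochainMap_pull _ _

end SigmaInv

namespace OreExtension

section MonoCochain

variable {k A : Type*} [CommRing k] [Ring A] [Algebra k A] (σ : A ≃ₐ[k] A)
  (δ : SkewDerivation σ)

theorem commBoundaries_le_cocycles {M : Type*} [AddCommGroup M] [Module k M]
    (B : BimoduleStr k (OreExtension σ δ) M) (n : ℕ) :
    commBoundaries B n ≤ cocycles (resTwist B) n := by
  refine sup_le (coboundaries_le_cocycles _ _) ?_
  rintro _ ⟨z, hz, rfl⟩
  exact (isCochainMap_commX B).mem_cocycles hz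

/-- The map `f ↦ (1 ⊗ xⁿ) (f ∘ σ^{⊗ d})` on cochains. -/
def monoCochain (n d : ℕ) :
    Cochain k A (A ⊗[k] A) d →ₗ[k] Cochain k A (OreExtension σ δ ⊗[k] OreExtension σ δ) d :=
  push A ((decompLeft σ δ).incl 0) d ∘ₗ push A ((decompRight σ δ).incl n) d ∘ₗ
    pull _ (σ : A →ₐ[k] A).toLinearMap d

theorem isCochainMap_monoCochain (n : ℕ) : IsCochainMap (outerTwisted k (sigmaInv σ))
    (resTwist (outerE σ δ)) (monoCochain σ δ n) := fun d f => by
  have hleft := ((decompLeft σ δ).isHom_sigmaTwist_incl σ 0).isCochainMap_push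
  have hright := ((decompRight σ δ).isHom_sigmaTwist_incl σ n).isCochainMap_push
  exact (hleft d _).trans (congrArg _ ((hright d _).trans
    (congrArg _ (isCochainMap_pull_sigma σ d f))))

/-- The map induced by `monoCochain` on cocycles. -/
def monoCocycle (d n : ℕ) : cocycles (outerTwisted k (sigmaInv σ)) d →ₗ[k]
    cocycles (resTwist (outerE σ δ)) d :=
  (monoCochain σ δ n d).restrict fun _ hf => (isCochainMap_monoCochain σ δ n).mem_cocycles hf

/-- The map induced by `monoCochain` on cohomology. -/
def monoHH (d n : ℕ) : HHTwisted k (sigmaInv σ) d →ₗ[k] CommCoker (outerE σ δ) d :=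
  Submodule.mapQ _ _ (monoCocycle σ δ d n) fun _ hf =>
    Submodule.mem_sup_left ((isCochainMap_monoCochain σ δ n).mem_coboundaries hf)

theorem monoHH_mk (d n : ℕ) (f : cocycles (outerTwisted k (sigmaInv σ)) d) :
    monoHH σ δ d n (HH.mk _ d f) = CommCoker.mk _ d (monoCocycle σ δ d n f) := rfl

/-- The map `(wₙ)ₙ ↦ ∑ (1 ⊗ xⁿ) wₙ`, from the finitely supported sequences in `Hᵈ(A, A ⊗ A^{σ⁻¹})`
to the cokernel of the skew commutator. -/
def seqToCoker (d : ℕ) : (ℕ →₀ HHTwisted k (sigmaInv σ) d) →ₗ[k] CommCoker (outerE σ δ) d :=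
  Finsupp.lsum k (monoHH σ δ d)

/-- The cocycles whose class is in the range of `seqToCoker`. -/
def seqCocycles (d : ℕ) : Submodule k (Cochain k A (OreExtension σ δ ⊗[k] OreExtension σ δ) d) :=
  ((LinearMap.range (seqToCoker σ δ d)).comap (CommCoker.mk _ d)).map (Submodule.subtype _)

theorem commBoundaries_le_seqCocycles (d : ℕ) :
    commBoundaries (outerE σ δ) d ≤ seqCocycles σ δ d := by
  intro y hy
  refine ⟨⟨y, commBoundaries_le_cocycles σ δ _ _ hy⟩, Submodule.mem_comap.2 ?_, rfl⟩
  rw [CommCoker.mk_eq_zero_iff.2 hy]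
  exact zero_mem _

theorem monoCochain_mem_seqCocycles {d : ℕ} (n : ℕ) {f : Cochain k A (A ⊗[k] A) d}
    (hf : f ∈ cocycles (outerTwisted k (sigmaInv σ)) d) :
    monoCochain σ δ n d f ∈ seqCocycles σ δ d :=
  ⟨monoCocycle σ δ d n ⟨f, hf⟩,
    ⟨Finsupp.single n (HH.mk _ d ⟨f, hf⟩), Finsupp.lsum_single k (monoHH σ δ d) n _⟩, rfl⟩

end MonoCochain

section TensorCoker

variable {k : Type u} {A : Type v} [CommRing k] [Ring A] [Algebra k A] [Module.Projective k A]
  {σ : A ≃ₐ[k] A} {δ : SkewDerivation σ} (hres : HasFGProjectiveResolution k A) {d : ℕ}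
include hres

theorem mem_coboundaries_of_push_incl_mem_commBoundaries
    {w : Cochain k A (A ⊗[k] OreExtension σ δ) d}
    (h : push A ((decompLeft σ δ).incl 0) d w ∈ commBoundaries (outerE σ δ) d) :
    w ∈ coboundaries (sigmaTwist σ (outerMid σ δ)) d := by
  obtain ⟨b, hb, _, ⟨z, hz, rfl⟩, hw⟩ := Submodule.mem_sup.1 h
  obtain ⟨N, hN⟩ := exists_sub_sum_mem_coboundaries hres hz
  refine (mem_coboundaries_of_sum_commX (N := N)
    (g := fun i => -push A ((decompLeft σ δ).proj i) d z) ?_).1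
  have hsum := add_mem hb ((isCochainMap_commX (outerE σ δ)).mem_coboundaries hN)
  rw [map_sub, map_sum, ← add_sub_assoc, hw, sub_eq_add_neg, ← Finset.sum_neg_distrib] at hsum
  refine Set.mem_of_eq_of_mem (congrArg _ (Finset.sum_congr rfl fun i _ => ?_)) hsum
  rw [map_neg (push A ((decompLeft σ δ).incl i) d), map_neg]

theorem push_incl_zero_mem_seqCocycles {w : Cochain k A (A ⊗[k] OreExtension σ δ) d}
    (hw : w ∈ cocycles (sigmaTwist σ (outerMid σ δ)) d) :
    push A ((decompLeft σ δ).incl 0) d w ∈ seqCocycles σ δ d := by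
  obtain ⟨s, hs⟩ :=
    ((decompRight σ δ).eventually_sub_sum_mem_coboundaries_sigmaTwist hres σ hw).exists
  have hsub := commBoundaries_le_seqCocycles σ δ d <| Submodule.mem_sup_left <|
    ((decompLeft σ δ).isHom_sigmaTwist_incl σ 0).push_mem_coboundaries hs
  rw [map_sub (push A ((decompLeft σ δ).incl 0) d), map_sum] at hsub
  refine (Submodule.sub_mem_iff_left _ (Submodule.sum_mem _ fun j _ => ?_)).1 hsub
  obtain ⟨f, hf⟩ := (pull_bijective σ d).2 (push A ((decompRight σ δ).proj j) d w)
  have hproj := ((decompRight σ δ).isHom_sigmaTwist_proj σ j).push_mem_cocycles hw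
  have hcocycle : f ∈ cocycles (outerTwisted k (sigmaInv σ)) d :=
    ((isCochainMap_pull_sigma σ).mem_cocycles_iff (pull_bijective σ _).1).1 (hf ▸ hproj)
  have hmono := monoCochain_mem_seqCocycles σ δ j hcocycle
  rwa [monoCochain, LinearMap.comp_apply, LinearMap.comp_apply, hf] at hmono

/- Modulo the image of the skew commutator, `xⁱ⁺¹ σ(g)` is congruent to an element of degree `i`. -/
theorem push_incl_mem_seqCocycles (i : ℕ) {w : Cochain k A (A ⊗[k] OreExtension σ δ) d}
    (hw : w ∈ cocycles (sigmaTwist σ (outerMid σ δ)) d) :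
    push A ((decompLeft σ δ).incl i) d w ∈ seqCocycles σ δ d := by
  induction i generalizing w with
  | zero => exact push_incl_zero_mem_seqCocycles hres hw
  | succ i ih =>
    have hg := (isHom_sigmaTensor_symm σ _).push_mem_cocycles hw
    have hcomm := commBoundaries_le_seqCocycles σ δ d <| Submodule.mem_sup_right
      ⟨_, ((decompLeft σ δ).incl_isHom i).push_mem_cocycles hg, rfl⟩
    rw [commX_incl, push_push_of_comp_eq_id (sigmaTensor_comp_symm σ _)] at hcomm
    exact (Submodule.add_mem_iff_left _ (ih ((isCochainMap_commMid σ δ).mem_cocycles hg))).1 hcomm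

theorem seqToCoker_surjective : Function.Surjective (seqToCoker σ δ d) := by
  intro κ
  obtain ⟨y, rfl⟩ := CommCoker.mk_surjective κ
  obtain ⟨s, hs⟩ :=
    ((decompLeft σ δ).eventually_sub_sum_mem_coboundaries_sigmaTwist hres σ y.2).exists
  have hsub := commBoundaries_le_seqCocycles σ δ d (Submodule.mem_sup_left hs)
  obtain ⟨z, hz, hzy⟩ : y.1 ∈ seqCocycles σ δ d :=
    (Submodule.sub_mem_iff_left _ (Submodule.sum_mem _ fun i _ => push_incl_mem_seqCocycles hres i
      (((decompLeft σ δ).isHom_sigmaTwist_proj σ i).push_mem_cocycles y.2))).1 hsub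
  obtain rfl : z = y := Subtype.ext hzy
  exact hz

theorem seqToCoker_injective : Function.Injective (seqToCoker σ δ d) := by
  rw [injective_iff_map_eq_zero]
  intro c hc
  choose f hf using fun n => Submodule.mkQ_surjective _ (c n)
  have hsum : CommCoker.mk (outerE σ δ) d (∑ n ∈ c.support, monoCocycle σ δ d n (f n)) = 0 := by
    rw [← hc, seqToCoker, Finsupp.lsum_apply, Finsupp.sum, map_sum]
    exact Finset.sum_congr rfl fun n _ => congrArg (monoHH σ δ d n) (hf n)
  rw [CommCoker.mk_eq_zero_iff, AddSubmonoidClass.coe_finsetSum] at hsum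
  have hmid : ∑ n ∈ c.support, push A ((decompRight σ δ).incl n) d
      (pull _ (σ : A →ₐ[k] A).toLinearMap d (f n).1)
        ∈ coboundaries (sigmaTwist σ (outerMid σ δ)) d := by
    refine mem_coboundaries_of_push_incl_mem_commBoundaries hres ?_
    rwa [map_sum]
  ext n
  by_contra hn
  have hcoeff := ((decompRight σ δ).isHom_sigmaTwist_proj σ n).push_mem_coboundaries hmid
  rw [map_sum, Finset.sum_eq_single_of_mem n (Finsupp.mem_support_iff.2 hn)
    fun j _ hj => (decompRight σ δ).push_proj_incl_of_ne hj d _,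
    (decompRight σ δ).push_proj_incl_self] at hcoeff
  refine hn ((hf n).symm.trans ((HH.mk_eq_zero_iff _ d (f n)).2 ?_))
  exact ((isCochainMap_pull_sigma σ).mem_coboundaries_iff (pull_bijective σ)).1 hcoeff

theorem seqToCoker_bijective : Function.Bijective (seqToCoker σ δ d) :=
  ⟨seqToCoker_injective hres, seqToCoker_surjective hres⟩

end TensorCoker

section TensorEquiv

variable {k : Type u} {A : Type v} [CommRing k] [Ring A] [Algebra k A] [Module.Projective k A]
  {σ : A ≃ₐ[k] A} {δ : SkewDerivation σ} (hres : HasFGProjectiveResolution k A) {d : ℕ}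

/-- The isomorphism `w ⊗ xⁿ ↦ (1 ⊗ xⁿ) w` of `Hᵈ(A, A ⊗ A^{σ⁻¹}) ⊗ k[x]` with the cokernel of the
skew commutator. -/
def tensorEquivCoker :
    HHTwisted k (sigmaInv σ) d ⊗[k] k[X] ≃ₗ[k] CommCoker (outerE σ δ) d :=
  TensorProduct.equivFinsuppOfBasisRight (Polynomial.basisMonomials k) ≪≫ₗ
    .ofBijective (seqToCoker σ δ d) (seqToCoker_bijective hres)

theorem tensorEquivCoker_tmul (f : cocycles (outerTwisted k (sigmaInv σ)) d) (n : ℕ) :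
    tensorEquivCoker (δ := δ) hres (HH.mk _ d f ⊗ₜ[k] (Polynomial.X ^ n : k[X]))
      = CommCoker.mk _ d (monoCocycle σ δ d n f) := by
  have hseq : TensorProduct.equivFinsuppOfBasisRight (Polynomial.basisMonomials k)
      (HH.mk _ d f ⊗ₜ[k] (Polynomial.X ^ n : k[X])) = Finsupp.single n (HH.mk _ d f) := by
    rw [← LinearEquiv.eq_symm_apply, TensorProduct.equivFinsuppOfBasisRight_symm_apply,
      Finsupp.sum_single_index, Polynomial.coe_basisMonomials, Polynomial.X_pow_eq_monomial]
    exact TensorProduct.zero_tmul _ _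
  rw [tensorEquivCoker, LinearEquiv.trans_apply, hseq, LinearEquiv.ofBijective_apply, seqToCoker,
    Finsupp.lsum_single, monoHH_mk]

end TensorEquiv

end OreExtension

section Transport

variable {k S M N : Type*} [CommRing k] [Ring S] [Algebra k S] [AddCommGroup M] [Module k M]
  [AddCommGroup N] [Module k N]

/-- Transport of a bimodule structure along a linear isomorphism. -/
def BimoduleStr.transport (B : BimoduleStr k S M) (Φ : M ≃ₗ[k] N) : BimoduleStr k S N where
  left := (Φ.conjAlgEquiv k).toAlgHom.comp B.left
  right := (Φ.conjAlgEquiv k).toAlgHom.comp B.right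
  comm a b := (B.comm a b).map (Φ.conjAlgEquiv k).toAlgHom

theorem BimoduleStr.isHom_transport (B : BimoduleStr k S M) (Φ : M ≃ₗ[k] N) :
    B.IsHom (B.transport Φ) Φ.toLinearMap :=
  ⟨fun s m => congrArg (fun m => Φ (B.left s m)) (Φ.symm_apply_apply m).symm,
    fun s m => congrArg (fun m => Φ (B.right s m)) (Φ.symm_apply_apply m).symm⟩

end Transport

namespace OreExtension

variable {k A : Type*} [CommRing k] [Ring A] [Algebra k A] (σ : A ≃ₐ[k] A) (δ : SkewDerivation σ)

section Inner

theorem innerE_left_C (a : A) (n : ℕ) (m : A ⊗[k] A) :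
    (innerTwisted k (AlgHom.id k (OreExtension σ δ))).left (C σ δ a)
        ((decompLeft σ δ).incl 0 ((decompRight σ δ).incl n m))
      = ∑ i ∈ Finset.range (n + 1), (decompLeft σ δ).incl 0 ((decompRight σ δ).incl i
          ((innerTwisted k (sigmaInv σ)).left (qMap σ δ n i a) m)) := by
  induction m with
  | zero => simp only [map_zero, Finset.sum_const_zero]
  | add x y hx hy => simp only [map_add, hx, hy, Finset.sum_add_distrib]
  | tmul u w =>
    have hinner (i : ℕ) : (decompRight σ δ).incl i
        ((innerTwisted k (sigmaInv σ)).left (qMap σ δ n i a) (u ⊗ₜ[k] w))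
        = u ⊗ₜ[k] (X σ δ ^ i * C σ δ (qMap σ δ n i a) * C σ δ w) := by
      rw [mul_assoc, ← map_mul]
      exact decompRight_incl_tmul σ δ i u _
    simp only [hinner, decompRight_incl_tmul, decompLeft_incl_tmul, ← TensorProduct.tmul_sum,
      ← Finset.sum_mul, ← C_mul_X_pow_eq_sum]
    exact congrArg (_ ⊗ₜ[k] ·) (mul_assoc _ _ _).symm

theorem innerE_left_X (n : ℕ) (m : A ⊗[k] A) :
    (innerTwisted k (AlgHom.id k (OreExtension σ δ))).left (X σ δ)
        ((decompLeft σ δ).incl 0 ((decompRight σ δ).incl n m))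
      = (decompLeft σ δ).incl 0 ((decompRight σ δ).incl (n + 1) m) := by
  induction m with
  | zero => simp only [map_zero]
  | add x y hx hy => simp only [map_add, hx, hy]
  | tmul u w =>
    simp only [decompRight_incl_tmul, decompLeft_incl_tmul, pow_succ' (X σ δ) n, mul_assoc (X σ δ)]
    rfl

theorem innerE_right_C (a : A) (n : ℕ) (m : A ⊗[k] A) :
    (innerTwisted k (AlgHom.id k (OreExtension σ δ))).right (MulOpposite.op (C σ δ a))
        ((decompLeft σ δ).incl 0 ((decompRight σ δ).incl n m))
      = (decompLeft σ δ).incl 0 ((decompRight σ δ).incl n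
          ((innerTwisted k (sigmaInv σ)).right (MulOpposite.op a) m)) := by
  induction m with
  | zero => simp only [map_zero]
  | add x y hx hy => simp only [map_add, hx, hy]
  | tmul u w =>
    have hinner : (innerTwisted k (sigmaInv σ)).right (MulOpposite.op a) (u ⊗ₜ[k] w)
        = (u * a) ⊗ₜ[k] w := rfl
    simp only [hinner, decompRight_incl_tmul, decompLeft_incl_tmul, pow_zero, mul_one, map_mul]
    rfl

theorem innerE_right_X (m : A ⊗[k] OreExtension σ δ) :
    (innerTwisted k (AlgHom.id k (OreExtension σ δ))).right (MulOpposite.op (X σ δ))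
      ((decompLeft σ δ).incl 0 m) = (decompLeft σ δ).incl 1 m := by
  induction m with
  | zero => simp only [map_zero]
  | add x y hx hy => simp only [map_add, hx, hy]
  | tmul u w =>
    simp only [decompLeft_incl_tmul, pow_zero, mul_one, pow_one]
    rfl

end Inner

section CommMidIncl

theorem rxMid_incl (n : ℕ) (m : A ⊗[k] A) :
    rxMid σ δ ((decompRight σ δ).incl n m)
      = (decompRight σ δ).incl (n + 1) (LinearMap.lTensor A σ.symm.toLinearMap m)
        - (decompRight σ δ).incl n (LinearMap.lTensor A (deltaSigmaInv σ δ) m) := by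
  induction m with
  | zero => simp only [map_zero, sub_zero]
  | add x y hx hy =>
    simp only [map_add, hx, hy]
    abel
  | tmul u w =>
    have hx : X σ δ ^ n * C σ δ w * X σ δ
        = X σ δ ^ (n + 1) * C σ δ (σ.symm w) - X σ δ ^ n * C σ δ (deltaSigmaInv σ δ w) := by
      rw [X_pow_mul_C_mul_X, LinearMap.neg_apply, map_neg, mul_neg, sub_eq_add_neg]
    simp only [rxMid, LinearMap.lTensor_tmul, decompRight_incl_tmul, LinearMap.mulRight_apply, hx,
      TensorProduct.tmul_sub, AlgEquiv.toLinearMap_apply]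

theorem rTensor_delta_incl (n : ℕ) (m : A ⊗[k] A) :
    LinearMap.rTensor _ δ.toLin ((decompRight σ δ).incl n m)
      = (decompRight σ δ).incl n (LinearMap.rTensor A δ.toLin m) := by
  induction m with
  | zero => simp only [map_zero]
  | add x y hx hy => simp only [map_add, hx, hy]
  | tmul u w => simp only [decompRight_incl_tmul, LinearMap.rTensor_tmul]

theorem pull_f₃ {d : ℕ} (f : Cochain k A (A ⊗[k] A) d) :
    pull _ (σ : A →ₐ[k] A).toLinearMap d (f₃ σ δ f) = skewCommutator σ δ
      (LinearMap.rTensor A δ.toLin) (-LinearMap.lTensor A (deltaSigmaInv σ δ)) d f := by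
  have hsymm : ∀ a : A, σ.symm.toLinearMap (σ a) = a := σ.symm_apply_apply
  have hdelta (a : A) : deltaSigmaInv σ δ (σ a) = δ.toLin a :=
    congrArg δ.toLin (σ.symm_apply_apply a)
  ext v
  have hterm (i j : Fin d) : (if i < j then LinearMap.id else if i = j then deltaSigmaInv σ δ
      else σ.symm.toLinearMap) (σ (v i))
      = if i < j then σ (v i) else if i = j then δ.toLin (v i) else v i := by
    split_ifs <;> simp only [LinearMap.id_apply, hdelta, hsymm]
  rw [skewCommutator_apply, sub_apply, skewRight_apply, pull_apply, ← sub_sub, LinearMap.neg_apply,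
    sub_neg_eq_add]
  simp only [f₃, sub_apply, add_apply, sum_apply, LinearMap.compMultilinearMap_apply,
    MultilinearMap.compLinearMap_apply, AlgHom.toLinearMap_apply, AlgEquiv.toAlgHom_apply, hsymm,
    hterm, push_apply]

theorem pull_f₂ {d : ℕ} (f : Cochain k A (A ⊗[k] A) d) :
    pull _ (σ : A →ₐ[k] A).toLinearMap d (f₂ σ f)
      = push A (LinearMap.lTensor A σ.symm.toLinearMap) d
          (pull _ (σ : A →ₐ[k] A).toLinearMap d f) := rfl

theorem commMid_incl (n : ℕ) {d : ℕ} (f : Cochain k A (A ⊗[k] A) d) :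
    commMid σ δ d (push A ((decompRight σ δ).incl n) d f)
      = push A ((decompRight σ δ).incl n) d (pull _ (σ : A →ₐ[k] A).toLinearMap d (f₃ σ δ f))
        - push A ((decompRight σ δ).incl (n + 1)) d
            (pull _ (σ : A →ₐ[k] A).toLinearMap d (f₂ σ f)) := by
  ext v
  rw [pull_f₃, pull_f₂, commMid, skewCommutator_apply, skewCommutator_apply]
  simp only [sub_apply, push_apply, skewRight_apply, rTensor_delta_incl, rxMid_incl, map_sub,
    map_add, map_sum, LinearMap.neg_apply, map_neg, pull_apply, AlgHom.toLinearMap_apply,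
    AlgEquiv.toAlgHom_apply]
  abel

end CommMidIncl

end OreExtension

namespace OreExtension

section Untwist

variable {k A : Type*} [CommRing k] [Ring A] [Algebra k A] (σ : A ≃ₐ[k] A) (δ : SkewDerivation σ)
  {d : ℕ} {f : Cochain k A (A ⊗[k] A) d}

theorem untwist_mem_cocycles (hf : f ∈ cocycles (outerTwisted k (sigmaInv σ)) d) :
    untwist σ f ∈ cocycles (outerTwisted k (AlgHom.id k A)) d :=
  (isHom_sigmaTensor_symm σ _).push_mem_cocycles ((isCochainMap_pull_sigma σ).mem_cocycles hf)

theorem sigmaTensor_decompRight_incl (n : ℕ) (m : A ⊗[k] A) :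
    sigmaTensor σ _ ((decompRight σ δ).incl n m)
      = (decompRight σ δ).incl n (sigmaTensor σ A m) := by
  induction m with
  | zero => simp only [map_zero]
  | add x y hx hy => simp only [map_add, hx, hy]
  | tmul u w => simp only [decompRight_incl_tmul, LinearMap.rTensor_tmul]

theorem push_sigmaTensor_push_untwist (n : ℕ) (f : Cochain k A (A ⊗[k] A) d) :
    push A (sigmaTensor σ _) d (push A ((decompRight σ δ).incl n) d (untwist σ f))
      = push A ((decompRight σ δ).incl n) d (pull _ (σ : A →ₐ[k] A).toLinearMap d f) := by
  rw [← push_push_of_comp_eq_id (sigmaTensor_comp_symm σ A) d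
    (pull _ (σ : A →ₐ[k] A).toLinearMap d f)]
  exact MultilinearMap.ext fun v => sigmaTensor_decompRight_incl σ δ n (untwist σ f v)

/- The relation is the skew commutator of `x` with `xⁿ (σ⁻¹ ⊗ id) f`. -/
theorem push_incl_one_sub_mem_commBoundaries
    (hf : f ∈ cocycles (outerTwisted k (sigmaInv σ)) d) (n : ℕ) :
    push A ((decompLeft σ δ).incl 1) d (push A ((decompRight σ δ).incl n) d
        (pull _ (σ : A →ₐ[k] A).toLinearMap d f))
      - (monoCochain σ δ (n + 1) d (f₂ σ (untwist σ f))
        - monoCochain σ δ n d (f₃ σ δ (untwist σ f))) ∈ commBoundaries (outerE σ δ) d := by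
  have hcomm : commX (outerE σ δ) d (push A ((decompLeft σ δ).incl 0) d
      (push A ((decompRight σ δ).incl n) d (untwist σ f))) ∈ commBoundaries (outerE σ δ) d :=
    Submodule.mem_sup_right ⟨_, ((decompLeft σ δ).incl_isHom 0).push_mem_cocycles
      (((decompRight σ δ).incl_isHom n).push_mem_cocycles (untwist_mem_cocycles σ hf)), rfl⟩
  rw [commX_incl, push_sigmaTensor_push_untwist, commMid_incl,
    map_sub (push A ((decompLeft σ δ).incl 0) d)] at hcomm
  rwa [sub_sub_eq_add_sub, add_sub_assoc]

theorem f₂_f₃_mem_cocycles (hf : f ∈ cocycles (outerTwisted k (sigmaInv σ)) d) :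
    f₂ σ (untwist σ f) ∈ cocycles (outerTwisted k (sigmaInv σ)) d ∧
      f₃ σ δ (untwist σ f) ∈ cocycles (outerTwisted k (sigmaInv σ)) d := by
  have hcomm := (isCochainMap_commMid σ δ).mem_cocycles
    (((decompRight σ δ).incl_isHom 0).push_mem_cocycles (untwist_mem_cocycles σ hf))
  rw [commMid_incl, zero_add] at hcomm
  have hproj (i : ℕ) := ((decompRight σ δ).isHom_sigmaTwist_proj σ i).push_mem_cocycles hcomm
  have hiff {g : Cochain k A (A ⊗[k] A) d} :=
    (isCochainMap_pull_sigma σ).mem_cocycles_iff (f := g) (pull_bijective σ (d + 1)).1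
  constructor
  · have hf₂ := hproj 1
    rw [map_sub (push A ((decompRight σ δ).proj 1) d),
      (decompRight σ δ).push_proj_incl_of_ne zero_ne_one, (decompRight σ δ).push_proj_incl_self,
      zero_sub, neg_mem_iff] at hf₂
    exact hiff.1 hf₂
  · have hf₃ := hproj 0
    rw [map_sub (push A ((decompRight σ δ).proj 0) d),
      (decompRight σ δ).push_proj_incl_of_ne one_ne_zero, (decompRight σ δ).push_proj_incl_self,
      sub_zero] at hf₃
    exact hiff.1 hf₃

end Untwist

section Dualizing

variable {k : Type u} {A : Type v} [CommRing k] [Ring A] [Algebra k A] [Module.Projective k A]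
  {σ : A ≃ₐ[k] A} {δ : SkewDerivation σ} {d : ℕ} (hres : HasFGProjectiveResolution k A)
  (hd : ∀ i : ℕ, i ≠ d → Subsingleton (HHEnv k A i))

/-- The isomorphism `Ω ≅ ω' ⊗ k[x]`. -/
def dualizingEquiv : HHEnv k (OreExtension σ δ) (d + 1) ≃ₗ[k]
    HHTwisted k (sigmaInv σ) d ⊗[k] k[X] :=
  cohomologyEquivCoker (B := outerE σ δ) (n := d)
    (fun _ hF => pullC_mem_coboundaries hd hres hF) ≪≫ₗ (tensorEquivCoker hres).symm

/-- The bimodule structure on `ω' ⊗ k[x]` transported from `Ω`. -/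
def dualizingBimod :
    BimoduleStr k (OreExtension σ δ) (HHTwisted k (sigmaInv σ) d ⊗[k] k[X]) :=
  (bimodHHEnv k (OreExtension σ δ) (d + 1)).transport (dualizingEquiv hres hd)

theorem dualizingEquiv_cohomologyMap (φ : (outerE σ δ).endo)
    {f : cocycles (outerTwisted k (sigmaInv σ)) d} {n : ℕ}
    {t : HHTwisted k (sigmaInv σ) d ⊗[k] k[X]} {y : cocycles (resTwist (outerE σ δ)) d}
    (ht : tensorEquivCoker hres t = CommCoker.mk _ d y)
    (h : push A φ.1 d (monoCochain σ δ n d f.1) - y.1 ∈ commBoundaries (outerE σ δ) d) :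
    dualizingEquiv hres hd (cohomologyMap (outerE σ δ) (d + 1) φ
      ((dualizingEquiv hres hd).symm
        (HH.mk _ d f ⊗ₜ[k] (Polynomial.X ^ n : k[X])))) = t := by
  rw [dualizingEquiv, LinearEquiv.trans_apply, LinearEquiv.symm_apply_eq, ht,
    cohomologyEquivCoker_cohomologyMap φ (y := monoCocycle σ δ d n f), CommCoker.mk_eq_mk_iff]
  · exact h
  · rw [LinearEquiv.symm_trans_apply, LinearEquiv.symm_symm, LinearEquiv.apply_symm_apply,
      tensorEquivCoker_tmul]

theorem dualizingBimod_left_C (a : A) (w : HHTwisted k (sigmaInv σ) d) (n : ℕ) :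
    (dualizingBimod (δ := δ) hres hd).left (C σ δ a) (w ⊗ₜ[k] (Polynomial.X ^ n : k[X])) =
      ∑ i ∈ Finset.range (n + 1),
        (bimodHHTwisted k (sigmaInv σ) d).left (qMap σ δ n i a) w ⊗ₜ[k]
          (Polynomial.X ^ i : k[X]) := by
  obtain ⟨f, rfl⟩ : ∃ f, HH.mk _ d f = w := Submodule.mkQ_surjective _ w
  refine dualizingEquiv_cohomologyMap hres hd
    ⟨_, innerTwisted_left_mem k (AlgHom.id k (OreExtension σ δ)) (C σ δ a)⟩
    (y := ∑ i ∈ Finset.range (n + 1), monoCocycle σ δ d i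
      ⟨postcomp k A _ d ((innerTwisted k (sigmaInv σ)).left (qMap σ δ n i a)) f.1,
        postcomp_mem_cocycles _ d (innerTwisted_left_mem k _ _) f.2⟩) ?_ ?_
  · rw [map_sum, map_sum]
    exact Finset.sum_congr rfl fun i _ => tensorEquivCoker_tmul hres _ i
  · refine Set.mem_of_eq_of_mem (sub_eq_zero.2 ?_) (Submodule.zero_mem _)
    rw [AddSubmonoidClass.coe_finsetSum]
    ext v
    rw [sum_apply]
    exact innerE_left_C σ δ a n _

theorem dualizingBimod_left_X (w : HHTwisted k (sigmaInv σ) d) (n : ℕ) :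
    (dualizingBimod (δ := δ) hres hd).left (X σ δ) (w ⊗ₜ[k] (Polynomial.X ^ n : k[X])) =
      w ⊗ₜ[k] (Polynomial.X ^ (n + 1) : k[X]) := by
  obtain ⟨f, rfl⟩ : ∃ f, HH.mk _ d f = w := Submodule.mkQ_surjective _ w
  refine dualizingEquiv_cohomologyMap hres hd
    ⟨_, innerTwisted_left_mem k (AlgHom.id k (OreExtension σ δ)) (X σ δ)⟩
    (tensorEquivCoker_tmul hres f (n + 1))
    (Set.mem_of_eq_of_mem (sub_eq_zero.2 ?_) (Submodule.zero_mem _))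
  exact MultilinearMap.ext fun v => innerE_left_X σ δ n _

theorem dualizingBimod_right_C (a : A) (w : HHTwisted k (sigmaInv σ) d) (n : ℕ) :
    (dualizingBimod (δ := δ) hres hd).right (MulOpposite.op (C σ δ a))
        (w ⊗ₜ[k] (Polynomial.X ^ n : k[X])) =
      (bimodHHTwisted k (sigmaInv σ) d).right (MulOpposite.op a) w ⊗ₜ[k]
        (Polynomial.X ^ n : k[X]) := by
  obtain ⟨f, rfl⟩ : ∃ f, HH.mk _ d f = w := Submodule.mkQ_surjective _ w
  refine dualizingEquiv_cohomologyMap hres hd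
    ⟨_, innerTwisted_right_mem k (AlgHom.id k (OreExtension σ δ)) (.op (C σ δ a))⟩
    (tensorEquivCoker_tmul hres
      ⟨postcomp k A _ d ((innerTwisted k (sigmaInv σ)).right (MulOpposite.op a)) f.1,
        postcomp_mem_cocycles _ d (innerTwisted_right_mem k _ _) f.2⟩ n)
    (Set.mem_of_eq_of_mem (sub_eq_zero.2 ?_) (Submodule.zero_mem _))
  exact MultilinearMap.ext fun v => innerE_right_C σ δ a n _

theorem dualizingBimod_right_X (g : cocycles (outerTwisted k (sigmaInv σ)) d)
    (h₂ : f₂ σ (untwist σ g.1) ∈ cocycles (outerTwisted k (sigmaInv σ)) d)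
    (h₃ : f₃ σ δ (untwist σ g.1) ∈ cocycles (outerTwisted k (sigmaInv σ)) d) (n : ℕ) :
    (dualizingBimod (δ := δ) hres hd).right (MulOpposite.op (X σ δ))
        (HH.mk _ d g ⊗ₜ[k] (Polynomial.X ^ n : k[X])) =
      HH.mk (outerTwisted k (sigmaInv σ)) d ⟨_, h₂⟩ ⊗ₜ[k] (Polynomial.X ^ (n + 1) : k[X]) -
        HH.mk (outerTwisted k (sigmaInv σ)) d ⟨_, h₃⟩ ⊗ₜ[k] (Polynomial.X ^ n : k[X]) := by
  refine dualizingEquiv_cohomologyMap hres hd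
    ⟨_, innerTwisted_right_mem k (AlgHom.id k (OreExtension σ δ)) (.op (X σ δ))⟩
    (y := monoCocycle σ δ d (n + 1) ⟨_, h₂⟩ - monoCocycle σ δ d n ⟨_, h₃⟩) ?_ ?_
  · rw [map_sub, map_sub (CommCoker.mk (outerE σ δ) d), tensorEquivCoker_tmul,
      tensorEquivCoker_tmul]
  · refine Set.mem_of_eq_of_mem (congrArg₂ (· - ·) ?_ rfl)
      (push_incl_one_sub_mem_commBoundaries σ δ g.2 n)
    exact MultilinearMap.ext fun v => innerE_right_X σ δ _

end Dualizing

end OreExtension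

end

end OreHochschild

open OreHochschild in
theorem mainTheorem3 {k : Type*} {A : Type*} [CommRing k] [Ring A] [Algebra k A]
    (hproj : Module.Projective k A) (σ : A ≃ₐ[k] A) (δ : SkewDerivation σ)
    (hres : HasFGProjectiveResolution k A) (d : ℕ)
    (hd : ∀ i : ℕ, i ≠ d → Subsingleton (HHEnv k A i)) :
    (∀ i : ℕ, i ≠ d + 1 → Subsingleton (HHEnv k (OreExtension σ δ) i)) ∧
    ∃ (B : BimoduleStr k (OreExtension σ δ) (HHTwisted k (sigmaInv σ) d ⊗[k] k[X]))
      (Φ : HHEnv k (OreExtension σ δ) (d + 1) ≃ₗ[k] HHTwisted k (sigmaInv σ) d ⊗[k] k[X]),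
      (bimodHHEnv k (OreExtension σ δ) (d + 1)).IsHom B Φ.toLinearMap ∧
      (∀ (a : A) (w : HHTwisted k (sigmaInv σ) d) (n : ℕ),
        B.left (OreExtension.C σ δ a) (w ⊗ₜ[k] (Polynomial.X ^ n : k[X])) =
          ∑ i ∈ Finset.range (n + 1),
            (bimodHHTwisted k (sigmaInv σ) d).left (qMap σ δ n i a) w ⊗ₜ[k]
              (Polynomial.X ^ i : k[X])) ∧
      (∀ (w : HHTwisted k (sigmaInv σ) d) (n : ℕ),
        B.left (OreExtension.X σ δ) (w ⊗ₜ[k] (Polynomial.X ^ n : k[X])) =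
          w ⊗ₜ[k] (Polynomial.X ^ (n + 1) : k[X])) ∧
      (∀ (a : A) (w : HHTwisted k (sigmaInv σ) d) (n : ℕ),
        B.right (MulOpposite.op (OreExtension.C σ δ a)) (w ⊗ₜ[k] (Polynomial.X ^ n : k[X])) =
          (bimodHHTwisted k (sigmaInv σ) d).right (MulOpposite.op a) w ⊗ₜ[k]
            (Polynomial.X ^ n : k[X])) ∧
      (∀ g : cocycles (outerTwisted k (sigmaInv σ)) d,
        ∃ (h₂ : f₂ σ (untwist σ g.1) ∈ cocycles (outerTwisted k (sigmaInv σ)) d)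
          (h₃ : f₃ σ δ (untwist σ g.1) ∈ cocycles (outerTwisted k (sigmaInv σ)) d),
          ∀ n : ℕ,
            B.right (MulOpposite.op (OreExtension.X σ δ))
                (HH.mk (outerTwisted k (sigmaInv σ)) d g ⊗ₜ[k] (Polynomial.X ^ n : k[X])) =
              HH.mk (outerTwisted k (sigmaInv σ)) d ⟨_, h₂⟩ ⊗ₜ[k]
                  (Polynomial.X ^ (n + 1) : k[X]) -
                HH.mk (outerTwisted k (sigmaInv σ)) d ⟨_, h₃⟩ ⊗ₜ[k]
                  (Polynomial.X ^ n : k[X])) := by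
  refine ⟨fun i hi => (subsingleton_HH_iff _ _).2 (OreExtension.cocycles_outerE_le hd hres hi),
    OreExtension.dualizingBimod hres hd, OreExtension.dualizingEquiv hres hd,
    BimoduleStr.isHom_transport _ _, OreExtension.dualizingBimod_left_C hres hd,
    OreExtension.dualizingBimod_left_X hres hd, OreExtension.dualizingBimod_right_C hres hd,
    fun g => ?_⟩
  obtain ⟨h₂, h₃⟩ := OreExtension.f₂_f₃_mem_cocycles σ δ g.2
  exact ⟨h₂, h₃, OreExtension.dualizingBimod_right_X hres hd g h₂ h₃⟩
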